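/- Let $n\ge 1$. A cube is an axis-parallel cube in $\mathbb{R}^n$; $Q_R$ is the cube with center $0$ and side length $R$. For a cube $Q$ and $1\le p<\infty$ put $\langle f\rangle_{p,Q}=|Q|^{-1/p}\|f\|_{L^p(Q)}$. A collection $\mathcal S$ of cubes is $\eta$-sparse ($0<\eta<1$) if there are pairwise disjoint measurable sets $E_Q\subset Q$ $(Q\in\mathcal S)$ with $|E_Q|>\eta|Q|$. For $\alpha>0$ put $$\Lambda^{\alpha}_{\mathcal S,r,s}(f,g)=\Big(\sum_{Q\in\mathcal S}|Q|\,\langle f\rangle_{r,Q}^{\alpha}\langle g\rangle_{s,Q}^{\alpha}\Big)^{1/\alpha}\in[0,\infty].$$ With $\hat f(\xi)=\int e^{-ix\cdot\xi}f(x)\,dx$, fix $\hat\psi\in C_c^\infty(\mathbb{R}^n)$ real-valued with $\hat\psi=1$ for $|\xi|\le 1$ and $\operatorname{supp}\hat\psi\subset\{|\xi|\le 2\}$, and let $\phi_j$ be given by $\hat\phi_0=\hat\psi$ and $\hat\phi_j(\xi)=\hat\psi(2^{-j}\xi)-\hat\psi(2^{-j+1}\xi)$ for $j\ge 1$. For $-1\le\rho<1$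 and $f\in\mathscr S(\mathbb{R}^n)$ let $U_\rho f(t)=e^{it(-\Delta)^{(1-\rho)/2}}f$ be the solution of $i\partial_t u+(-\Delta)^{(1-\rho)/2}u=0$, $u(0)=f$, that is, the function whose Fourier transform is $e^{it|\xi|^{1-\rho}}\hat f(\xi)$. Write $\langle F,g\rangle=\int Fg$. There is $\eta\in(0,1)$, depending only on $n$, such that the following holds for every $1\le r\le 2$. (i) Let $-1\le\rho<1$, $\rho\ne 0$, and $\frac1r+\frac12<\frac1\alpha<\frac2r$. There is a constant $C$, depending only on $n,\hat\psi,r,\rho,\alpha$, such that for all $f,g\in\mathscr S(\mathbb{R}^n)$ there are $\eta$-sparse families $\mathcal S_0,\mathcal S_1,\dots$ with $$|\langle U_\rho f(t),g\rangle|\le C\,t^{\,n\left(\frac1r-\frac12-\left(\frac1\alpha-1\right)\right)}\liminf_{R\to\infty}\sum_{j\ge 0}2^{j\kappa_4}\Lambda^{\alpha}_{\mathcal S_j,r,r}\big((\phi_j*f)1_{Q_R},g\big)\qquad\text{for all }t>0,$$ where $\kappa_4=n(1-\rho)\left(\frac1r-\frac12\right)+\rho n\left(\frac1\alpha-1\right)$.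 (ii) Let $\frac{n+1}{rn}+\frac{n-1}{2n}<\frac1\alpha<\frac2r$. There is a constant $C$, depending only on $n,\hat\psi,r,\alpha$, such that for all $f,g\in\mathscr S(\mathbb{R}^n)$ there are $\eta$-sparse families $\mathcal S_0,\mathcal S_1,\dots$ with $$|\langle U_0 f(t),g\rangle|\le C\,t^{\,(n+1)\left(\frac1r-\frac12\right)-n\left(\frac1\alpha-1\right)}\liminf_{R\to\infty}\sum_{j\ge 0}2^{j\kappa_5}\Lambda^{\alpha}_{\mathcal S_j,r,r}\big((\phi_j*f)1_{Q_R},g\big)\qquad\text{for all }t>0,$$ where $\kappa_5=(n+1)\left(\frac1r-\frac12\right)$. -/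

import Mathlib

open MeasureTheory Filter
open scoped FourierTransform SchwartzMap ENNReal NNReal ContDiff

noncomputable section

namespace SparseDispersive

/-- Euclidean space `ℝⁿ`. -/
abbrev E (n : ℕ) : Type := EuclideanSpace ℝ (Fin n)

/-- A cube in `ℝⁿ` with sides parallel to the axes, given by its center and its side length. -/
structure Cube (n : ℕ) where
  center : E n
  side : ℝ
  side_pos : 0 < side

/-- The half-open set `∏ᵢ [cᵢ - ℓ/2, cᵢ + ℓ/2)`. -/
def cubeSet {n : ℕ} (c : E n) (l : ℝ) : Set (E n) :=
  {x | ∀ i, c i - l / 2 ≤ x i ∧ x i < c i + l / 2}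

/-- The points of a cube. -/
def Cube.toSet {n : ℕ} (Q : Cube n) : Set (E n) := cubeSet Q.center Q.side

/-- A collection of cubes is `η`-sparse if there are pairwise disjoint measurable sets
`E_Q ⊆ Q` with `|E_Q| > η |Q|`. -/
def IsSparse {n : ℕ} (η : ℝ) (S : Set (Cube n)) : Prop :=
  ∃ F : Cube n → Set (E n),
    (∀ Q ∈ S, MeasurableSet (F Q) ∧ F Q ⊆ Q.toSet ∧
      ENNReal.ofReal η * volume Q.toSet < volume (F Q)) ∧
    S.PairwiseDisjoint F

/-- The average `⟨f⟩_{p,Q} = |Q|^{-1/p} ‖f‖_{L^p(Q)}`. -/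
def avg {n : ℕ} (p : ℝ) (Q : Cube n) (f : E n → ℂ) : ℝ≥0∞ :=
  (volume Q.toSet) ^ (-(1 / p)) * eLpNorm f (ENNReal.ofReal p) (volume.restrict Q.toSet)

/-- The sparse form `Λ^α_{S,r,s}(f,g) = (∑_{Q ∈ S} |Q| ⟨f⟩_{r,Q}^α ⟨g⟩_{s,Q}^α)^{1/α}`. -/
def sparseForm {n : ℕ} (α : ℝ) (S : Set (Cube n)) (r s : ℝ) (f g : E n → ℂ) : ℝ≥0∞ :=
  (∑' Q : S, volume (Q : Cube n).toSet * avg r (Q : Cube n) f ^ α * avg s (Q : Cube n) g ^ α)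
    ^ (1 / α)

/-- The function `ψ̂` that generates the dyadic partition of unity. -/
structure IsCutoff {n : ℕ} (χ : E n → ℝ) : Prop where
  smooth : ContDiff ℝ ∞ χ
  tsupport_subset : tsupport χ ⊆ Metric.closedBall 0 2
  eq_one : ∀ ξ ∈ Metric.closedBall (0 : E n) 1, χ ξ = 1

/-- The symbol `φ̂_j`: for `j ≥ 1` it is `χ(2^{-j} ξ) - χ(2^{-j+1} ξ)`, and for `j = 0` it is
the (telescoping) sum `∑_{i ≤ 0} (χ(2^{-i} ξ) - χ(2^{-i+1} ξ))`, that is `χ(ξ)`. -/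
def phiHat {n : ℕ} (χ : E n → ℝ) : ℕ → E n → ℝ
  | 0 => χ
  | (j + 1) => fun ξ => χ (((2 : ℝ) ^ (j + 1))⁻¹ • ξ) - χ (((2 : ℝ) ^ j)⁻¹ • ξ)

/-- `φ_j(x) = (2π)^{-n} ∫ e^{i x·ξ} φ̂_j(ξ) dξ`, written with the inverse Fourier transform
of kernel `e^{2π i x·ξ}`. -/
def phi {n : ℕ} (χ : E n → ℝ) (j : ℕ) : E n → ℂ :=
  𝓕⁻ (fun ξ : E n => (phiHat χ j ((2 * Real.pi) • ξ) : ℂ))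

/-- The convolution `φ_j * f`. -/
def lpPiece {n : ℕ} (χ : E n → ℝ) (j : ℕ) (f : E n → ℂ) : E n → ℂ :=
  convolution (phi χ j) f (ContinuousLinearMap.mul ℝ ℂ) volume

/-- `U_ρ(t) f = e^{it(-Δ)^{(1-ρ)/2}} f`, the solution at time `t` of
`i ∂ₜ u + (-Δ)^{(1-ρ)/2} u = 0`, `u(0) = f`. With the Fourier kernel `e^{-2π i x·ξ}` the symbol
of `(-Δ)^{(1-ρ)/2}` is `(2π|ξ|)^{1-ρ}`. -/
def U {n : ℕ} (ρ t : ℝ) (f : 𝓢(E n, ℂ)) : E n → ℂ :=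
  𝓕⁻ (fun ξ : E n =>
    Complex.exp (Complex.I * ((t * (2 * Real.pi * ‖ξ‖) ^ (1 - ρ) : ℝ) : ℂ)) * 𝓕 (f : E n → ℂ) ξ)

/-- The pairing `⟨F, g⟩ = ∫ F g`. -/
def pairing {n : ℕ} (F g : E n → ℂ) : ℂ := ∫ x, F x * g x

/-- The Besov-type sparse form
`liminf_{R → ∞} ∑_{j ≥ 0} 2^{jκ} Λ^α_{S_j,r,r}((φ_j * f) 1_{Q_R}, g)`, where `Q_R` is the cube
with center `0` and side length `R`. -/
def besovSparseForm {n : ℕ} (χ : E n → ℝ) (κ α r : ℝ) (S : ℕ → Set (Cube n))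
    (f g : E n → ℂ) : ℝ≥0∞ :=
  liminf (fun R : ℝ => ∑' j : ℕ, ENNReal.ofReal ((2 : ℝ) ^ ((j : ℝ) * κ)) *
    sparseForm α (S j) r r ((cubeSet (0 : E n) R).indicator (lpPiece χ j f)) g) atTop

end SparseDispersive

end

noncomputable section

namespace SparseDispersive

/-! Put `a = 1 - ρ`. The pairing is the bilinear form of the Fourier multiplier `e^{it(2π|ξ|)^a}`.
The plan is to bound it one frequency shell at a time, using pairs of cubes in a grid adapted to the
shell and to `t`, and then to replace all these grids by families that do not depend on `t`.

On the shell `|ξ| ~ l` put `τ = t l^a` and `y = 1 + τ`. The rescaled convolution kernel is written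
as a superposition of wave packets of frequency width `y^{-1/2}`, at which scale the Taylor
remainder of the phase is harmless (`norm_fourierInv_osc_le`). A packet at `z` is concentrated near
`x = -(τ/2π)∇P(z)`, so the size of the kernel is governed by how well the gradient separates
frequencies. For `a ≠ 1` it separates them in all `n` directions. For `a = 1` it separates only the
`n - 1` angular ones. With `d = n` or `d = n - 1` respectively, the kernel is `O(l^n y^{-d/2})`
(`norm_oscKernel_le_sqrt_pow`), and it decays rapidly beyond distance `ℓ ~ y/l`
(`norm_oscKernel_le_of_far`).

Interpolating the `L¹` kernel bound with Plancherel by the three lines theorem gives an `L^r × L^r`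
bound with constant `l^{n(2/r-1)} y^{-d(1/r-1/2)}` (`enorm_kernelForm_le_interp`). It is applied to
neighbouring cubes of a grid of side `ℓ`; distant pairs are handled by kernel decay. Since `α ≤ 1`,
an `ℓ¹` sum over disjoint cubes of side `ℓ` is at most the `ℓ^α` sum. It is therefore at most
`ℓ^{n(2/r-1/α)}` times a sparse form over disjoint cubes (`exists_enorm_kernelForm_le_disjointSup`).
Altogether the shell contributes `l^{n(1/α-1)} y^e` with `e = n(2/r-1/α) - d(1/r-1/2)`. The lower
bound on `1/α` makes `e ≤ 0`, so `y^e ≤ τ^e = t^e l^{ae}`. This produces the stated power of `t` and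
the weight `l^κ` with `κ = n(1/α-1) + ae`.

The grid depends on `t`, while the families must not. The grid forms are therefore bounded by the
supremum over all families of disjoint cubes. This supremum is finite because `r ≤ 2α`: Hölder gives
`|Q|⟨F⟩_{r,Q}^{2α} ≤ ∫_Q |F|^{2α}`. A family reaching half of it is fixed once for each `j`
(`exists_disjoint_family`). Disjoint cubes are `1/2`-sparse, with `E_Q = Q`.

Finally the shells are summed. The pieces `j ≥ 1` are single shells. The piece `j = 0` consists of
infinitely many shells `l = 2·2^{-k}`, whose weights `l^κ` are summable because `κ > 0`. The
truncation to `Q_R` is removed by a Fatou argument (`tsum_sparseForm_le_besovSparseForm`). -/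

/-! ### Wave packets and oscillatory integrals -/

/-- Smooth functions supported in the unit ball have inverse Fourier transforms that decay
rapidly, with a bound that only involves the size of finitely many derivatives. -/
theorem fourierInv_decay (n N : ℕ) : ∃ C : ℝ, 0 ≤ C ∧ ∀ (g : E n → ℂ) (M : ℝ),
    ContDiff ℝ ∞ g → (∀ w, g w ≠ 0 → ‖w‖ ≤ 1) →
    (∀ k ≤ N, ∀ w, ‖iteratedFDeriv ℝ k g w‖ ≤ M) →
    ∀ ζ, (1 + ‖ζ‖) ^ N * ‖𝓕⁻ g ζ‖ ≤ C * M := by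
  set V : ℝ := (volume (Metric.closedBall (0 : E n) 1)).toReal with hV
  have hV0 : 0 ≤ V := ENNReal.toReal_nonneg
  refine ⟨2 ^ N * ((V + 2 ^ N * ((N + 1) * V))), by positivity, ?_⟩
  intro g M hg hsupp hM ζ
  have hts : tsupport g ⊆ Metric.closedBall 0 1 := by
    refine closure_minimal ?_ Metric.isClosed_closedBall
    intro w hw
    simpa using hsupp w hw
  have hcs : HasCompactSupport g :=
    HasCompactSupport.of_support_subset_isCompact (isCompact_closedBall 0 1)
      ((subset_tsupport g).trans hts)
  have hcont : ∀ k : ℕ, Continuous (iteratedFDeriv ℝ k g) := fun k =>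
    hg.continuous_iteratedFDeriv (by exact_mod_cast le_top)
  have hint : ∀ k : ℕ, Integrable (fun v => ‖iteratedFDeriv ℝ k g v‖) := fun k =>
    ((hcont k).integrable_of_hasCompactSupport (hcs.iteratedFDeriv k)).norm
  have hle : ∀ k ≤ N, ∫ v, ‖iteratedFDeriv ℝ k g v‖ ≤ V * M := by
    intro k hk
    have h1 : ∫ v, ‖iteratedFDeriv ℝ k g v‖ =
        ∫ v in Metric.closedBall (0 : E n) 1, ‖iteratedFDeriv ℝ k g v‖ := by
      refine (setIntegral_eq_integral_of_forall_compl_eq_zero ?_).symm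
      intro x hx
      rw [norm_eq_zero]
      by_contra hne
      exact hx (hts (tsupport_iteratedFDeriv_subset k (subset_tsupport _ hne)))
    rw [h1]
    calc _ ≤ ∫ v in Metric.closedBall (0 : E n) 1, M := by
          refine setIntegral_mono (hint k).integrableOn ?_ (fun v => hM k hk v)
          exact integrableOn_const (isCompact_closedBall (0 : E n) 1).measure_lt_top.ne
      _ = V * M := by
          rw [setIntegral_const]; rfl
  have hF : 𝓕⁻ g ζ = 𝓕 g (-ζ) := by
    rw [Real.fourierInv_eq_fourier_neg]
  have key : ∀ m ≤ N, ‖ζ‖ ^ m * ‖𝓕⁻ g ζ‖ ≤ 2 ^ m * ((m + 1) * (V * M)) := by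
    intro m hm
    have := Real.pow_mul_norm_iteratedFDeriv_fourier_le (K := 0) (N := (N : ℕ∞)) (f := g)
      (hg.of_le (by exact_mod_cast le_top))
      (by
        intro k j hk hj
        have : k = 0 := by simpa using hk
        subst this
        simpa using hint j) (k := 0) (n := m) le_rfl (by exact_mod_cast hm) (-ζ)
    rw [norm_neg, norm_iteratedFDeriv_zero, ← hF] at this
    refine this.trans ?_
    simp only [pow_zero, one_mul, Nat.cast_zero, mul_zero, zero_add]
    gcongr
    rw [Finset.sum_product]
    simp only [Finset.range_one, Finset.sum_singleton, pow_zero, one_mul]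
    calc _ ≤ ∑ i ∈ Finset.range (m + 1), V * M := by
          refine Finset.sum_le_sum fun i hi => hle i ?_
          have := Finset.mem_range.1 hi
          omega
      _ = _ := by simp
  have h0 := key 0 (Nat.zero_le _)
  have h1 := key N le_rfl
  simp only [pow_zero, one_mul, Nat.cast_zero, zero_add] at h0
  -- Only the powers `0` and `N` of `‖ζ‖` are needed to control `(1 + ‖ζ‖)^N`.
  have hp : (1 + ‖ζ‖) ^ N ≤ 2 ^ N * (1 + ‖ζ‖ ^ N) := by
    rcases le_total ‖ζ‖ 1 with h | h
    · calc (1 + ‖ζ‖) ^ N ≤ 2 ^ N := by gcongr; linarith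
        _ ≤ 2 ^ N * (1 + ‖ζ‖ ^ N) := le_mul_of_one_le_right (by positivity)
            (by have := pow_nonneg (norm_nonneg ζ) N; linarith)
    · calc (1 + ‖ζ‖) ^ N ≤ (2 * ‖ζ‖) ^ N := by gcongr; linarith
        _ = 2 ^ N * ‖ζ‖ ^ N := mul_pow _ _ _
        _ ≤ _ := by gcongr; linarith
  calc (1 + ‖ζ‖) ^ N * ‖𝓕⁻ g ζ‖ ≤ 2 ^ N * (1 + ‖ζ‖ ^ N) * ‖𝓕⁻ g ζ‖ := by gcongr
    _ = 2 ^ N * (‖𝓕⁻ g ζ‖ + ‖ζ‖ ^ N * ‖𝓕⁻ g ζ‖) := by ring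
    _ ≤ 2 ^ N * (V * M + 2 ^ N * ((N + 1) * (V * M))) := by gcongr
    _ = _ := by ring

theorem exists_bound_iteratedFDeriv {n : ℕ} {F : Type*} [NormedAddCommGroup F] [NormedSpace ℝ F]
    {f : E n → F} (hf : ContDiff ℝ ∞ f) (hc : HasCompactSupport f) (N : ℕ) :
    ∃ C : ℝ, 1 ≤ C ∧ ∀ k ≤ N, ∀ w, ‖iteratedFDeriv ℝ k f w‖ ≤ C := by
  have h : ∀ k : ℕ, ∃ C : ℝ, ∀ w, ‖iteratedFDeriv ℝ k f w‖ ≤ C := fun k =>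
    (hc.iteratedFDeriv k).exists_bound_of_continuous
      (hf.continuous_iteratedFDeriv (by exact_mod_cast le_top))
  choose C hC using h
  refine ⟨1 + ∑ k ∈ Finset.range (N + 1), |C k|, by
    have : 0 ≤ ∑ k ∈ Finset.range (N + 1), |C k| := Finset.sum_nonneg fun _ _ => abs_nonneg _
    linarith, ?_⟩
  intro k hk w
  have h1 : |C k| ≤ ∑ k ∈ Finset.range (N + 1), |C k| :=
    Finset.single_le_sum (f := fun k => |C k|) (fun _ _ => abs_nonneg _)
      (Finset.mem_range.2 (by omega))
  have := (hC k w).trans (le_abs_self _)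
  linarith

theorem norm_iteratedFDeriv_comp_affine {n : ℕ} {F : Type*} [NormedAddCommGroup F]
    [NormedSpace ℝ F] {f : E n → F} (hf : ContDiff ℝ ∞ f) (k : ℕ) (z w : E n) (ε : ℝ) :
    ‖iteratedFDeriv ℝ k (fun w => f (z + ε • w)) w‖ =
      |ε| ^ k * ‖iteratedFDeriv ℝ k f (z + ε • w)‖ := by
  have h1 : ContDiff ℝ k (fun v => f (z + v)) := by
    have : ContDiff ℝ ∞ (fun v => f (z + v)) := hf.comp (contDiff_const.add contDiff_id)
    exact this.of_le (by exact_mod_cast le_top)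
  have h := congrFun (iteratedFDeriv_comp_const_smul ε h1) w
  rw [h]
  rw [norm_smul, norm_pow, Real.norm_eq_abs, iteratedFDeriv_comp_add_left]

theorem norm_iteratedFDeriv_expI (k : ℕ) (s : ℝ) :
    ‖iteratedFDeriv ℝ k (fun s : ℝ => Complex.exp (Complex.I * s)) s‖ = 1 := by
  rw [norm_iteratedFDeriv_eq_norm_iteratedDeriv]
  have : iteratedDeriv k (fun s : ℝ => Complex.exp (Complex.I * s)) =
      fun s : ℝ => Complex.I ^ k * Complex.exp (Complex.I * s) := by
    induction k with
    | zero => simp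
    | succ k ih =>
      rw [iteratedDeriv_succ, ih]
      ext s
      have h1 : HasDerivAt (fun s : ℝ => Complex.I * (s : ℂ)) Complex.I s := by
        simpa using (Complex.ofRealCLM.hasDerivAt (x := s)).const_mul Complex.I
      have := (h1.cexp).const_mul (Complex.I ^ k)
      rw [this.deriv]
      ring
  rw [this]
  simp [Complex.norm_exp]

theorem contDiff_expI : ContDiff ℝ ∞ (fun s : ℝ => Complex.exp (Complex.I * s)) :=
  (contDiff_const.mul Complex.ofRealCLM.contDiff).cexp

theorem contDiff_affine {n : ℕ} (z : E n) (ε : ℝ) : ContDiff ℝ ∞ (fun w : E n => z + ε • w) := by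
  fun_prop

/-- The second order Taylor remainder, at scale `ε`, of `τ P` at the point `z`. -/
def taylorRemainder {n : ℕ} (P : E n → ℝ) (τ ε : ℝ) (z w : E n) : ℝ :=
  τ * (P (z + ε • w) - P z - ε * fderiv ℝ P z w)

theorem contDiff_taylorRemainder {n : ℕ} {P : E n → ℝ} (hP : ContDiff ℝ ∞ P) (τ ε : ℝ) (z : E n) :
    ContDiff ℝ ∞ (taylorRemainder P τ ε z) := by
  unfold taylorRemainder
  have h1 : ContDiff ℝ ∞ (fun w => P (z + ε • w)) :=
    hP.comp (contDiff_affine z ε)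
  exact contDiff_const.mul ((h1.sub contDiff_const).sub
    (contDiff_const.mul (fderiv ℝ P z).contDiff))

theorem fderiv_taylorRemainder {n : ℕ} {P : E n → ℝ} (hP : ContDiff ℝ ∞ P) (τ ε : ℝ)
    (z w : E n) : fderiv ℝ (taylorRemainder P τ ε z) w =
      (τ * ε) • (fderiv ℝ P (z + ε • w) - fderiv ℝ P z) := by
  have h1 : HasFDerivAt (fun w => P (z + ε • w)) (ε • fderiv ℝ P (z + ε • w)) w := by
    have h2 : HasFDerivAt (fun w : E n => z + ε • w) (ε • ContinuousLinearMap.id ℝ (E n)) w :=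
      ((hasFDerivAt_id w).const_smul ε).const_add z
    have h3 : HasFDerivAt P (fderiv ℝ P (z + ε • w)) (z + ε • w) :=
      (hP.differentiable (by simp)).differentiableAt.hasFDerivAt
    have := h3.comp w h2
    convert! this using 1
    ext v
    simp
  have h4 : HasFDerivAt (taylorRemainder P τ ε z)
      (τ • ((ε • fderiv ℝ P (z + ε • w)) - ε • fderiv ℝ P z)) w :=
    ((h1.sub_const (P z)).sub ((fderiv ℝ P z).hasFDerivAt.const_mul ε)).const_mul τ
  rw [h4.fderiv, ← smul_sub, smul_smul]

/-- Each derivative in `w` costs a factor `ε`, so orders two and above carry `τε² ≤ 1`. In order one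
the subtracted linear term leaves a difference of gradients at distance at most `ε`, and the mean
value theorem supplies the second `ε`. Order zero is not needed, since the remainder occurs only
inside a unimodular exponential. -/
theorem norm_iteratedFDeriv_taylorRemainder_le {n N : ℕ} {P : E n → ℝ} (hP : ContDiff ℝ ∞ P)
    {D : ℝ} (hN : 1 ≤ N) (hD : ∀ k ≤ N + 1, ∀ w, ‖iteratedFDeriv ℝ k P w‖ ≤ D) {τ ε : ℝ}
    (hτ : 0 ≤ τ) (hε : 0 ≤ ε) (hε1 : ε ≤ 1) (hτε : τ * ε ^ 2 ≤ 1) (z w : E n) (hw : ‖w‖ ≤ 1)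
    {k : ℕ} (hk : 1 ≤ k) (hkN : k ≤ N) :
    ‖iteratedFDeriv ℝ k (taylorRemainder P τ ε z) w‖ ≤ D := by
  have hD0 : 0 ≤ D := (norm_nonneg _).trans (hD 0 (by omega) 0)
  obtain ⟨j, rfl⟩ : ∃ j, k = j + 1 := ⟨k - 1, by omega⟩
  have hf : fderiv ℝ (taylorRemainder P τ ε z) =
      fun w => (τ * ε) • (fderiv ℝ P (z + ε • w) - fderiv ℝ P z) :=
    funext fun w => fderiv_taylorRemainder hP τ ε z w
  have hdP : ContDiff ℝ ∞ (fderiv ℝ P) := hP.fderiv_right (by simp)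
  rw [← norm_iteratedFDeriv_fderiv, hf]
  rcases Nat.eq_zero_or_pos j with rfl | hj
  · rw [norm_iteratedFDeriv_zero, norm_smul, Real.norm_of_nonneg (by positivity)]
    have hmv : ‖fderiv ℝ P (z + ε • w) - fderiv ℝ P z‖ ≤ D * ‖(z + ε • w) - z‖ := by
      refine Convex.norm_image_sub_le_of_norm_fderiv_le (𝕜 := ℝ) (s := Set.univ)
        (fun x _ => (hdP.differentiable (by simp)).differentiableAt) (fun x _ => ?_)
        convex_univ (Set.mem_univ _) (Set.mem_univ _)
      have h2 := hD 2 (by omega) x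
      rw [← norm_iteratedFDeriv_fderiv, ← norm_iteratedFDeriv_fderiv,
        norm_iteratedFDeriv_zero] at h2
      exact h2
    rw [add_sub_cancel_left, norm_smul, Real.norm_of_nonneg hε] at hmv
    calc τ * ε * ‖fderiv ℝ P (z + ε • w) - fderiv ℝ P z‖ ≤ τ * ε * (D * (ε * ‖w‖)) := by gcongr
      _ = (τ * ε ^ 2) * ‖w‖ * D := by ring
      _ ≤ 1 * 1 * D := by gcongr
      _ = D := by ring
  · have hc : ContDiff ℝ ∞ (fun w => fderiv ℝ P (z + ε • w)) :=
      hdP.comp (contDiff_affine z ε)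
    have hc' : ContDiff ℝ j (fun w => fderiv ℝ P (z + ε • w)) :=
      hc.of_le (by exact_mod_cast le_top)
    have h1 : iteratedFDeriv ℝ j
        (fun w => (τ * ε) • (fderiv ℝ P (z + ε • w) - fderiv ℝ P z)) w =
        (τ * ε) • iteratedFDeriv ℝ j (fun w => fderiv ℝ P (z + ε • w)) w := by
      rw [iteratedFDeriv_const_smul_apply' (hc'.sub contDiff_const).contDiffAt]
      congr 1
      rw [fun_iteratedFDeriv_sub_apply hc'.contDiffAt contDiff_const.contDiffAt,
        iteratedFDeriv_const_of_ne (by omega)]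
      simp
    rw [h1, norm_smul, norm_iteratedFDeriv_comp_affine hdP, Real.norm_of_nonneg (by positivity),
      abs_of_nonneg hε, norm_iteratedFDeriv_fderiv]
    obtain ⟨i, rfl⟩ : ∃ i, j = i + 1 := ⟨j - 1, by omega⟩
    calc τ * ε * (ε ^ (i + 1) * ‖iteratedFDeriv ℝ (i + 1 + 1) P (z + ε • w)‖)
        = (τ * ε ^ 2) * ε ^ i * ‖iteratedFDeriv ℝ (i + 1 + 1) P (z + ε • w)‖ := by ring
      _ ≤ 1 * 1 * D := by
          gcongr
          · exact pow_le_one₀ hε hε1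
          · exact hD _ (by omega) _
      _ = D := by ring

/-- The wave packet profile at position `z` and scale `ε`. -/
def packet {n : ℕ} (P : E n → ℝ) (b η : E n → ℂ) (τ ε : ℝ) (z w : E n) : ℂ :=
  η w * (b (z + ε • w) * Complex.exp (Complex.I * (taylorRemainder P τ ε z w : ℝ)))

theorem norm_iteratedFDeriv_mul_le_of_le {n N : ℕ} {f g : E n → ℂ} (hf : ContDiff ℝ ∞ f)
    (hg : ContDiff ℝ ∞ g) {A B : ℝ} (w : E n) (hA : ∀ k ≤ N, ‖iteratedFDeriv ℝ k f w‖ ≤ A)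
    (hB : ∀ k ≤ N, ‖iteratedFDeriv ℝ k g w‖ ≤ B) {k : ℕ} (hk : k ≤ N) :
    ‖iteratedFDeriv ℝ k (fun w => f w * g w) w‖ ≤ 2 ^ N * (A * B) := by
  have hA0 : 0 ≤ A := (norm_nonneg _).trans (hA 0 (by omega))
  have hB0 : 0 ≤ B := (norm_nonneg _).trans (hB 0 (by omega))
  refine (norm_iteratedFDeriv_mul_le hf hg w (n := k) (by exact_mod_cast le_top)).trans ?_
  calc _ ≤ ∑ i ∈ Finset.range (k + 1), (k.choose i : ℝ) * (A * B) := by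
        refine Finset.sum_le_sum fun i hi => ?_
        have := Finset.mem_range.1 hi
        rw [mul_assoc]
        gcongr
        · exact hA i (by omega)
        · exact hB (k - i) (by omega)
    _ = 2 ^ k * (A * B) := by
        rw [← Finset.sum_mul]
        congr 1
        exact_mod_cast Nat.sum_range_choose k
    _ ≤ 2 ^ N * (A * B) := by
        gcongr
        norm_num

theorem contDiff_packet {n : ℕ} {P : E n → ℝ} {b η : E n → ℂ} (hP : ContDiff ℝ ∞ P)
    (hb : ContDiff ℝ ∞ b) (hη : ContDiff ℝ ∞ η) (τ ε : ℝ) (z : E n) :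
    ContDiff ℝ ∞ (packet P b η τ ε z) := by
  have h1 : ContDiff ℝ ∞ (fun w => b (z + ε • w)) := hb.comp (contDiff_affine z ε)
  have h2 : ContDiff ℝ ∞ (fun w => Complex.exp (Complex.I * (taylorRemainder P τ ε z w : ℝ))) :=
    contDiff_expI.comp (contDiff_taylorRemainder hP τ ε z)
  exact hη.mul (h1.mul h2)

/-- The condition `τε² ≤ 1` keeps all derivatives of the packet bounded uniformly in `τ`, `ε` and
`z`. Its inverse Fourier transform therefore decays at a rate with constants independent of these
parameters. -/
theorem packet_decay {n : ℕ} (N : ℕ) {P : E n → ℝ} {b η : E n → ℂ} (hP : ContDiff ℝ ∞ P)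
    (hPc : HasCompactSupport P) (hb : ContDiff ℝ ∞ b) (hbc : HasCompactSupport b)
    (hη : ContDiff ℝ ∞ η) (hηs : ∀ w, η w ≠ 0 → ‖w‖ ≤ 1) :
    ∃ C : ℝ, 0 ≤ C ∧ ∀ τ ε : ℝ, 0 ≤ τ → 0 ≤ ε → ε ≤ 1 → τ * ε ^ 2 ≤ 1 → ∀ z ζ : E n,
      (1 + ‖ζ‖) ^ N * ‖𝓕⁻ (packet P b η τ ε z) ζ‖ ≤ C := by
  have hηc : HasCompactSupport η :=
    HasCompactSupport.of_support_subset_isCompact (isCompact_closedBall 0 1)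
      (fun w hw => by simpa using hηs w hw)
  -- Working with `N + 1` derivatives makes the remainder estimate available for `N = 0` as well;
  -- the phase needs one more, for the mean value theorem.
  obtain ⟨D, hD1, hD⟩ := exists_bound_iteratedFDeriv hP hPc (N + 1 + 1)
  obtain ⟨B, hB1, hB⟩ := exists_bound_iteratedFDeriv hb hbc (N + 1)
  obtain ⟨H, hH1, hH⟩ := exists_bound_iteratedFDeriv hη hηc (N + 1)
  obtain ⟨C, hC0, hC⟩ := fourierInv_decay n N
  refine ⟨C * (2 ^ (N + 1) * (H * (2 ^ (N + 1) * (B * ((N + 1).factorial * D ^ (N + 1)))))),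
    by positivity, ?_⟩
  intro τ ε hτ hε hε1 hτε z ζ
  have hsupp : ∀ w, packet P b η τ ε z w ≠ 0 → ‖w‖ ≤ 1 := by
    intro w hw
    exact hηs w (left_ne_zero_of_mul hw)
  refine hC _ _ (contDiff_packet hP hb hη τ ε z) hsupp ?_ ζ
  intro k hk w
  by_cases hw : ‖w‖ ≤ 1
  swap
  · have : iteratedFDeriv ℝ k (packet P b η τ ε z) w = 0 := by
      by_contra hne
      have h1 := tsupport_iteratedFDeriv_subset (𝕜 := ℝ) k (subset_tsupport _ hne)
      have hts : tsupport (packet P b η τ ε z) ⊆ Metric.closedBall 0 1 :=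
        closure_minimal (fun w hw => by simpa using hsupp w hw) Metric.isClosed_closedBall
      exact hw (by simpa using hts h1)
    rw [this, norm_zero]
    positivity
  have hbz : ContDiff ℝ ∞ (fun w => b (z + ε • w)) :=
    hb.comp (contDiff_affine z ε)
  have he : ContDiff ℝ ∞ ((fun s : ℝ => Complex.exp (Complex.I * s)) ∘ taylorRemainder P τ ε z) :=
    contDiff_expI.comp (contDiff_taylorRemainder hP τ ε z)
  refine norm_iteratedFDeriv_mul_le_of_le (N := N + 1) hη (hbz.mul he) w
    (fun k hk => hH k hk w) ?_ (by omega)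
  intro k hk
  refine norm_iteratedFDeriv_mul_le_of_le (N := N + 1) hbz he w ?_ ?_ hk
  · intro k hk
    rw [norm_iteratedFDeriv_comp_affine hb, abs_of_nonneg hε]
    calc _ ≤ 1 * B := by
          gcongr
          · exact pow_le_one₀ hε hε1
          · exact hB k hk _
      _ = B := one_mul B
  · intro k hk
    refine (norm_iteratedFDeriv_comp_le contDiff_expI (contDiff_taylorRemainder hP τ ε z)
      (n := k) (by exact_mod_cast le_top) w (C := 1) (D := D) ?_ ?_).trans ?_
    · intro i _
      rw [norm_iteratedFDeriv_expI]
    · intro i hi hik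
      refine (norm_iteratedFDeriv_taylorRemainder_le (N := N + 1) hP (by omega) hD hτ hε hε1 hτε
        z w hw hi (by omega)).trans ?_
      exact le_self_pow₀ hD1 (by omega)
    · rw [mul_one]
      gcongr

/-- The wave packet bound for an oscillatory integral. -/
theorem norm_fourierInv_osc_le {n : ℕ} (N : ℕ) {P : E n → ℝ} {b : E n → ℂ} (hP : ContDiff ℝ ∞ P)
    (hPc : HasCompactSupport P) (hb : ContDiff ℝ ∞ b) (hbc : HasCompactSupport b)
    {δ : ℝ} (hδ : 0 < δ) {A : Set (E n)} (hA : IsCompact A)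
    (hbA : ∀ z w : E n, ‖w‖ ≤ δ → b (z + w) ≠ 0 → z ∈ A) :
    ∃ C : ℝ, 0 ≤ C ∧ ∀ τ ε : ℝ, 0 ≤ τ → 0 < ε → ε ≤ 1 → τ * ε ^ 2 ≤ 1 → ∀ x : E n,
      ‖𝓕⁻ (fun ξ => Complex.exp (Complex.I * (τ * P ξ : ℝ)) * b ξ) x‖ ≤
        C * ∫ z in A, ((1 + ‖ε • (x + (τ / (2 * Real.pi)) • gradient P z)‖) ^ N)⁻¹ := by
  -- Radius at most `1` is what `packet_decay` requires; radius at most `δ`, together with `ε ≤ 1`,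
  -- confines the centres `z` to `A`.
  set δ' := min δ 1 with hδ'
  have hδ'0 : 0 < δ' := lt_min hδ one_pos
  let φ : ContDiffBump (0 : E n) := ⟨δ' / 2, δ', by positivity, by linarith⟩
  let η : E n → ℂ := fun w => ((φ.normed volume w : ℝ) : ℂ)
  have hη : ContDiff ℝ ∞ η := Complex.ofRealCLM.contDiff.comp (φ.contDiff_normed)
  have hηδ : ∀ w, η w ≠ 0 → ‖w‖ ≤ δ' := by
    intro w hw
    have : φ.normed volume w ≠ 0 := by
      intro h; apply hw; simp [η, h]
    have h2 : w ∈ Function.support (φ.normed volume) := this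
    rw [φ.support_normed_eq] at h2
    exact (by simpa using h2 : ‖w‖ < δ').le
  have hη1 : ∫ w, η w = 1 := by
    have := φ.integral_normed (μ := volume)
    simp only [η]
    rw [integral_complex_ofReal, this]
    simp
  have hηc : HasCompactSupport η :=
    HasCompactSupport.of_support_subset_isCompact (isCompact_closedBall 0 δ')
      (fun w hw => by simpa using hηδ w hw)
  obtain ⟨C, hC0, hC⟩ := packet_decay N hP hPc hb hbc hη
    (fun w hw => (hηδ w hw).trans (min_le_right _ _))
  refine ⟨C, hC0, ?_⟩
  intro τ ε hτ hε hε1 hτε x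
  set h : E n → ℂ := fun ξ => Complex.exp (↑(2 * Real.pi * inner ℝ ξ x) * Complex.I) *
    (Complex.exp (Complex.I * (τ * P ξ : ℝ)) * b ξ) with hh
  have hcont : Continuous h := by
    have := hP.continuous
    have := hb.continuous
    fun_prop
  have hhc : HasCompactSupport h := by
    refine HasCompactSupport.intro hbc ?_
    intro ξ hξ
    simp [hh, image_eq_zero_of_notMem_tsupport hξ]
  have hk : 𝓕⁻ (fun ξ => Complex.exp (Complex.I * (τ * P ξ : ℝ)) * b ξ) x = ∫ ξ, h ξ := by
    rw [Real.fourierInv_eq']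
    simp only [smul_eq_mul, hh]
  -- Expanding the phase to first order at `z`, the constant part is unimodular and the linear part
  -- is a character in `w`. What is left is the inverse transform of the packet at the frequency
  -- `ε(x + (τ/2π)∇P(z))`.
  have hinner : ∀ z, ∫ w, η w * h (z + ε • w) =
      (Complex.exp (↑(2 * Real.pi * inner ℝ z x) * Complex.I) *
        Complex.exp (Complex.I * (τ * P z : ℝ))) *
      𝓕⁻ (packet P b η τ ε z) (ε • (x + (τ / (2 * Real.pi)) • gradient P z)) := by
    intro z
    rw [Real.fourierInv_eq', ← integral_const_mul]
    congr 1
    ext w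
    simp only [hh, packet, smul_eq_mul, taylorRemainder]
    have hgrad : fderiv ℝ P z w = inner ℝ w (gradient P z) := by
      rw [real_inner_comm]
      simp [gradient]
    rw [hgrad]
    have e1 : Complex.exp (↑(2 * Real.pi * inner ℝ (z + ε • w) x) * Complex.I) *
        Complex.exp (Complex.I * (τ * P (z + ε • w) : ℝ)) =
        (Complex.exp (↑(2 * Real.pi * inner ℝ z x) * Complex.I) *
        Complex.exp (Complex.I * (τ * P z : ℝ))) *
        (Complex.exp (↑(2 * Real.pi *
          inner ℝ w (ε • (x + (τ / (2 * Real.pi)) • gradient P z))) * Complex.I) *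
        Complex.exp (Complex.I *
          (τ * (P (z + ε • w) - P z - ε * inner ℝ w (gradient P z)) : ℝ))) := by
      simp only [← Complex.exp_add]
      congr 1
      simp only [inner_add_left, inner_add_right, real_inner_smul_left, real_inner_smul_right]
      have : (Real.pi : ℂ) ≠ 0 := by exact_mod_cast Real.pi_ne_zero
      push_cast
      field_simp
      ring
    linear_combination (η w * b (z + ε • w)) * e1
  have hprod : Integrable (Function.uncurry fun w z : E n => η w * h (z + ε • w))
      (volume.prod volume) := by
    refine Continuous.integrable_of_hasCompactSupport ?_ ?_
    · have := hη.continuous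
      simp only [Function.uncurry_def]
      fun_prop
    · obtain ⟨R, hR⟩ := hhc.isCompact.isBounded.subset_closedBall (0 : E n)
      refine HasCompactSupport.intro ((isCompact_closedBall (0 : E n) 1).prod
        (isCompact_closedBall (0 : E n) (R + 1))) ?_
      rintro ⟨w, z⟩ hwz
      by_contra hne
      apply hwz
      simp only [Function.uncurry_apply_pair] at hne
      have h1 := (hηδ w (left_ne_zero_of_mul hne)).trans (min_le_right _ _)
      have h2 : ‖z + ε • w‖ ≤ R := by
        simpa using hR (subset_tsupport _ (right_ne_zero_of_mul hne))
      refine Set.mk_mem_prod (by simpa using h1) ?_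
      have h3 : ‖z‖ ≤ ‖z + ε • w‖ + ‖ε • w‖ := by
        simpa using norm_sub_le (z + ε • w) (ε • w)
      have h4 : ‖ε • w‖ ≤ 1 := by
        rw [norm_smul, Real.norm_of_nonneg hε.le]
        nlinarith [norm_nonneg w]
      simp only [mem_closedBall_zero_iff]
      linarith
  -- For each fixed `w` the integral in `z` is translation invariant, and `η` has integral one.
  -- Averaging over the centres `z` thus replaces a discrete partition into packets.
  have hmain : ∫ ξ, h ξ = ∫ z, ∫ w, η w * h (z + ε • w) := by
    rw [← integral_integral_swap hprod]
    have : ∀ w, ∫ z, η w * h (z + ε • w) = η w * ∫ ξ, h ξ := by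
      intro w
      rw [integral_const_mul, integral_add_right_eq_self h]
    simp only [this]
    rw [integral_mul_const, hη1, one_mul]
  rw [hk, hmain]
  have hzero : ∀ z ∉ A, ∫ w, η w * h (z + ε • w) = 0 := by
    intro z hz
    have : (fun w => η w * h (z + ε • w)) = 0 := by
      ext w
      by_contra hne
      apply hz
      have h1 := (hηδ w (left_ne_zero_of_mul hne)).trans (min_le_left _ _)
      have h2 : b (z + ε • w) ≠ 0 := right_ne_zero_of_mul (right_ne_zero_of_mul
        (right_ne_zero_of_mul hne))
      refine hbA z (ε • w) ?_ h2
      rw [norm_smul, Real.norm_of_nonneg hε.le]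
      nlinarith [norm_nonneg w]
    rw [this]
    simp
  rw [← setIntegral_eq_integral_of_forall_compl_eq_zero hzero, ← integral_const_mul]
  refine norm_integral_le_of_norm_le ?_ ?_
  · refine (ContinuousOn.integrableOn_compact hA ?_)
    have hg : Continuous (gradient P) := by
      unfold gradient
      exact (InnerProductSpace.toDual ℝ (E n)).symm.continuous.comp
        (hP.continuous_fderiv (by simp))
    refine Continuous.continuousOn (continuous_const.mul (Continuous.inv₀ (by fun_prop) ?_))
    intro z
    positivity
  · refine Filter.Eventually.of_forall fun z => ?_
    rw [hinner, norm_mul, norm_mul]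
    have e1 : ‖Complex.exp (↑(2 * Real.pi * inner ℝ z x) * Complex.I)‖ = 1 :=
      Complex.norm_exp_ofReal_mul_I _
    have e2 : ‖Complex.exp (Complex.I * (τ * P z : ℝ))‖ = 1 := by
      rw [mul_comm]; exact Complex.norm_exp_ofReal_mul_I _
    rw [e1, e2, one_mul, one_mul, ← div_eq_mul_inv, le_div_iff₀ (by positivity), mul_comm]
    exact hC τ ε hτ hε.le hε1 hτε z _

/-! ### Separation of frequencies by the phase gradient -/

/-- The closed annulus of radii `s₁` and `s₂`. -/
def annulus (n : ℕ) (s₁ s₂ : ℝ) : Set (E n) := {z | s₁ ≤ ‖z‖ ∧ ‖z‖ ≤ s₂}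

theorem isCompact_annulus (n : ℕ) (s₁ s₂ : ℝ) : IsCompact (annulus n s₁ s₂) := by
  refine (isCompact_closedBall (0 : E n) s₂).of_isClosed_subset ?_ ?_
  · exact (isClosed_le continuous_const continuous_norm).inter
      (isClosed_le continuous_norm continuous_const)
  · intro z hz
    simpa using hz.2

theorem measurableSet_annulus (n : ℕ) (s₁ s₂ : ℝ) : MeasurableSet (annulus n s₁ s₂) :=
  (isCompact_annulus n s₁ s₂).measurableSet

/-- The gradient of `(2π‖ξ‖)^a` away from the origin. -/
def phaseGradient {n : ℕ} (a : ℝ) (z : E n) : E n :=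
  (a * (2 * Real.pi) ^ a * ‖z‖ ^ (a - 2)) • z

theorem hasGradientAt_phase {n : ℕ} (a : ℝ) {z : E n} (hz : z ≠ 0) :
    HasGradientAt (fun ξ : E n => (2 * Real.pi * ‖ξ‖) ^ a) (phaseGradient a z) z := by
  rw [hasGradientAt_iff_hasFDerivAt]
  have hz' : 0 < ‖z‖ := norm_pos_iff.2 hz
  have h1 := ((hasStrictFDerivAt_norm_sq z).hasFDerivAt.rpow_const (p := a / 2)
    (Or.inl (by positivity))).const_mul ((2 * Real.pi) ^ a)
  have h2 : (fun ξ : E n => (2 * Real.pi * ‖ξ‖) ^ a) =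
      fun ξ => (2 * Real.pi) ^ a * (‖ξ‖ ^ 2) ^ (a / 2) := by
    ext ξ
    rw [Real.mul_rpow (by positivity) (norm_nonneg _), ← Real.rpow_natCast,
      ← Real.rpow_mul (norm_nonneg _)]
    congr 2
    push_cast
    ring
  rw [h2]
  convert! h1 using 1
  ext v
  have h3 : (‖z‖ ^ 2) ^ (a / 2 - 1) = ‖z‖ ^ (a - 2) := by
    rw [← Real.rpow_natCast, ← Real.rpow_mul (norm_nonneg _)]
    congr 1
    push_cast
    ring
  simp only [phaseGradient, h3, InnerProductSpace.toDual_apply_apply, real_inner_smul_left,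
    FunLike.coe_smul, Pi.smul_apply, smul_eq_mul, innerSL_apply_apply, two_smul,
    FunLike.coe_add, Pi.add_apply]
  ring

theorem exists_rpow_lower_bound (q : ℝ) {s₁ s₂ : ℝ} (h₁ : 0 < s₁) :
    ∃ m : ℝ, 0 < m ∧ ∀ s, s₁ ≤ s → s ≤ s₂ → m ≤ s ^ q := by
  rcases lt_or_ge s₂ s₁ with h | h
  · exact ⟨1, one_pos, fun s h1 h2 => absurd (h1.trans h2) (not_le.2 h)⟩
  · obtain ⟨x, hx, hmin⟩ := isCompact_Icc.exists_isMinOn (s := Set.Icc s₁ s₂)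
      (f := fun s : ℝ => s ^ q) ⟨s₁, le_rfl, h⟩
      (fun s hs => (Real.continuousAt_rpow_const s q
        (Or.inl (h₁.trans_le hs.1).ne')).continuousWithinAt)
    exact ⟨x ^ q, Real.rpow_pos_of_pos (h₁.trans_le hx.1) q, fun s h1 h2 => hmin ⟨h1, h2⟩⟩

theorem exists_rpow_sub_lower_bound {e : ℝ} (he : e ≠ 0) {s₁ s₂ : ℝ} (h₁ : 0 < s₁) :
    ∃ m : ℝ, 0 < m ∧ ∀ s t, s₁ ≤ s → s ≤ s₂ → s₁ ≤ t → t ≤ s₂ →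
      m * |s - t| ≤ |s ^ e - t ^ e| := by
  obtain ⟨m, hm, hle⟩ := exists_rpow_lower_bound (e - 1) (s₂ := s₂) h₁
  have key : ∀ s t, s₁ ≤ s → t ≤ s₂ → s < t → |e| * m * |s - t| ≤ |s ^ e - t ^ e| := by
    intro s t hs ht hst
    obtain ⟨c, hc, hce⟩ := exists_hasDerivAt_eq_slope (fun x : ℝ => x ^ e)
      (fun x => e * x ^ (e - 1)) hst
      (fun x hx => (Real.continuousAt_rpow_const x e
        (Or.inl (h₁.trans_le (hs.trans hx.1)).ne')).continuousWithinAt)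
      (fun x hx => Real.hasDerivAt_rpow_const (Or.inl (h₁.trans_le (hs.trans hx.1.le)).ne'))
    have h2 : t ^ e - s ^ e = e * c ^ (e - 1) * (t - s) := by
      rw [hce]
      field_simp [(sub_pos.2 hst).ne']
    rw [abs_sub_comm, abs_sub_comm (s ^ e), h2, abs_mul, abs_mul]
    have h3 := hle c (hs.trans hc.1.le) (hc.2.le.trans ht)
    rw [abs_of_pos (hm.trans_le h3)]
    gcongr
  refine ⟨|e| * m, mul_pos (abs_pos.2 he) hm, ?_⟩
  intro s t hs hs2 ht ht2
  rcases lt_trichotomy s t with h | h | h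
  · exact key s t hs ht2 h
  · simp [h]
  · rw [abs_sub_comm, abs_sub_comm (s ^ e)]
    exact key t s ht hs2 h

/-- Splits the distance into a radial square and an angular term. For `p, q ≥ 0` both are
nonnegative, so either one alone gives a lower bound. -/
theorem norm_sq_smul_sub_smul {n : ℕ} (p q : ℝ) (z w : E n) :
    ‖p • z - q • w‖ ^ 2 = (p * ‖z‖ - q * ‖w‖) ^ 2 +
      2 * (p * q) * (‖z‖ * ‖w‖ - inner ℝ z w) := by
  rw [@norm_sub_sq ℝ, norm_smul, norm_smul, real_inner_smul_left, real_inner_smul_right,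
    mul_pow, mul_pow, Real.norm_eq_abs, Real.norm_eq_abs, sq_abs, sq_abs]
  simp only [RCLike.re_to_real]
  ring

/-- The gradient is radial, of length a constant times `|z|^{a-1}`. For `a ≠ 1` this length is
strictly monotone in `|z|` and controls the radial separation; the angular separation is controlled
for every `a > 0` because the scalar factor is bounded below on the annulus. -/
theorem phaseGradient_antilipschitz {n : ℕ} {a : ℝ} (ha : 0 < a) (ha1 : a ≠ 1) {s₁ s₂ : ℝ}
    (h₁ : 0 < s₁) : ∃ c : ℝ, 0 < c ∧ ∀ z ∈ annulus n s₁ s₂, ∀ w ∈ annulus n s₁ s₂,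
      c * ‖z - w‖ ≤ ‖phaseGradient a z - phaseGradient a w‖ := by
  obtain ⟨m, hm, hle⟩ := exists_rpow_lower_bound (a - 2) (s₂ := s₂) h₁
  obtain ⟨m', hm', hle'⟩ := exists_rpow_sub_lower_bound (sub_ne_zero.2 ha1) (s₂ := s₂) h₁
  set A : ℝ := a * (2 * Real.pi) ^ a with hA
  have hA0 : 0 < A := by positivity
  obtain ⟨c, hc⟩ : ∃ c, c = A * min m m' := ⟨_, rfl⟩
  have hc0 : 0 < c := by rw [hc]; positivity
  refine ⟨c, hc0, ?_⟩
  intro z hz w hw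
  have hz0 : 0 < ‖z‖ := h₁.trans_le hz.1
  have hw0 : 0 < ‖w‖ := h₁.trans_le hw.1
  refine le_of_sq_le_sq ?_ (norm_nonneg _)
  have h3 : ‖z - w‖ ^ 2 = (‖z‖ - ‖w‖) ^ 2 + 2 * (‖z‖ * ‖w‖ - inner ℝ z w) := by
    simpa using norm_sq_smul_sub_smul 1 1 z w
  rw [mul_pow, h3, phaseGradient, phaseGradient, norm_sq_smul_sub_smul]
  have hK : 0 ≤ ‖z‖ * ‖w‖ - inner ℝ z w := sub_nonneg.2 (real_inner_le_norm z w)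
  have e1 : ∀ s : ℝ, 0 < s → A * s ^ (a - 2) * s = A * s ^ (a - 1) := by
    intro s hs
    rw [mul_assoc, ← Real.rpow_add_one hs.ne']
    congr 2
    ring
  rw [← hA, e1 _ hz0, e1 _ hw0, ← mul_sub]
  have h5 : c * |‖z‖ - ‖w‖| ≤ A * |‖z‖ ^ (a - 1) - ‖w‖ ^ (a - 1)| := by
    calc c * |‖z‖ - ‖w‖| ≤ A * (m' * |‖z‖ - ‖w‖|) := by
          rw [hc, mul_assoc]; gcongr; exact min_le_right _ _
      _ ≤ _ := by gcongr; exact hle' _ _ hz.1 hz.2 hw.1 hw.2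
  have h6 : c ^ 2 * (‖z‖ - ‖w‖) ^ 2 ≤ (A * (‖z‖ ^ (a - 1) - ‖w‖ ^ (a - 1))) ^ 2 := by
    rw [← sq_abs (‖z‖ - ‖w‖), ← sq_abs (A * (_ - _)), abs_mul, abs_of_pos hA0,
      ← mul_pow]
    exact pow_le_pow_left₀ (by positivity) h5 2
  have h7 : c ^ 2 ≤ A * ‖z‖ ^ (a - 2) * (A * ‖w‖ ^ (a - 2)) := by
    rw [sq]
    have := hle _ hz.1 hz.2
    have := hle _ hw.1 hw.2
    gcongr
    · rw [hc]; gcongr; exact (min_le_left _ _).trans (hle _ hz.1 hz.2)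
    · rw [hc]; gcongr; exact (min_le_left _ _).trans (hle _ hw.1 hw.2)
  have h8 := mul_le_mul_of_nonneg_right h7 hK
  nlinarith [h6, h8]

/-- The angular half of the previous argument, valid also for `a = 1`. The squared distance of `z`
to the line `ℝw` is `|z||w| - z·w` times a factor bounded on the annulus, and the radial term is
discarded. -/
theorem norm_orthogonalProjection_le_phaseGradient_sub {n : ℕ} {a : ℝ} (ha : 0 < a)
    {s₁ s₂ : ℝ} (h₁ : 0 < s₁) :
    ∃ c : ℝ, 0 < c ∧ ∀ z ∈ annulus n s₁ s₂, ∀ w ∈ annulus n s₁ s₂,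
      c * ‖(Submodule.span ℝ {w})ᗮ.orthogonalProjectionOnto z‖ ≤
        ‖phaseGradient a z - phaseGradient a w‖ := by
  obtain ⟨m, hm, hle⟩ := exists_rpow_lower_bound (a - 2) (s₂ := s₂) h₁
  set A : ℝ := a * (2 * Real.pi) ^ a with hA
  have hA0 : 0 < A := by positivity
  rcases lt_or_ge s₂ s₁ with h | h
  · exact ⟨1, one_pos, fun z hz => absurd (hz.1.trans hz.2) (not_le.2 h)⟩
  have h₂ : 0 < s₂ := h₁.trans_le h
  refine ⟨A * m * Real.sqrt (s₁ / s₂), by positivity, ?_⟩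
  intro z hz w hw
  have hz0 : 0 < ‖z‖ := h₁.trans_le hz.1
  have hw0 : 0 < ‖w‖ := h₁.trans_le hw.1
  refine le_of_sq_le_sq ?_ (norm_nonneg _)
  have hK : 0 ≤ ‖z‖ * ‖w‖ - inner ℝ z w := sub_nonneg.2 (real_inner_le_norm z w)
  have hproj : ‖(Submodule.span ℝ {w})ᗮ.orthogonalProjectionOnto z‖ ^ 2 =
      ‖z‖ ^ 2 - (inner ℝ z w) ^ 2 / ‖w‖ ^ 2 := by
    have h1 := Submodule.norm_sq_eq_add_norm_sq_projection z (Submodule.span ℝ {w})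
    have h2 : ‖(Submodule.span ℝ {w}).orthogonalProjectionOnto z‖ ^ 2 =
        (inner ℝ z w) ^ 2 / ‖w‖ ^ 2 := by
      have h3 := Submodule.starProjection_singleton ℝ (v := w) z
      have h4 : ‖(Submodule.span ℝ {w}).orthogonalProjectionOnto z‖ =
          ‖(Submodule.span ℝ {w}).starProjection z‖ := rfl
      rw [h4, h3, norm_smul, mul_pow, Real.norm_eq_abs, sq_abs, real_inner_comm]
      simp only [RCLike.ofReal_real_eq_id, id]
      field_simp
    linarith
  have hproj' : ‖(Submodule.span ℝ {w})ᗮ.orthogonalProjectionOnto z‖ ^ 2 ≤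
      2 * (‖z‖ * ‖w‖ - inner ℝ z w) * (s₂ / s₁) := by
    have h1 : ‖z‖ ^ 2 - (inner ℝ z w) ^ 2 / ‖w‖ ^ 2 =
        (‖z‖ * ‖w‖ - inner ℝ z w) * ((‖z‖ * ‖w‖ + inner ℝ z w) / ‖w‖ ^ 2) := by
      field_simp
      ring
    have h2 : (‖z‖ * ‖w‖ + inner ℝ z w) / ‖w‖ ^ 2 ≤ 2 * (s₂ / s₁) := by
      have h3 : ‖z‖ * ‖w‖ + inner ℝ z w ≤ 2 * (‖z‖ * ‖w‖) := by linarith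
      calc _ ≤ 2 * (‖z‖ * ‖w‖) / ‖w‖ ^ 2 := by gcongr
        _ = 2 * (‖z‖ / ‖w‖) := by field_simp
        _ ≤ 2 * (s₂ / s₁) := by
            have := hz.2; have := hw.1
            gcongr
    rw [hproj, h1]
    calc _ ≤ (‖z‖ * ‖w‖ - inner ℝ z w) * (2 * (s₂ / s₁)) := by gcongr
      _ = _ := by ring
  rw [mul_pow, mul_pow, Real.sq_sqrt (by positivity), phaseGradient, phaseGradient,
    norm_sq_smul_sub_smul, ← hA]
  have h7 : (A * m) ^ 2 ≤ A * ‖z‖ ^ (a - 2) * (A * ‖w‖ ^ (a - 2)) := by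
    rw [sq]
    gcongr
    · exact hle _ hz.1 hz.2
    · exact hle _ hw.1 hw.2
  calc (A * m) ^ 2 * (s₁ / s₂) * ‖(Submodule.span ℝ {w})ᗮ.orthogonalProjectionOnto z‖ ^ 2
      ≤ (A * m) ^ 2 * (s₁ / s₂) * (2 * (‖z‖ * ‖w‖ - inner ℝ z w) * (s₂ / s₁)) := by gcongr
    _ = 2 * (A * m) ^ 2 * (‖z‖ * ‖w‖ - inner ℝ z w) := by field_simp
    _ ≤ 2 * (A * ‖z‖ ^ (a - 2) * (A * ‖w‖ ^ (a - 2))) * (‖z‖ * ‖w‖ - inner ℝ z w) := by gcongr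
    _ ≤ _ := le_add_of_nonneg_left (sq_nonneg _)

/-! ### Integration of the packet bound over the annulus -/

theorem integrable_inv_one_add_norm_pow {V : Type*} [NormedAddCommGroup V] [NormedSpace ℝ V]
    [FiniteDimensional ℝ V] [MeasurableSpace V] [BorelSpace V] (μ : Measure V)
    [μ.IsAddHaarMeasure] {N : ℕ} (hN : Module.finrank ℝ V < N) :
    Integrable (fun x : V => ((1 + ‖x‖) ^ N)⁻¹) μ := by
  have := integrable_one_add_norm (μ := μ) (E := V) (r := N) (by exact_mod_cast hN)
  simpa [Real.rpow_neg, add_nonneg] using this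

theorem integral_inv_one_add_smul_norm_pow {V : Type*} [NormedAddCommGroup V] [NormedSpace ℝ V]
    [FiniteDimensional ℝ V] [MeasurableSpace V] [BorelSpace V] (μ : Measure V)
    [μ.IsAddHaarMeasure] (N : ℕ) {l : ℝ} (hl : 0 < l) :
    ∫ x, ((1 + l * ‖x‖) ^ N)⁻¹ ∂μ =
      (l ^ Module.finrank ℝ V)⁻¹ * ∫ x, ((1 + ‖x‖) ^ N)⁻¹ ∂μ := by
  have := Measure.integral_comp_smul μ (fun x : V => ((1 + ‖x‖) ^ N)⁻¹) l
  rw [abs_of_pos (by positivity)] at this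
  simpa [norm_smul, abs_of_pos hl] using this

/-- Comparison with a minimiser `w` makes it unnecessary to solve `x + σV(z) = 0`: the value at `z`
dominates the value at `w`, hence half of the difference of the two vectors. -/
theorem norm_add_smul_ge_of_isMinOn {n : ℕ} {A : Set (E n)} {V : E n → E n} {x : E n}
    {σ : ℝ} (hσ : 0 < σ) {w : E n} (hw : IsMinOn (fun z => ‖x + σ • V z‖) A w) {z : E n}
    (hz : z ∈ A) : σ / 2 * ‖V z - V w‖ ≤ ‖x + σ • V z‖ := by
  have h1 : ‖x + σ • V w‖ ≤ ‖x + σ • V z‖ := hw hz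
  have h2 : σ * ‖V z - V w‖ ≤ ‖x + σ • V z‖ + ‖x + σ • V w‖ := by
    have : σ • (V z - V w) = (x + σ • V z) - (x + σ • V w) := by
      rw [smul_sub]; abel
    rw [← Real.norm_of_nonneg hσ.le, ← norm_smul, this, Real.norm_of_nonneg hσ.le]
    exact norm_sub_le _ _
  linarith

theorem continuousOn_phaseGradient {n : ℕ} (a : ℝ) {s₁ s₂ : ℝ} (h₁ : 0 < s₁) :
    ContinuousOn (phaseGradient a) (annulus n s₁ s₂) := by
  unfold phaseGradient
  have h1 : ContinuousOn (fun z : E n => ‖z‖ ^ (a - 2)) (annulus n s₁ s₂) :=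
    continuous_norm.continuousOn.rpow_const fun z hz => Or.inl (h₁.trans_le hz.1).ne'
  have h2 : ContinuousOn (fun z : E n => a * (2 * Real.pi) ^ a * ‖z‖ ^ (a - 2))
      (annulus n s₁ s₂) := h1.const_mul _
  exact h2.smul continuousOn_id

/-- By the antilipschitz bound the integrand is at most a rapidly decaying bump of width `(εσ)⁻¹`
about the minimiser `w`, uniformly in `x`. -/
theorem integral_phaseGradient_le {n : ℕ} {a : ℝ} (ha : 0 < a) (ha1 : a ≠ 1) {s₁ s₂ : ℝ}
    (h₁ : 0 < s₁) {N : ℕ} (hN : n < N) : ∃ C : ℝ, 0 ≤ C ∧ ∀ ε σ : ℝ, 0 < ε → 0 < σ →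
      ∀ x : E n, ∫ z in annulus n s₁ s₂, ((1 + ‖ε • (x + σ • phaseGradient a z)‖) ^ N)⁻¹ ≤
        C * ((ε * σ) ^ n)⁻¹ := by
  obtain ⟨c, hc, hanti⟩ := phaseGradient_antilipschitz (n := n) ha ha1 (s₂ := s₂) h₁
  set I : ℝ := ∫ x : E n, ((1 + ‖x‖) ^ N)⁻¹ with hI
  have hI0 : 0 ≤ I := integral_nonneg fun x => by positivity
  refine ⟨((c / 2) ^ n)⁻¹ * I, by positivity, ?_⟩
  intro ε σ hε hσ x
  rcases (annulus n s₁ s₂).eq_empty_or_nonempty with hem | hne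
  · rw [hem]; simp only [Measure.restrict_empty, integral_zero_measure]; positivity
  obtain ⟨w, hwA, hw⟩ := (isCompact_annulus n s₁ s₂).exists_isMinOn hne
    (f := fun z => ‖x + σ • phaseGradient a z‖)
    ((continuousOn_const.add ((continuousOn_phaseGradient a h₁).const_smul σ)).norm)
  set l := ε * σ * (c / 2) with hl
  have hl0 : 0 < l := by positivity
  have hint : Integrable (fun z : E n => ((1 + l * ‖z - w‖) ^ N)⁻¹) := by
    have h1 := (integrable_inv_one_add_norm_pow (volume : Measure (E n)) (N := N)
      (by simpa using hN)).comp_smul hl0.ne'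
    have h2 := h1.comp_sub_right w
    simpa [norm_smul, abs_of_pos hl0] using h2
  calc ∫ z in annulus n s₁ s₂, ((1 + ‖ε • (x + σ • phaseGradient a z)‖) ^ N)⁻¹
      ≤ ∫ z in annulus n s₁ s₂, ((1 + l * ‖z - w‖) ^ N)⁻¹ := by
        refine integral_mono_of_nonneg (Eventually.of_forall fun z => by positivity)
          hint.integrableOn ?_
        refine (ae_restrict_iff' (isCompact_annulus n s₁ s₂).measurableSet).2
          (Eventually.of_forall fun z hz => ?_)
        simp only
        gcongr
        rw [norm_smul, Real.norm_of_nonneg hε.le]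
        have h3 := norm_add_smul_ge_of_isMinOn hσ hw hz
        calc l * ‖z - w‖ = ε * (σ / 2 * (c * ‖z - w‖)) := by rw [hl]; ring
          _ ≤ ε * (σ / 2 * ‖phaseGradient a z - phaseGradient a w‖) := by
              gcongr; exact hanti z hz w hwA
          _ ≤ _ := by gcongr
    _ ≤ ∫ z, ((1 + l * ‖z - w‖) ^ N)⁻¹ :=
        setIntegral_le_integral hint (Eventually.of_forall fun z => by
          show 0 ≤ ((1 + l * ‖z - w‖) ^ N)⁻¹
          positivity)
    _ = ∫ z : E n, ((1 + l * ‖z‖) ^ N)⁻¹ :=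
        integral_sub_right_eq_self (fun z : E n => ((1 + l * ‖z‖) ^ N)⁻¹) w
    _ = ((c / 2) ^ n)⁻¹ * I * ((ε * σ) ^ n)⁻¹ := by
        rw [integral_inv_one_add_smul_norm_pow _ _ hl0, hl, mul_pow, mul_inv]
        simp only [finrank_euclideanSpace, Fintype.card_fin]
        ring

/-- In the orthogonal splitting along `ℝw`, the ball bounds the one longitudinal variable and the
decay acts on the `n` transverse ones. Transferring both factors to fixed Euclidean spaces by
orthonormal bases makes the constant independent of `w`. -/
theorem integral_tube_le {n : ℕ} {N : ℕ} (hN : n < N) (R : ℝ) : ∃ C : ℝ, 0 ≤ C ∧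
    ∀ w : E (n + 1), w ≠ 0 → ∀ l : ℝ, 0 < l →
      Integrable (fun z : E (n + 1) => (Metric.closedBall (0 : E (n + 1)) R).indicator
        (fun z => ((1 + l * ‖(Submodule.span ℝ {w})ᗮ.orthogonalProjectionOnto z‖) ^ N)⁻¹) z) ∧
      ∫ z : E (n + 1), (Metric.closedBall (0 : E (n + 1)) R).indicator
        (fun z => ((1 + l * ‖(Submodule.span ℝ {w})ᗮ.orthogonalProjectionOnto z‖) ^ N)⁻¹) z ≤
        C * (l ^ n)⁻¹ := by
  set I : ℝ := ∫ x : E n, ((1 + ‖x‖) ^ N)⁻¹ with hI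
  set B : ℝ := ∫ x : E 1, (Metric.closedBall (0 : E 1) R).indicator (fun _ => (1 : ℝ)) x with hB
  have hI0 : 0 ≤ I := integral_nonneg fun x => by positivity
  have hB0 : 0 ≤ B := integral_nonneg fun x => Set.indicator_nonneg (fun _ _ => zero_le_one) x
  refine ⟨B * I, by positivity, ?_⟩
  intro w hw l hl
  set K := Submodule.span ℝ {w} with hK
  have : Fact (Module.finrank ℝ (E (n + 1)) = n + 1) := ⟨by simp⟩
  have hd : Module.finrank ℝ Kᗮ = n := Submodule.finrank_orthogonal_span_singleton hw
  have hdK : Module.finrank ℝ K = 1 := finrank_span_singleton hw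
  let bK : OrthonormalBasis (Fin 1) ℝ K :=
    (stdOrthonormalBasis ℝ K).reindex (finCongr hdK)
  let bP : OrthonormalBasis (Fin n) ℝ Kᗮ :=
    (stdOrthonormalBasis ℝ Kᗮ).reindex (finCongr hd)
  have hbK : MeasurePreserving bK.repr volume volume := bK.measurePreserving_repr
  have hbP : MeasurePreserving bP.repr volume volume := bP.measurePreserving_repr
  let e : E (n + 1) ≃ᵐ K × Kᗮ := K.orthogonalDecomposition.toHomeomorph.toMeasurableEquiv.trans
    (MeasurableEquiv.toLp 2 _).symm
  have he : MeasurePreserving e volume (volume.prod volume) :=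
    K.orthogonalDecomposition.measurePreserving.trans (WithLp.volume_preserving_ofLp _ _)
  have he1 : ∀ z, (e z).1 = K.orthogonalProjectionOnto z := fun z => by
    simp [e]
  have he2 : ∀ z, (e z).2 = Kᗮ.orthogonalProjectionOnto z := fun z => by
    simp [e]
  let g1 : K → ℝ := (Metric.closedBall (0 : K) R).indicator (fun _ => (1 : ℝ))
  let g2 : Kᗮ → ℝ := fun v => ((1 + l * ‖v‖) ^ N)⁻¹
  have hg1 : Integrable g1 := by
    refine (integrable_indicator_iff Metric.isClosed_closedBall.measurableSet).2 ?_
    exact integrableOn_const (isCompact_closedBall (0 : K) R).measure_lt_top.ne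
  have hg2 : Integrable g2 := by
    have h1 := (integrable_inv_one_add_norm_pow (volume : Measure Kᗮ) (N := N)
      (by rw [hd]; exact hN)).comp_smul hl.ne'
    simpa only [norm_smul, Real.norm_of_nonneg hl.le] using h1
  have hg : Integrable (fun p : K × Kᗮ => g1 p.1 * g2 p.2) (volume.prod volume) :=
    hg1.mul_prod hg2
  have hge : Integrable (fun z => g1 (e z).1 * g2 (e z).2) :=
    (he.integrable_comp_emb e.measurableEmbedding).2 hg
  have hle : ∀ z : E (n + 1), (Metric.closedBall (0 : E (n + 1)) R).indicator
      (fun z => ((1 + l * ‖Kᗮ.orthogonalProjectionOnto z‖) ^ N)⁻¹) z ≤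
      g1 (e z).1 * g2 (e z).2 := by
    intro z
    by_cases hz : z ∈ Metric.closedBall (0 : E (n + 1)) R
    · rw [Set.indicator_of_mem hz]
      have : (e z).1 ∈ Metric.closedBall (0 : K) R := by
        rw [he1, mem_closedBall_zero_iff]
        exact (K.norm_orthogonalProjectionOnto_apply_le z).trans (by simpa using hz)
      simp only [g1, g2, Set.indicator_of_mem this, one_mul, he2]
      exact le_rfl
    · rw [Set.indicator_of_notMem hz]
      refine mul_nonneg (Set.indicator_nonneg (fun _ _ => zero_le_one) _) ?_
      simp only [g2]
      positivity
  have h0 : ∀ z : E (n + 1), 0 ≤ (Metric.closedBall (0 : E (n + 1)) R).indicator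
      (fun z => ((1 + l * ‖Kᗮ.orthogonalProjectionOnto z‖) ^ N)⁻¹) z :=
    fun z => Set.indicator_nonneg (fun z _ => by positivity) z
  have hint : Integrable (fun z : E (n + 1) => (Metric.closedBall (0 : E (n + 1)) R).indicator
      (fun z => ((1 + l * ‖Kᗮ.orthogonalProjectionOnto z‖) ^ N)⁻¹) z) := by
    refine hge.mono' ?_ (Eventually.of_forall fun z => ?_)
    · refine AEStronglyMeasurable.indicator ?_ Metric.isClosed_closedBall.measurableSet
      refine Continuous.aestronglyMeasurable (Continuous.inv₀ (by fun_prop) fun z => ?_)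
      positivity
    · rw [Real.norm_of_nonneg (h0 z)]
      exact hle z
  refine ⟨hint, ?_⟩
  calc _ ≤ ∫ z, g1 (e z).1 * g2 (e z).2 := integral_mono hint hge hle
    _ = ∫ p, g1 p.1 * g2 p.2 ∂(volume.prod volume) :=
        he.integral_comp' (fun p : K × Kᗮ => g1 p.1 * g2 p.2)
    _ = (∫ u, g1 u) * ∫ v, g2 v := integral_prod_mul _ _
    _ = B * ((l ^ n)⁻¹ * I) := by
        congr 1
        · rw [hB, ← hbK.integral_comp bK.repr.toHomeomorph.measurableEmbedding]
          congr 1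
          ext u
          simp only [g1, Set.indicator, mem_closedBall_zero_iff, LinearIsometryEquiv.norm_map]
        · simp only [g2]
          rw [integral_inv_one_add_smul_norm_pow _ _ hl, hd, hI,
            ← hbP.integral_comp bP.repr.toHomeomorph.measurableEmbedding]
          simp only [LinearIsometryEquiv.norm_map]
    _ = _ := by ring

/-- For `a = 1` the packets concentrate only in a tube around the line through the minimiser, so one
of the `n + 1` dimensions gives no gain. -/
theorem integral_phaseGradient_cone_le {n : ℕ} {a : ℝ} (ha : 0 < a) {s₁ s₂ : ℝ}
    (h₁ : 0 < s₁) {N : ℕ} (hN : n < N) : ∃ C : ℝ, 0 ≤ C ∧ ∀ ε σ : ℝ, 0 < ε → 0 < σ →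
      ∀ x : E (n + 1),
        ∫ z in annulus (n + 1) s₁ s₂, ((1 + ‖ε • (x + σ • phaseGradient a z)‖) ^ N)⁻¹ ≤
        C * ((ε * σ) ^ n)⁻¹ := by
  obtain ⟨c, hc, hanti⟩ := norm_orthogonalProjection_le_phaseGradient_sub (n := n + 1) ha
    (s₂ := s₂) h₁
  obtain ⟨T, hT0, hT⟩ := integral_tube_le hN s₂
  refine ⟨T * ((c / 2) ^ n)⁻¹, by positivity, ?_⟩
  intro ε σ hε hσ x
  rcases (annulus (n + 1) s₁ s₂).eq_empty_or_nonempty with hem | hne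
  · rw [hem]; simp only [Measure.restrict_empty, integral_zero_measure]; positivity
  obtain ⟨w, hwA, hw⟩ := (isCompact_annulus (n + 1) s₁ s₂).exists_isMinOn hne
    (f := fun z => ‖x + σ • phaseGradient a z‖)
    ((continuousOn_const.add ((continuousOn_phaseGradient a h₁).const_smul σ)).norm)
  have hw0 : w ≠ 0 := norm_pos_iff.1 (h₁.trans_le hwA.1)
  set l := ε * σ * (c / 2) with hl
  have hl0 : 0 < l := by positivity
  obtain ⟨hint, hle⟩ := hT w hw0 l hl0
  have hmeas : MeasurableSet (annulus (n + 1) s₁ s₂) := measurableSet_annulus _ _ _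
  calc ∫ z in annulus (n + 1) s₁ s₂, ((1 + ‖ε • (x + σ • phaseGradient a z)‖) ^ N)⁻¹
      = ∫ z, (annulus (n + 1) s₁ s₂).indicator
          (fun z => ((1 + ‖ε • (x + σ • phaseGradient a z)‖) ^ N)⁻¹) z :=
        (integral_indicator hmeas).symm
    _ ≤ ∫ z, (Metric.closedBall (0 : E (n + 1)) s₂).indicator
        (fun z => ((1 + l * ‖(Submodule.span ℝ {w})ᗮ.orthogonalProjectionOnto z‖) ^ N)⁻¹) z := by
        refine integral_mono_of_nonneg (Eventually.of_forall fun z =>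
          Set.indicator_nonneg (fun z _ => by positivity) z) hint (Eventually.of_forall fun z => ?_)
        by_cases hz : z ∈ annulus (n + 1) s₁ s₂
        · have hz2 : z ∈ Metric.closedBall (0 : E (n + 1)) s₂ := by simpa using hz.2
          rw [Set.indicator_of_mem hz, Set.indicator_of_mem hz2]
          gcongr
          rw [norm_smul, Real.norm_of_nonneg hε.le]
          have h3 := norm_add_smul_ge_of_isMinOn hσ hw hz
          have h4 := hanti z hz w hwA
          calc _ = ε * (σ / 2 * (c * ‖(Submodule.span ℝ {w})ᗮ.orthogonalProjectionOnto z‖)) := by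
                rw [hl]; ring
            _ ≤ ε * (σ / 2 * ‖phaseGradient a z - phaseGradient a w‖) := by gcongr
            _ ≤ _ := by gcongr
        · rw [Set.indicator_of_notMem hz]
          exact Set.indicator_nonneg (fun z _ => by positivity) z
    _ ≤ T * (l ^ n)⁻¹ := hle
    _ = _ := by rw [hl, mul_pow, mul_inv]; ring

/-! ### Dispersive estimates for a single frequency shell -/

/-- The convolution kernel of the multiplier `e^{iτ(2π‖ξ‖)^a} b(ξ)`. -/
def oscKernel {n : ℕ} (a τ : ℝ) (b : E n → ℂ) : E n → ℂ :=
  𝓕⁻ (fun ξ : E n => Complex.exp (Complex.I * ((τ * (2 * Real.pi * ‖ξ‖) ^ a : ℝ) : ℂ)) * b ξ)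

/-- The phase need not be smooth at the origin and is not compactly supported. It may be altered
away from the support of the symbol, provided it is kept on an open neighbourhood of the slightly
enlarged annulus, so that the gradients agree there too. -/
theorem exists_smooth_phase {n : ℕ} (a : ℝ) {c₁ c₂ : ℝ} (h₁ : 0 < c₁) (h₂ : c₁ ≤ c₂) :
    ∃ P : E n → ℝ, ContDiff ℝ ∞ P ∧ HasCompactSupport P ∧
      ∀ z : E n, c₁ / 4 < ‖z‖ → ‖z‖ < c₂ + c₁ → P z = (2 * Real.pi * ‖z‖) ^ a := by
  let φ : ContDiffBump (0 : E n) := ⟨c₂ + c₁, c₂ + c₁ + 1, by linarith, by linarith⟩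
  let ψ : ContDiffBump (0 : E n) := ⟨c₁ / 8, c₁ / 4, by linarith, by linarith⟩
  refine ⟨fun z => (φ z - ψ z) * (2 * Real.pi * ‖z‖) ^ a, ?_, ?_, ?_⟩
  · rw [contDiff_iff_contDiffAt]
    intro z
    by_cases hz : z = 0
    · refine ContDiffAt.congr_of_eventuallyEq (f := fun _ => (0 : ℝ)) contDiffAt_const ?_
      rw [hz]
      filter_upwards [φ.eventuallyEq_one, ψ.eventuallyEq_one] with w hw1 hw2
      simp [hw1, hw2]
    · refine (φ.contDiffAt.sub ψ.contDiffAt).mul ?_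
      refine ContDiffAt.rpow_const_of_ne (contDiffAt_const.mul (contDiffAt_norm ℝ hz)) ?_
      have : 0 < ‖z‖ := norm_pos_iff.2 hz
      positivity
  · refine HasCompactSupport.mul_right ?_
    exact φ.hasCompactSupport.sub ψ.hasCompactSupport
  · intro z hz1 hz2
    have e1 : φ z = 1 := φ.one_of_mem_closedBall (by simpa using hz2.le)
    have e2 : ψ z = 0 := ψ.zero_of_le_dist (by simpa using hz1.le)
    simp [e1, e2]

/-- The packet scale `ε = (1 + τ)^{-1/2}` is admissible uniformly down to `τ = 0`. -/
theorem sqrt_one_add_props {τ : ℝ} (hτ : 0 ≤ τ) : 0 < (√(1 + τ))⁻¹ ∧ (√(1 + τ))⁻¹ ≤ 1 ∧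
    τ * (√(1 + τ))⁻¹ ^ 2 ≤ 1 := by
  have h : 1 ≤ √(1 + τ) := Real.one_le_sqrt.2 (by linarith)
  refine ⟨by positivity, inv_le_one_of_one_le₀ h, ?_⟩
  rw [inv_pow, Real.sq_sqrt (by linarith), ← div_eq_mul_inv, div_le_one (by linarith)]
  linarith

/-- The wave packet bound for the kernel `oscKernel`. -/
theorem norm_oscKernel_le {n : ℕ} (a : ℝ) {c₁ c₂ : ℝ} (h₁ : 0 < c₁) (h₂ : c₁ ≤ c₂)
    {b : E n → ℂ} (hb : ContDiff ℝ ∞ b) (hbs : ∀ ξ, b ξ ≠ 0 → c₁ ≤ ‖ξ‖ ∧ ‖ξ‖ ≤ c₂) (N : ℕ) :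
    ∃ C : ℝ, 0 ≤ C ∧ ∀ τ : ℝ, 0 ≤ τ → ∀ x : E n, ‖oscKernel a τ b x‖ ≤
      C * ∫ z in annulus n (c₁ / 2) (c₂ + c₁ / 2),
        ((1 + ‖(√(1 + τ))⁻¹ • (x + (τ / (2 * Real.pi)) • phaseGradient a z)‖) ^ N)⁻¹ := by
  obtain ⟨P, hP, hPc, hPe⟩ := exists_smooth_phase (n := n) a h₁ h₂
  have hbc : HasCompactSupport b :=
    HasCompactSupport.of_support_subset_isCompact (isCompact_closedBall 0 c₂)
      (fun ξ hξ => by simpa using (hbs ξ hξ).2)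
  obtain ⟨C, hC0, hC⟩ := norm_fourierInv_osc_le N hP hPc hb hbc (δ := c₁ / 2) (by linarith)
    (isCompact_annulus n (c₁ / 2) (c₂ + c₁ / 2)) (by
      intro z w hw hzw
      obtain ⟨h3, h4⟩ := hbs _ hzw
      have h5 := norm_add_le z w
      have h6 : ‖z‖ ≤ ‖z + w‖ + ‖w‖ := by simpa using norm_sub_le (z + w) w
      exact ⟨by linarith, by linarith⟩)
  refine ⟨C, hC0, ?_⟩
  intro τ hτ x
  obtain ⟨he0, he1, he2⟩ := sqrt_one_add_props hτ
  have hk : oscKernel a τ b = 𝓕⁻ (fun ξ => Complex.exp (Complex.I * (τ * P ξ : ℝ)) * b ξ) := by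
    unfold oscKernel
    congr 1
    ext ξ
    by_cases hξ : b ξ = 0
    · simp [hξ]
    · obtain ⟨h3, h4⟩ := hbs ξ hξ
      rw [hPe ξ (by linarith) (by linarith)]
  rw [hk]
  refine (hC τ _ hτ he0 he1 he2 x).trans (le_of_eq ?_)
  congr 1
  refine setIntegral_congr_fun (measurableSet_annulus _ _ _) fun z hz => ?_
  have hg : gradient P z = phaseGradient a z := by
    have hz0 : z ≠ 0 := norm_pos_iff.1 (lt_of_lt_of_le (by linarith) hz.1)
    refine ((hasGradientAt_phase a hz0).congr_of_eventuallyEq ?_).gradient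
    have h1 : ∀ᶠ y in nhds z, c₁ / 4 < ‖y‖ :=
      continuous_norm.continuousAt.eventually (lt_mem_nhds (lt_of_lt_of_le (by linarith) hz.1))
    have h2 : ∀ᶠ y in nhds z, ‖y‖ < c₂ + c₁ :=
      continuous_norm.continuousAt.eventually (gt_mem_nhds (lt_of_le_of_lt hz.2 (by linarith)))
    filter_upwards [h1, h2] with y hy1 hy2 using hPe y hy1 hy2
  simp only [hg]

/-- The dispersive estimate. -/
theorem norm_oscKernel_le_sqrt_pow {n d : ℕ} {a : ℝ} (ha : 0 < a)
    (hd : (a ≠ 1 ∧ d = n) ∨ d + 1 = n) {c₁ c₂ : ℝ} (h₁ : 0 < c₁) (h₂ : c₁ ≤ c₂)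
    {b : E n → ℂ} (hb : ContDiff ℝ ∞ b) (hbs : ∀ ξ, b ξ ≠ 0 → c₁ ≤ ‖ξ‖ ∧ ‖ξ‖ ≤ c₂) :
    ∃ C : ℝ, 0 ≤ C ∧ ∀ τ : ℝ, 0 ≤ τ → ∀ x : E n,
      ‖oscKernel a τ b x‖ ≤ C * (√(1 + τ) ^ d)⁻¹ := by
  obtain ⟨C, hC0, hC⟩ := norm_oscKernel_le a h₁ h₂ hb hbs (d + 1)
  have hint : ∃ T : ℝ, 0 ≤ T ∧ ∀ ε σ : ℝ, 0 < ε → 0 < σ → ∀ x : E n,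
      ∫ z in annulus n (c₁ / 2) (c₂ + c₁ / 2),
        ((1 + ‖ε • (x + σ • phaseGradient a z)‖) ^ (d + 1))⁻¹ ≤ T * ((ε * σ) ^ d)⁻¹ := by
    rcases hd with ⟨ha1, rfl⟩ | rfl
    · exact integral_phaseGradient_le ha ha1 (by linarith) (by omega)
    · exact integral_phaseGradient_cone_le ha (by linarith) (by omega)
  obtain ⟨T, hT0, hT⟩ := hint
  set W : ℝ := (volume (annulus n (c₁ / 2) (c₂ + c₁ / 2))).toReal with hW
  have hW0 : 0 ≤ W := ENNReal.toReal_nonneg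
  refine ⟨C * (T * (4 * Real.pi) ^ d + W * 2 ^ d), by positivity, ?_⟩
  intro τ hτ x
  refine (hC τ hτ x).trans ?_
  rw [mul_assoc]
  gcongr
  have hs : 0 < √(1 + τ) := Real.sqrt_pos.2 (by linarith)
  have hss : √(1 + τ) * √(1 + τ) = 1 + τ := Real.mul_self_sqrt (by linarith)
  -- For `τ < 1` the integrand is at most `1` and `√(1 + τ) ≤ 2`, so the trivial bound suffices. For
  -- `τ ≥ 1`, `εσ` is comparable to `√(1 + τ)` because `1 + τ ≤ 2τ`.
  rcases lt_or_ge τ 1 with h | h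
  · calc _ ≤ ∫ z in annulus n (c₁ / 2) (c₂ + c₁ / 2), (1 : ℝ) := by
          refine integral_mono_of_nonneg (Eventually.of_forall fun z => by positivity) ?_
            (Eventually.of_forall fun z => ?_)
          · exact integrableOn_const (isCompact_annulus n _ _).measure_lt_top.ne
          · exact inv_le_one_of_one_le₀ (one_le_pow₀ (by
              have := norm_nonneg ((√(1 + τ))⁻¹ • (x + (τ / (2 * Real.pi)) • phaseGradient a z))
              linarith))
      _ = W := by rw [setIntegral_const]; simp [hW, Measure.real]
      _ ≤ W * 2 ^ d * (√(1 + τ) ^ d)⁻¹ := by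
          rw [mul_assoc]
          refine le_mul_of_one_le_right hW0 ?_
          rw [← div_eq_mul_inv, ← div_pow]
          refine one_le_pow₀ ?_
          rw [one_le_div hs]
          nlinarith
      _ ≤ _ := by
          gcongr
          have : 0 ≤ T * (4 * Real.pi) ^ d := by positivity
          linarith
  · have hlow : √(1 + τ) / (4 * Real.pi) ≤ (√(1 + τ))⁻¹ * (τ / (2 * Real.pi)) := by
      rw [inv_mul_eq_div, div_div, div_le_div_iff₀ (by positivity) (by positivity)]
      nlinarith [Real.pi_pos]
    calc _ ≤ T * (((√(1 + τ))⁻¹ * (τ / (2 * Real.pi))) ^ d)⁻¹ :=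
          hT _ _ (by positivity) (by positivity) x
      _ ≤ T * ((√(1 + τ) / (4 * Real.pi)) ^ d)⁻¹ := by gcongr
      _ = T * (4 * Real.pi) ^ d * (√(1 + τ) ^ d)⁻¹ := by
          rw [div_pow, inv_div]
          field_simp
      _ ≤ _ := by
          gcongr
          have : 0 ≤ W * 2 ^ d := by positivity
          linarith

/-- The kernel decays rapidly outside a ball of radius comparable to `1 + τ`. -/
theorem norm_oscKernel_le_of_far {n : ℕ} (a : ℝ) {c₁ c₂ : ℝ} (h₁ : 0 < c₁) (h₂ : c₁ ≤ c₂)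
    {b : E n → ℂ} (hb : ContDiff ℝ ∞ b) (hbs : ∀ ξ, b ξ ≠ 0 → c₁ ≤ ‖ξ‖ ∧ ‖ξ‖ ≤ c₂) (N : ℕ) :
    ∃ C C₀ : ℝ, 0 ≤ C ∧ 0 < C₀ ∧ ∀ τ : ℝ, 0 ≤ τ → ∀ x : E n, C₀ * (1 + τ) ≤ ‖x‖ →
      ‖oscKernel a τ b x‖ ≤ C * (√(1 + τ) / ‖x‖) ^ N := by
  obtain ⟨C, hC0, hC⟩ := norm_oscKernel_le a h₁ h₂ hb hbs N
  set A := annulus n (c₁ / 2) (c₂ + c₁ / 2) with hA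
  obtain ⟨G, hG⟩ := (isCompact_annulus n (c₁ / 2) (c₂ + c₁ / 2)).exists_bound_of_continuousOn
    (continuousOn_phaseGradient a (by linarith))
  set W : ℝ := (volume A).toReal with hW
  have hW0 : 0 ≤ W := ENNReal.toReal_nonneg
  refine ⟨C * (W * 2 ^ N), |G| + 1, by positivity, by positivity, ?_⟩
  intro τ hτ x hx
  have hx0 : 0 < ‖x‖ := lt_of_lt_of_le (by positivity) hx
  have hs : 0 < √(1 + τ) := Real.sqrt_pos.2 (by linarith)
  refine (hC τ hτ x).trans ?_
  rw [mul_assoc]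
  gcongr
  calc _ ≤ ∫ z in A, 2 ^ N * (√(1 + τ) / ‖x‖) ^ N := by
        refine integral_mono_of_nonneg (Eventually.of_forall fun z => by positivity) ?_ ?_
        · exact integrableOn_const (isCompact_annulus n _ _).measure_lt_top.ne
        · refine (ae_restrict_iff' (measurableSet_annulus _ _ _)).2
            (Eventually.of_forall fun z hz => ?_)
          simp only
          rw [← mul_pow, ← inv_pow]
          gcongr
          -- With `C₀ = |G| + 1` the displacement of every packet is at most half of `‖x‖`.
          have h3 : ‖(τ / (2 * Real.pi)) • phaseGradient a z‖ ≤ ‖x‖ / 2 := by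
            rw [norm_smul, Real.norm_of_nonneg (by positivity)]
            have h4 : ‖phaseGradient a z‖ ≤ |G| := (hG z hz).trans (le_abs_self G)
            have h5 : τ / (2 * Real.pi) ≤ τ / 2 := by
              gcongr
              linarith [Real.pi_gt_three]
            calc _ ≤ τ / 2 * |G| := by gcongr
              _ ≤ ‖x‖ / 2 := by nlinarith [abs_nonneg G]
          have h6 : ‖x‖ / 2 ≤ ‖x + (τ / (2 * Real.pi)) • phaseGradient a z‖ := by
            have := norm_sub_le (x + (τ / (2 * Real.pi)) • phaseGradient a z)
              ((τ / (2 * Real.pi)) • phaseGradient a z)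
            rw [add_sub_cancel_right] at this
            linarith
          rw [norm_smul, Real.norm_of_nonneg (by positivity)]
          have h7 : ‖x‖ / (2 * √(1 + τ)) ≤
              1 + (√(1 + τ))⁻¹ * ‖x + (τ / (2 * Real.pi)) • phaseGradient a z‖ := by
            calc ‖x‖ / (2 * √(1 + τ)) = (√(1 + τ))⁻¹ * (‖x‖ / 2) := by field_simp
              _ ≤ (√(1 + τ))⁻¹ * ‖x + (τ / (2 * Real.pi)) • phaseGradient a z‖ := by gcongr
              _ ≤ _ := by linarith
          calc _ ≤ (‖x‖ / (2 * √(1 + τ)))⁻¹ := by gcongr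
            _ = 2 * (√(1 + τ) / ‖x‖) := by field_simp
    _ = W * 2 ^ N * (√(1 + τ) / ‖x‖) ^ N := by
        rw [setIntegral_const, smul_eq_mul, mul_assoc]
        rfl

/-! ### Plancherel and the two endpoint bounds -/

/-- Plancherel's theorem for the Fourier integral on `L¹ ∩ L²`. -/
theorem eLpNorm_fourier_eq {n : ℕ} {F : E n → ℂ} (hF : Integrable F) (hF2 : MemLp F 2) :
    eLpNorm (𝓕 F) 2 = eLpNorm F 2 := by
  let f : Lp ℂ 2 (volume : Measure (E n)) := hF2.toLp F
  have hcont : Continuous (𝓕 F) :=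
    VectorFourier.fourierIntegral_continuous Real.continuous_fourierChar
      (by exact continuous_inner) hF
  -- The `L²` transform and the integral transform are compared by testing against smooth compactly
  -- supported functions; both pairings move the transform onto the test function.
  have hae : (𝓕 f : Lp ℂ 2 (volume : Measure (E n))) =ᵐ[volume] 𝓕 F := by
    refine ae_eq_of_integral_contDiff_smul_eq
      ((Lp.memLp (𝓕 f : Lp ℂ 2 (volume : Measure (E n)))).locallyIntegrable (by norm_num))
      hcont.locallyIntegrable ?_
    intro g hg hgc
    have hg' : ContDiff ℝ ∞ (fun x => ((g x : ℝ) : ℂ)) := Complex.ofRealCLM.contDiff.comp hg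
    have hgc' : HasCompactSupport (fun x => ((g x : ℝ) : ℂ)) := by
      refine HasCompactSupport.intro hgc ?_
      intro x hx
      simp [image_eq_zero_of_notMem_tsupport hx]
    let φ : 𝓢(E n, ℂ) := hgc'.toSchwartzMap hg'
    have hφ : ∀ x, φ x = (g x : ℂ) := fun x => rfl
    have h1 := congrArg (fun T : 𝓢'(E n, ℂ) => T φ) (Lp.fourier_toTemperedDistribution_eq f)
    simp only [TemperedDistribution.fourier_apply, Lp.toTemperedDistribution_apply] at h1
    have h2 : ∫ x, g x • (𝓕 f : Lp ℂ 2 (volume : Measure (E n))) x =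
        ∫ x, φ x • (𝓕 f : Lp ℂ 2 (volume : Measure (E n))) x := by
      congr 1
    rw [h2, ← h1]
    have h3 : ∫ x, g x • 𝓕 F x = ∫ x, φ x * 𝓕 F x := by
      congr 1
    rw [h3]
    have h4 : ∫ x, (𝓕 φ) x • f x = ∫ x, 𝓕 (φ : E n → ℂ) x * F x := by
      refine integral_congr_ae ?_
      filter_upwards [hF2.coeFn_toLp] with x hx
      rw [hx, smul_eq_mul, SchwartzMap.fourier_coe]
    rw [h4]
    have h5 := VectorFourier.integral_fourierIntegral_smul_eq_flip (L := innerₗ (E n))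
      (μ := volume) (ν := volume) (f := (φ : E n → ℂ)) (g := F) Real.continuous_fourierChar
      (by exact continuous_inner) φ.integrable hF
    simp only [smul_eq_mul, flip_innerₗ] at h5
    exact h5
  rw [← eLpNorm_congr_ae hae]
  have h6 := Lp.norm_fourier_eq f
  rw [Lp.norm_def, Lp.norm_def] at h6
  have h7 := (ENNReal.toReal_eq_toReal_iff' (Lp.eLpNorm_ne_top _) (Lp.eLpNorm_ne_top _)).1 h6
  rw [h7]
  exact eLpNorm_congr_ae hF2.coeFn_toLp

theorem eLpNorm_fourierInv_eq {n : ℕ} {F : E n → ℂ} (hF : Integrable F) (hF2 : MemLp F 2) :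
    eLpNorm (𝓕⁻ F) 2 = eLpNorm F 2 := by
  have hn : MeasurePreserving (fun x : E n => -x) volume volume := Measure.measurePreserving_neg _
  have h1 : 𝓕⁻ F = 𝓕 F ∘ fun x => -x := by
    ext x
    rw [Real.fourierInv_eq_fourier_neg]
    rfl
  have hcont : Continuous (𝓕 F) :=
    VectorFourier.fourierIntegral_continuous Real.continuous_fourierChar
      (by exact continuous_inner) hF
  rw [h1, eLpNorm_comp_measurePreserving hcont.aestronglyMeasurable hn, eLpNorm_fourier_eq hF hF2]

/-- The bilinear form of the Fourier multiplier `m`. -/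
def multiplierForm {n : ℕ} (m F G : E n → ℂ) : ℂ := ∫ ξ, m ξ * (𝓕 F ξ * 𝓕⁻ G ξ)

/-- The bilinear form of convolution with the kernel `K`. -/
def kernelForm {n : ℕ} (K F G : E n → ℂ) : ℂ :=
  ∫ p : E n × E n, K (p.1 - p.2) * (F p.2 * G p.1)

/-- The `L²` endpoint: Cauchy–Schwarz on the frequency side, then Plancherel for each factor. -/
theorem enorm_multiplierForm_le {n : ℕ} {m F G : E n → ℂ} {M : ℝ≥0}
    (hM : ∀ ξ, ‖m ξ‖₊ ≤ M) (hF : Integrable F) (hG : Integrable G) (hF2 : MemLp F 2)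
    (hG2 : MemLp G 2) :
    ‖multiplierForm m F G‖ₑ ≤ M * (eLpNorm F 2 * eLpNorm G 2) := by
  have hFc : Continuous (𝓕 F) :=
    VectorFourier.fourierIntegral_continuous Real.continuous_fourierChar
      (by exact continuous_inner) hF
  have hGc : Continuous (𝓕⁻ G) := by
    have h1 : 𝓕⁻ G = 𝓕 G ∘ fun x => -x := by
      ext x
      rw [Real.fourierInv_eq_fourier_neg]
      rfl
    rw [h1]
    exact (VectorFourier.fourierIntegral_continuous Real.continuous_fourierChar
      (by exact continuous_inner) hG).comp continuous_neg
  calc ‖multiplierForm m F G‖ₑ ≤ ∫⁻ ξ, ‖m ξ * (𝓕 F ξ * 𝓕⁻ G ξ)‖ₑ := enorm_integral_le_lintegral_enorm _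
    _ ≤ ∫⁻ ξ, M * (‖𝓕 F ξ‖ₑ * ‖𝓕⁻ G ξ‖ₑ) := by
        refine lintegral_mono fun ξ => ?_
        rw [enorm_mul, enorm_mul]
        gcongr
        exact enorm_le_coe.2 (hM ξ)
    _ = M * ∫⁻ ξ, ‖𝓕 F ξ‖ₑ * ‖𝓕⁻ G ξ‖ₑ := lintegral_const_mul' _ _ ENNReal.coe_ne_top
    _ ≤ M * (eLpNorm (𝓕 F) 2 * eLpNorm (𝓕⁻ G) 2) := by
        gcongr
        have := ENNReal.lintegral_mul_le_Lp_mul_Lq volume Real.HolderConjugate.two_two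
          hFc.enorm.measurable.aemeasurable hGc.enorm.measurable.aemeasurable
        rw [eLpNorm_eq_lintegral_rpow_enorm_toReal (by norm_num) (by norm_num),
          eLpNorm_eq_lintegral_rpow_enorm_toReal (by norm_num) (by norm_num)]
        simpa using this
    _ = _ := by rw [eLpNorm_fourier_eq hF hF2, eLpNorm_fourierInv_eq hG hG2]

/-- Fubini for an integrable symbol. It allows one form to be estimated by its symbol in `L²` and by
its kernel in `L¹`. -/
theorem multiplierForm_eq_kernelForm {n : ℕ} {m F G : E n → ℂ} (hm : Integrable m)
    (hF : Integrable F) (hG : Integrable G) :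
    multiplierForm m F G = kernelForm (𝓕⁻ m) F G := by
  unfold multiplierForm kernelForm
  have h1 : ∀ ξ, m ξ * (𝓕 F ξ * 𝓕⁻ G ξ) = ∫ p : E n × E n,
      m ξ * (Complex.exp (↑(2 * Real.pi * inner ℝ ξ (p.1 - p.2)) * Complex.I) *
        (F p.2 * G p.1)) := by
    intro ξ
    rw [integral_const_mul]
    congr 1
    rw [Real.fourier_eq', Real.fourierInv_eq', mul_comm, ← integral_prod_mul]
    congr 1
    ext p
    simp only [smul_eq_mul]
    have : Complex.exp (↑(2 * Real.pi * inner ℝ ξ (p.1 - p.2)) * Complex.I) =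
        Complex.exp (↑(2 * Real.pi * inner ℝ p.1 ξ) * Complex.I) *
        Complex.exp (↑(-2 * Real.pi * inner ℝ p.2 ξ) * Complex.I) := by
      rw [← Complex.exp_add, inner_sub_right, real_inner_comm, real_inner_comm ξ p.2]
      congr 1
      push_cast
      ring
    rw [this]
    ring
  simp only [h1]
  have hint : Integrable (Function.uncurry fun (ξ : E n) (p : E n × E n) =>
      m ξ * (Complex.exp (↑(2 * Real.pi * inner ℝ ξ (p.1 - p.2)) * Complex.I) *
        (F p.2 * G p.1))) (volume.prod volume) := by
    have h2 : Integrable (fun p : E n × E n => F p.2 * G p.1) :=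
      (hG.mul_prod hF).congr (Eventually.of_forall fun p => mul_comm _ _)
    have h3 := hm.mul_prod h2
    have h4 := h3.bdd_mul (c := 1) (f := fun q : E n × (E n × E n) =>
      Complex.exp (↑(2 * Real.pi * inner ℝ q.1 (q.2.1 - q.2.2)) * Complex.I))
      (Continuous.aestronglyMeasurable (by fun_prop))
      (Eventually.of_forall fun q => (Complex.norm_exp_ofReal_mul_I _).le)
    refine h4.congr (Eventually.of_forall fun q => ?_)
    simp only [Function.uncurry_def]
    ring
  rw [integral_integral_swap hint]
  congr 1
  ext p
  rw [Real.fourierInv_eq', ← integral_mul_const]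
  congr 1
  ext ξ
  simp only [smul_eq_mul]
  ring

theorem norm_kernelForm_le {n : ℕ} {K F G : E n → ℂ} {B : ℝ}
    (hB : ∀ x y, F y ≠ 0 → G x ≠ 0 → ‖K (x - y)‖ ≤ B) (hF : Integrable F) (hG : Integrable G) :
    ‖kernelForm K F G‖ ≤ B * ((∫ x, ‖F x‖) * ∫ x, ‖G x‖) := by
  unfold kernelForm
  have h2 : Integrable (fun p : E n × E n => ‖F p.2‖ * ‖G p.1‖) :=
    (hG.norm.mul_prod hF.norm).congr (Eventually.of_forall fun p => mul_comm _ _)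
  calc _ ≤ ∫ p : E n × E n, B * (‖F p.2‖ * ‖G p.1‖) := by
        refine norm_integral_le_of_norm_le (h2.const_mul B) (Eventually.of_forall fun p => ?_)
        rw [norm_mul, norm_mul]
        by_cases h1 : F p.2 = 0
        · simp [h1]
        by_cases h3 : G p.1 = 0
        · simp [h3]
        gcongr
        exact hB _ _ h1 h3
    _ = _ := by
        rw [integral_const_mul]
        congr 1
        rw [mul_comm, ← integral_prod_mul (fun x => ‖G x‖) (fun x => ‖F x‖)]
        simp only [mul_comm]
        rfl

/-! ### Complex interpolation -/

theorem norm_cpow_mul_log_le {u : ℝ} (hu0 : 0 ≤ u) (hu1 : u ≤ 1) {w : ℂ} (hw : 1 / 8 ≤ w.re) :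
    ‖(u : ℂ) ^ w * Complex.log u‖ ≤ 8 := by
  rcases hu0.eq_or_lt with rfl | hpos
  · simp
  · rw [norm_mul, Complex.norm_cpow_eq_rpow_re_of_pos hpos, ← Complex.ofReal_log hu0,
      Complex.norm_real, Real.norm_eq_abs]
    have h1 : u ^ w.re ≤ u ^ (1 / 8 : ℝ) := Real.rpow_le_rpow_of_exponent_ge hpos hu1 hw
    have h2 := Real.abs_log_mul_self_rpow_lt u (1 / 8) hpos hu1 (by norm_num)
    rw [abs_mul, abs_of_pos (Real.rpow_pos_of_pos hpos _)] at h2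
    calc u ^ w.re * |Real.log u| ≤ u ^ (1 / 8 : ℝ) * |Real.log u| := by gcongr
      _ = |Real.log u| * u ^ (1 / 8 : ℝ) := mul_comm _ _
      _ ≤ 8 := by
          refine h2.le.trans (by norm_num)

theorem interp_exponent_re {r : ℝ} (z : ℂ) : ((r : ℂ) * (1 - z / 2)).re = r * (1 - z.re / 2) := by
  simp

/-- Differentiation under the integral sign. On `Re z < 7/4` the exponent has real part at least
`r/8 ≥ 1/8`, where `u^w log u` is bounded by `8` for `0 ≤ u ≤ 1`; zeros of `u` therefore cause no
trouble. The range exceeds the unit strip, so its closure is covered. -/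
theorem differentiableOn_integral_cpow {X : Type*} [MeasurableSpace X] {μ : Measure X}
    {h : X → ℂ} {u bnd : X → ℝ} (hh : AEStronglyMeasurable h μ) (hb : ∀ x, ‖h x‖ ≤ bnd x)
    (hbi : Integrable bnd μ) (hu : Measurable u) (hu0 : ∀ x, 0 ≤ u x) (hu1 : ∀ x, u x ≤ 1)
    {r : ℝ} (hr1 : 1 ≤ r) (hr2 : r ≤ 2) :
    DifferentiableOn ℂ (fun z : ℂ => ∫ x, h x * (u x : ℂ) ^ ((r : ℂ) * (1 - z / 2)) ∂μ)
      {z | z.re < 3 / 2} := by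
  intro z₀ hz₀
  simp only [Set.mem_ofPred_eq] at hz₀
  have hopen : IsOpen {z : ℂ | z.re < 7 / 4} := isOpen_lt Complex.continuous_re continuous_const
  have hre : ∀ z ∈ {z : ℂ | z.re < 7 / 4}, 1 / 8 ≤ ((r : ℂ) * (1 - z / 2)).re := by
    intro z hz
    simp only [Set.mem_ofPred_eq] at hz
    rw [interp_exponent_re]
    nlinarith
  have hmeas : ∀ w : ℂ, Measurable fun x => (u x : ℂ) ^ w := fun w =>
    (Complex.measurable_ofReal.comp hu).pow_const w
  have hcpow : ∀ (w : ℂ) (x : X), 1 / 8 ≤ w.re → ‖(u x : ℂ) ^ w‖ ≤ 1 := by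
    intro w x hw
    rw [Complex.norm_cpow_eq_rpow_re_of_nonneg (hu0 x) (by linarith)]
    exact Real.rpow_le_one (hu0 x) (hu1 x) (by linarith)
  have key := hasDerivAt_integral_of_dominated_loc_of_deriv_le (μ := μ) (x₀ := z₀)
    (s := {z : ℂ | z.re < 7 / 4})
    (F := fun (z : ℂ) (x : X) => h x * (u x : ℂ) ^ ((r : ℂ) * (1 - z / 2)))
    (F' := fun (z : ℂ) (x : X) => h x * ((u x : ℂ) ^ ((r : ℂ) * (1 - z / 2)) *
      Complex.log (u x) * ((r : ℂ) * (-(1 / 2)))))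
    (bound := fun x => bnd x * 8) (hopen.mem_nhds (by simp only [Set.mem_ofPred_eq]; linarith))
    (Eventually.of_forall fun z => hh.mul (hmeas _).aestronglyMeasurable) ?_ ?_ ?_ ?_ ?_
  · exact key.2.differentiableAt.differentiableWithinAt
  · refine hbi.mono' (hh.mul (hmeas _).aestronglyMeasurable) (Eventually.of_forall fun x => ?_)
    rw [norm_mul]
    calc ‖h x‖ * ‖(u x : ℂ) ^ ((r : ℂ) * (1 - z₀ / 2))‖ ≤ bnd x * 1 := by
          gcongr
          · exact (norm_nonneg _).trans (hb x)
          · exact hb x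
          · exact hcpow _ _ (hre z₀ (by simp only [Set.mem_ofPred_eq]; linarith))
      _ = bnd x := mul_one _
  · refine hh.mul (Measurable.aestronglyMeasurable ?_)
    exact ((hmeas _).mul (Complex.measurable_log.comp (Complex.measurable_ofReal.comp hu))).mul_const _
  · refine Eventually.of_forall fun x z hz => ?_
    rw [norm_mul, norm_mul]
    have h1 := norm_cpow_mul_log_le (hu0 x) (hu1 x) (hre z hz)
    have h2 : ‖(r : ℂ) * (-(1 / 2))‖ ≤ 1 := by
      rw [norm_mul, Complex.norm_real, Real.norm_of_nonneg (by linarith)]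
      norm_num
      linarith
    calc _ ≤ bnd x * (8 * 1) := by
          have := (norm_nonneg _).trans (hb x)
          gcongr
          exact hb x
      _ = _ := by ring
  · exact hbi.mul_const 8
  · refine Eventually.of_forall fun x z hz => ?_
    have hd : HasDerivAt (fun z : ℂ => (r : ℂ) * (1 - z / 2)) ((r : ℂ) * (-(1 / 2))) z :=
      (((hasDerivAt_id z).div_const 2).const_sub 1).const_mul (r : ℂ)
    refine (hd.const_cpow (Or.inr ?_)).const_mul (h x)
    intro h0
    have := hre z hz
    rw [h0] at this
    norm_num at this

/-- The complex power of modulus `‖c‖ ^ re w` with the argument of `c`. -/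
def twist (w c : ℂ) : ℂ := c / (‖c‖ : ℂ) * (‖c‖ : ℂ) ^ w

theorem norm_twist {w : ℂ} (hw : 0 < w.re) (c : ℂ) : ‖twist w c‖ = ‖c‖ ^ w.re := by
  unfold twist
  rw [norm_mul, Complex.norm_cpow_eq_rpow_re_of_nonneg (norm_nonneg _) hw.ne', norm_div,
    Complex.norm_real, norm_norm]
  by_cases hc : c = 0
  · simp [hc, Real.zero_rpow hw.ne']
  · rw [div_self (norm_ne_zero_iff.2 hc), one_mul]

theorem twist_one (c : ℂ) : twist 1 c = c := by
  unfold twist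
  by_cases hc : c = 0
  · simp [hc]
  · have : (‖c‖ : ℂ) ≠ 0 := by exact_mod_cast norm_ne_zero_iff.2 hc
    rw [Complex.cpow_one]
    field_simp

theorem measurable_twist (w : ℂ) : Measurable (twist w) := by
  unfold twist
  have h : Measurable fun c : ℂ => (‖c‖ : ℂ) := Complex.measurable_ofReal.comp measurable_norm
  exact (measurable_id.div h).mul (h.pow_const w)

/-- Interpolation between the `L¹` and the `L²` bounds, for functions bounded by `1`. -/
theorem norm_kernelForm_le_interp_of_le_one {n : ℕ} {m F G : E n → ℂ} {B : ℝ} {M : ℝ≥0}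
    (hm : Integrable m) (hM : ∀ ξ, ‖m ξ‖₊ ≤ M) (hB : ∀ x, ‖𝓕⁻ m x‖ ≤ B)
    (hF : Measurable F) (hG : Measurable G) (hF1 : ∀ x, ‖F x‖ ≤ 1) (hG1 : ∀ x, ‖G x‖ ≤ 1)
    {S T : Set (E n)} (hS : MeasurableSet S) (hT : MeasurableSet T) (hSv : volume S ≠ ⊤)
    (hTv : volume T ≠ ⊤) (hFS : ∀ x ∉ S, F x = 0) (hGT : ∀ x ∉ T, G x = 0)
    {r : ℝ} (hr1 : 1 ≤ r) (hr2 : r ≤ 2) :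
    ‖kernelForm (𝓕⁻ m) F G‖ ≤ B ^ (2 / r - 1) * (M : ℝ) ^ (2 - 2 / r) *
      ((∫ x, ‖F x‖ ^ r) * ∫ x, ‖G x‖ ^ r) ^ (1 / r) := by
  have hr0 : 0 < r := by linarith
  have hB0 : 0 ≤ B := (norm_nonneg _).trans (hB 0)
  set A : ℝ := (∫ x, ‖F x‖ ^ r) * ∫ x, ‖G x‖ ^ r with hA
  have hA0 : 0 ≤ A := by positivity
  have hKc : Continuous (𝓕⁻ m) := by
    have h1 : 𝓕⁻ m = 𝓕 m ∘ fun x => -x := by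
      ext x
      rw [Real.fourierInv_eq_fourier_neg]
      rfl
    rw [h1]
    exact (VectorFourier.fourierIntegral_continuous Real.continuous_fourierChar
      (by exact continuous_inner) hm).comp continuous_neg
  have hbound : ∀ (H : E n → ℂ) (U : Set (E n)), Measurable H → MeasurableSet U →
      volume U ≠ ⊤ → (∀ x, ‖H x‖ ≤ 1) → (∀ x ∉ U, H x = 0) → ∀ p : ℝ≥0∞, MemLp H p := by
    intro H U hH hU hUv hH1 hH0 p
    have h1 : H = U.indicator H := by
      ext x
      by_cases hx : x ∈ U
      · rw [Set.indicator_of_mem hx]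
      · rw [Set.indicator_of_notMem hx, hH0 x hx]
    rw [h1, memLp_indicator_iff_restrict hU]
    have : IsFiniteMeasure (volume.restrict U) := ⟨by simpa using hUv.lt_top⟩
    exact MemLp.of_bound hH.aestronglyMeasurable 1 (Eventually.of_forall hH1)
  -- The exponent has real part `r` on `Re z = 0` and `r/2` on `Re z = 1`. The `L¹` and `L²` norms
  -- of the twisted functions are then powers of `∫ |F|^r` and `∫ |G|^r`.
  let e : ℂ → ℂ := fun z => (r : ℂ) * (1 - z / 2)
  have hre : ∀ z : ℂ, (e z).re = r * (1 - z.re / 2) := fun z => interp_exponent_re z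
  let Φ : ℂ → ℂ := fun z => kernelForm (𝓕⁻ m) (fun x => twist (e z) (F x))
    (fun x => twist (e z) (G x))
  have hstrip : ∀ z ∈ Complex.HadamardThreeLines.verticalClosedStrip 0 1, 1 / 2 ≤ (e z).re := by
    intro z hz
    have hz1 : z.re ≤ 1 := hz.2
    rw [hre]
    nlinarith
  have htw : ∀ (H : E n → ℂ) (U : Set (E n)), Measurable H → MeasurableSet U →
      volume U ≠ ⊤ → (∀ x, ‖H x‖ ≤ 1) → (∀ x ∉ U, H x = 0) → ∀ w : ℂ, 0 < w.re → ∀ p : ℝ≥0∞,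
      MemLp (fun x => twist w (H x)) p := by
    intro H U hH hU hUv hH1 hH0 w hw p
    refine hbound _ U ((measurable_twist w).comp hH) hU hUv ?_ ?_ p
    · intro x
      rw [Function.comp_apply, norm_twist hw]
      exact Real.rpow_le_one (norm_nonneg _) (hH1 x) hw.le
    · intro x hx
      simp [hH0 x hx, twist]
  have hΦ : ∀ z, Φ z = ∫ p : E n × E n, (𝓕⁻ m (p.1 - p.2) *
      (F p.2 / (‖F p.2‖ : ℂ) * (G p.1 / (‖G p.1‖ : ℂ)))) *
      ((‖F p.2‖ * ‖G p.1‖ : ℝ) : ℂ) ^ ((r : ℂ) * (1 - z / 2)) := by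
    intro z
    simp only [Φ, kernelForm, twist, e]
    congr 1
    ext p
    rw [Complex.ofReal_mul, Complex.mul_cpow_ofReal_nonneg (norm_nonneg _) (norm_nonneg _)]
    ring
  have hsgn : ∀ c : ℂ, ‖c / (‖c‖ : ℂ)‖ ≤ 1 := by
    intro c
    rw [norm_div, Complex.norm_real, norm_norm]
    exact div_self_le_one _
  have hdiff : DifferentiableOn ℂ Φ {z | z.re < 3 / 2} := by
    have hΦ' : Φ = fun z => ∫ p : E n × E n, (𝓕⁻ m (p.1 - p.2) *
      (F p.2 / (‖F p.2‖ : ℂ) * (G p.1 / (‖G p.1‖ : ℂ)))) *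
      ((‖F p.2‖ * ‖G p.1‖ : ℝ) : ℂ) ^ ((r : ℂ) * (1 - z / 2)) := funext hΦ
    rw [hΦ']
    have hsg : ∀ {H : E n → ℂ}, Measurable H → Measurable fun x => H x / (‖H x‖ : ℂ) :=
      fun hH => hH.div (Complex.measurable_ofReal.comp hH.norm)
    refine differentiableOn_integral_cpow
      (bnd := fun p => (T ×ˢ S).indicator (fun _ => B) p) ?_ ?_ ?_ ?_ ?_ ?_ hr1 hr2
    · refine Measurable.aestronglyMeasurable ?_
      exact (hKc.measurable.comp (measurable_fst.sub measurable_snd)).mul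
        (((hsg hF).comp measurable_snd).mul ((hsg hG).comp measurable_fst))
    · intro p
      by_cases hp : p ∈ T ×ˢ S
      · rw [Set.indicator_of_mem hp, norm_mul, norm_mul]
        calc _ ≤ B * (1 * 1) := by
              gcongr
              · exact hB _
              · exact hsgn _
              · exact hsgn _
          _ = B := by ring
      · rw [Set.indicator_of_notMem hp]
        have : p.1 ∉ T ∨ p.2 ∉ S := by
          by_contra! hcon
          exact hp ⟨hcon.1, hcon.2⟩
        rcases this with h | h
        · simp [hGT _ h]
        · simp [hFS _ h]
    · refine (integrable_indicator_iff (hT.prod hS)).2 ?_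
      refine integrableOn_const ?_
      rw [Measure.volume_eq_prod, Measure.prod_prod]
      exact ENNReal.mul_ne_top hTv hSv
    · exact (hF.norm.comp measurable_snd).mul (hG.norm.comp measurable_fst)
    · intro p; positivity
    · intro p
      exact mul_le_one₀ (hF1 _) (norm_nonneg _) (hG1 _)
  have hL1 : ∀ z ∈ Complex.HadamardThreeLines.verticalClosedStrip 0 1, ‖Φ z‖ ≤
      B * ((∫ x, ‖F x‖ ^ (e z).re) * ∫ x, ‖G x‖ ^ (e z).re) := by
    intro z hz
    have hw : 0 < (e z).re := by linarith [hstrip z hz]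
    have := norm_kernelForm_le (fun x y _ _ => hB (x - y))
      (memLp_one_iff_integrable.1 (htw F S hF hS hSv hF1 hFS (e z) hw 1))
      (memLp_one_iff_integrable.1 (htw G T hG hT hTv hG1 hGT (e z) hw 1))
    simpa only [norm_twist hw] using this
  have hint_le : ∀ (H : E n → ℂ) (U : Set (E n)), Measurable H → MeasurableSet U →
      volume U ≠ ⊤ → (∀ x, ‖H x‖ ≤ 1) → (∀ x ∉ U, H x = 0) → ∀ s : ℝ, 0 < s →
      ∫ x, ‖H x‖ ^ s ≤ (volume U).toReal := by
    intro H U hH hU hUv hH1 hH0 s hs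
    calc ∫ x, ‖H x‖ ^ s ≤ ∫ x, U.indicator (fun _ => (1 : ℝ)) x := by
          refine integral_mono_of_nonneg (Eventually.of_forall fun x => by positivity) ?_
            (Eventually.of_forall fun x => ?_)
          · exact (integrable_indicator_iff hU).2 (integrableOn_const hUv)
          · by_cases hx : x ∈ U
            · simp only [Set.indicator_of_mem hx]
              exact Real.rpow_le_one (norm_nonneg _) (hH1 x) hs.le
            · simp [Set.indicator_of_notMem hx, hH0 x hx, Real.zero_rpow hs.ne']
      _ = (volume U).toReal := by
          rw [integral_indicator hU, setIntegral_const]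
          simp [Measure.real]
  -- The point at which the exponent is one, so that the original functions reappear.
  set θ : ℝ := 2 - 2 / r with hθ
  have hr2' : 1 ≤ 2 / r := by rw [le_div_iff₀ hr0]; linarith
  have hr2'' : 2 / r ≤ 2 := by rw [div_le_iff₀ hr0]; linarith
  have hθmem : (θ : ℂ) ∈ Complex.HadamardThreeLines.verticalClosedStrip 0 1 := by
    constructor
    · simp [hθ]; linarith
    · simp [hθ]; linarith
  have heθ : e θ = 1 := by
    simp only [e, hθ]
    push_cast
    have : (r : ℂ) ≠ 0 := by exact_mod_cast hr0.ne'
    field_simp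
    ring
  have hΦθ : Φ θ = kernelForm (𝓕⁻ m) F G := by
    simp only [Φ, heθ, twist_one]
  have h3 := Complex.HadamardThreeLines.norm_le_interp_of_mem_verticalClosedStrip₀₁' Φ
    (a := B * A) (b := M * A ^ (1 / 2 : ℝ)) hθmem ?_ ?_ ?_ ?_
  · rw [hΦθ] at h3
    refine h3.trans (le_of_eq ?_)
    simp only [Complex.ofReal_re]
    rw [Real.mul_rpow hB0 hA0, Real.mul_rpow M.coe_nonneg (by positivity), ← Real.rpow_mul hA0]
    have e1 : 1 - θ = 2 / r - 1 := by rw [hθ]; ring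
    -- The law `A^{s+t} = A^s A^t` can fail at `A = 0` when one exponent vanishes, which happens at
    -- the endpoints `r = 1` and `r = 2`.
    by_cases hA00 : A = 0
    · rw [hA00, Real.zero_rpow (by positivity : (1 / r) ≠ 0)]
      by_cases h10 : 1 - θ = 0
      · have : 1 / 2 * θ ≠ 0 := by
          intro h
          linarith
        rw [Real.zero_rpow this]; ring
      · rw [Real.zero_rpow h10]; ring
    · have hAp : 0 < A := lt_of_le_of_ne hA0 (Ne.symm hA00)
      have e2 : A ^ (1 / r) = A ^ (1 - θ) * A ^ (1 / 2 * θ) := by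
        rw [← Real.rpow_add hAp]
        congr 1
        rw [hθ]
        field_simp
        ring
      rw [e2, e1]
      ring
  · refine DifferentiableOn.diffContOnCl ?_
    refine hdiff.mono ?_
    have hcl : closure (Complex.HadamardThreeLines.verticalStrip 0 1) ⊆
        Complex.HadamardThreeLines.verticalClosedStrip 0 1 := by
      refine closure_minimal ?_ (isClosed_Icc.preimage Complex.continuous_re)
      intro z hz
      exact ⟨hz.1.le, hz.2.le⟩
    intro z hz
    have h1 : z.re ≤ 1 := (hcl hz).2
    simp only [Set.mem_ofPred_eq]
    linarith
  · refine ⟨B * ((volume S).toReal * (volume T).toReal), ?_⟩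
    rintro _ ⟨z, hz, rfl⟩
    have hw : 0 < (e z).re := by linarith [hstrip z hz]
    refine (hL1 z hz).trans ?_
    gcongr
    · exact hint_le F S hF hS hSv hF1 hFS _ hw
    · exact hint_le G T hG hT hTv hG1 hGT _ hw
  · intro z hz
    have hz0 : z.re = 0 := hz
    have := hL1 z ⟨by simp [hz0], by simp [hz0]⟩
    rw [hre, hz0] at this
    simpa [hA] using this
  · intro z hz
    have hz1 : z.re = 1 := hz
    have hez : (e z).re = r / 2 := by rw [hre, hz1]; ring
    have hw : 0 < (e z).re := by rw [hez]; linarith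
    have hF2 := htw F S hF hS hSv hF1 hFS (e z) hw
    have hG2 := htw G T hG hT hTv hG1 hGT (e z) hw
    have h4 := enorm_multiplierForm_le hM (memLp_one_iff_integrable.1 (hF2 1))
      (memLp_one_iff_integrable.1 (hG2 1)) (hF2 2) (hG2 2)
    rw [multiplierForm_eq_kernelForm hm (memLp_one_iff_integrable.1 (hF2 1))
      (memLp_one_iff_integrable.1 (hG2 1))] at h4
    have hnorm : ∀ (H : E n → ℂ), MemLp (fun x => twist (e z) (H x)) 2 →
        eLpNorm (fun x => twist (e z) (H x)) 2 =
          ENNReal.ofReal ((∫ x, ‖H x‖ ^ r) ^ (1 / 2 : ℝ)) := by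
      intro H hH
      rw [hH.eLpNorm_eq_integral_rpow_norm (by norm_num) (by norm_num)]
      congr 1
      simp only [norm_twist hw, hez, ENNReal.toReal_ofNat]
      have h5 : ∀ x, (‖H x‖ ^ (r / 2)) ^ (2 : ℝ) = ‖H x‖ ^ r := by
        intro x
        rw [← Real.rpow_mul (norm_nonneg _)]
        congr 1
        ring
      simp only [h5]
      norm_num
    rw [hnorm F (hF2 2), hnorm G (hG2 2), ← ENNReal.ofReal_mul (by positivity),
      ← Real.mul_rpow (by positivity) (by positivity), ← hA, ← ENNReal.ofReal_coe_nnreal,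
      ← ENNReal.ofReal_mul M.coe_nonneg, ← ofReal_norm] at h4
    exact (ENNReal.ofReal_le_ofReal_iff (by positivity)).1 h4

theorem kernelForm_const_mul {n : ℕ} (K F G : E n → ℂ) (a b : ℂ) :
    kernelForm K (fun x => a * F x) (fun x => b * G x) = (a * b) * kernelForm K F G := by
  unfold kernelForm
  rw [← integral_const_mul]
  congr 1
  ext p
  ring

/-- Interpolation between the `L¹` and the `L²` bounds. -/
theorem enorm_kernelForm_le_interp {n : ℕ} {m F G : E n → ℂ} {B : ℝ} {M : ℝ≥0}
    (hm : Integrable m) (hM : ∀ ξ, ‖m ξ‖₊ ≤ M) (hB : ∀ x, ‖𝓕⁻ m x‖ ≤ B)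
    (hF : Measurable F) (hG : Measurable G) {L : ℝ} (hL : 0 < L) (hFL : ∀ x, ‖F x‖ ≤ L)
    (hGL : ∀ x, ‖G x‖ ≤ L)
    {S T : Set (E n)} (hS : MeasurableSet S) (hT : MeasurableSet T) (hSv : volume S ≠ ⊤)
    (hTv : volume T ≠ ⊤) (hFS : ∀ x ∉ S, F x = 0) (hGT : ∀ x ∉ T, G x = 0)
    {r : ℝ} (hr1 : 1 ≤ r) (hr2 : r ≤ 2) :
    ‖kernelForm (𝓕⁻ m) F G‖ₑ ≤ ENNReal.ofReal (B ^ (2 / r - 1) * (M : ℝ) ^ (2 - 2 / r)) *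
      (eLpNorm F (ENNReal.ofReal r) * eLpNorm G (ENNReal.ofReal r)) := by
  have hr0 : 0 < r := by linarith
  have hB0 : 0 ≤ B := (norm_nonneg _).trans (hB 0)
  have hLc : (L : ℂ) ≠ 0 := by exact_mod_cast hL.ne'
  -- Normalising by `L` meets the requirement `‖F‖, ‖G‖ ≤ 1`; bilinearity and homogeneity of the
  -- norms restore the factor.
  set F' : E n → ℂ := fun x => (L : ℂ)⁻¹ * F x with hF'
  set G' : E n → ℂ := fun x => (L : ℂ)⁻¹ * G x with hG'
  have hFF : F = fun x => (L : ℂ) * F' x := by ext x; simp [hF', hLc]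
  have hGG : G = fun x => (L : ℂ) * G' x := by ext x; simp [hG', hLc]
  have hle : ∀ H : E n → ℂ, (∀ x, ‖H x‖ ≤ L) → ∀ x, ‖(L : ℂ)⁻¹ * H x‖ ≤ 1 := by
    intro H hH x
    rw [norm_mul, norm_inv, Complex.norm_real, Real.norm_of_nonneg hL.le, inv_mul_le_one₀ hL]
    exact hH x
  have key := norm_kernelForm_le_interp_of_le_one hm hM hB (hF.const_mul (L : ℂ)⁻¹)
    (hG.const_mul (L : ℂ)⁻¹) (hle F hFL) (hle G hGL) hS hT hSv hTv
    (fun x hx => by simp [hFS x hx]) (fun x hx => by simp [hGT x hx]) hr1 hr2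
  have hmem : ∀ (H : E n → ℂ) (U : Set (E n)), Measurable H → MeasurableSet U →
      volume U ≠ ⊤ → (∀ x, ‖H x‖ ≤ 1) → (∀ x ∉ U, H x = 0) →
      eLpNorm H (ENNReal.ofReal r) = ENNReal.ofReal ((∫ x, ‖H x‖ ^ r) ^ (1 / r)) := by
    intro H U hH hU hUv hH1 hH0
    have h1 : MemLp H (ENNReal.ofReal r) := by
      have h1 : H = U.indicator H := by
        ext x
        by_cases hx : x ∈ U
        · rw [Set.indicator_of_mem hx]
        · rw [Set.indicator_of_notMem hx, hH0 x hx]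
      rw [h1, memLp_indicator_iff_restrict hU]
      have : IsFiniteMeasure (volume.restrict U) := ⟨by simpa using hUv.lt_top⟩
      exact MemLp.of_bound hH.aestronglyMeasurable 1 (Eventually.of_forall hH1)
    rw [h1.eLpNorm_eq_integral_rpow_norm (by simpa using hr0) ENNReal.ofReal_ne_top,
      ENNReal.toReal_ofReal hr0.le, one_div]
  have hFe := hmem F' S (hF.const_mul (L : ℂ)⁻¹) hS hSv (hle F hFL)
    (fun x hx => by simp [hF', hFS x hx])
  have hGe := hmem G' T (hG.const_mul (L : ℂ)⁻¹) hT hTv (hle G hGL)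
    (fun x hx => by simp [hG', hGT x hx])
  have hsc : ∀ H : E n → ℂ, eLpNorm (fun x => (L : ℂ) * H x) (ENNReal.ofReal r) =
      ENNReal.ofReal L * eLpNorm H (ENNReal.ofReal r) := by
    intro H
    have := eLpNorm_const_smul (L : ℂ) H (ENNReal.ofReal r) (volume : Measure (E n))
    rw [← ofReal_norm, Complex.norm_real, Real.norm_of_nonneg hL.le] at this
    exact this
  rw [hFF, hGG, kernelForm_const_mul, hsc, hsc, hFe, hGe, enorm_mul, ← ofReal_norm,
    ← ofReal_norm (kernelForm _ _ _), norm_mul, Complex.norm_real, Real.norm_of_nonneg hL.le]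
  have e1 : ENNReal.ofReal (B ^ (2 / r - 1) * (M : ℝ) ^ (2 - 2 / r)) *
      (ENNReal.ofReal L * ENNReal.ofReal ((∫ x, ‖F' x‖ ^ r) ^ (1 / r)) *
        (ENNReal.ofReal L * ENNReal.ofReal ((∫ x, ‖G' x‖ ^ r) ^ (1 / r)))) =
      ENNReal.ofReal (L * L) * ENNReal.ofReal (B ^ (2 / r - 1) * (M : ℝ) ^ (2 - 2 / r) *
        ((∫ x, ‖F' x‖ ^ r) * ∫ x, ‖G' x‖ ^ r) ^ (1 / r)) := by
    rw [Real.mul_rpow (by positivity) (by positivity), ENNReal.ofReal_mul hL.le,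
      ENNReal.ofReal_mul (p := B ^ (2 / r - 1) * (M : ℝ) ^ (2 - 2 / r)) (by positivity),
      ENNReal.ofReal_mul (p := (∫ x, ‖F' x‖ ^ r) ^ (1 / r)) (by positivity)]
    ring
  rw [e1]
  gcongr

/-! ### Cubes and sparse forms over disjoint families -/

theorem cubeSet_eq_preimage {n : ℕ} (c : E n) (l : ℝ) :
    cubeSet c l = WithLp.ofLp ⁻¹' (Set.univ.pi fun i => Set.Ico (c i - l / 2) (c i + l / 2)) := by
  ext x
  simp [cubeSet, Set.mem_pi]

theorem measurableSet_cubeSet {n : ℕ} (c : E n) (l : ℝ) : MeasurableSet (cubeSet c l) := by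
  rw [cubeSet_eq_preimage]
  exact (PiLp.volume_preserving_ofLp (Fin n)).measurable
    (MeasurableSet.univ_pi fun i => measurableSet_Ico)

theorem volume_cubeSet {n : ℕ} (c : E n) {l : ℝ} (hl : 0 ≤ l) :
    volume (cubeSet c l) = ENNReal.ofReal (l ^ n) := by
  rw [cubeSet_eq_preimage, (PiLp.volume_preserving_ofLp (Fin n)).measure_preimage
    (MeasurableSet.univ_pi fun i => measurableSet_Ico).nullMeasurableSet, Real.volume_pi_Ico]
  have : ∀ i, c i + l / 2 - (c i - l / 2) = l := fun i => by ring
  simp [this, ENNReal.ofReal_pow hl]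

theorem Cube.measurableSet {n : ℕ} (Q : Cube n) : MeasurableSet Q.toSet :=
  measurableSet_cubeSet _ _

theorem Cube.volume_eq {n : ℕ} (Q : Cube n) : volume Q.toSet = ENNReal.ofReal (Q.side ^ n) :=
  volume_cubeSet _ Q.side_pos.le

theorem Cube.volume_ne_zero {n : ℕ} (Q : Cube n) : volume Q.toSet ≠ 0 := by
  rw [Q.volume_eq]
  simpa using pow_pos Q.side_pos n

theorem Cube.volume_ne_top {n : ℕ} (Q : Cube n) : volume Q.toSet ≠ ⊤ := by
  rw [Q.volume_eq]
  exact ENNReal.ofReal_ne_top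

/-- The supremum of the sparse forms over all families of pairwise disjoint cubes. -/
def disjointSup {n : ℕ} (α r : ℝ) (F g : E n → ℂ) : ℝ≥0∞ :=
  ⨆ S : {S : Set (Cube n) // S.PairwiseDisjoint Cube.toSet}, sparseForm α S.1 r r F g

theorem sparseForm_le_disjointSup {n : ℕ} (α r : ℝ) (F g : E n → ℂ) {S : Set (Cube n)}
    (hS : S.PairwiseDisjoint Cube.toSet) : sparseForm α S r r F g ≤ disjointSup α r F g :=
  le_iSup (fun S : {S : Set (Cube n) // S.PairwiseDisjoint Cube.toSet} =>
    sparseForm α S.1 r r F g) ⟨S, hS⟩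

theorem isSparse_of_pairwiseDisjoint {n : ℕ} {S : Set (Cube n)}
    (hS : S.PairwiseDisjoint Cube.toSet) : IsSparse (1 / 2) S := by
  refine ⟨Cube.toSet, fun Q _ => ⟨Q.measurableSet, subset_rfl, ?_⟩, hS⟩
  have h1 : ENNReal.ofReal (1 / 2) < 1 := by
    rw [ENNReal.ofReal_lt_one]; norm_num
  calc ENNReal.ofReal (1 / 2) * volume Q.toSet < 1 * volume Q.toSet :=
        (ENNReal.mul_lt_mul_iff_left Q.volume_ne_zero Q.volume_ne_top).2 h1
    _ = _ := one_mul _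

/-- Hölder on `Q`, from exponent `r` to `2α`. All powers of `|Q|` cancel, so the right side can be
added over disjoint cubes of arbitrary sizes. -/
theorem volume_mul_avg_rpow_le {n : ℕ} {α r : ℝ} (hr : 1 ≤ r) (hα : r ≤ 2 * α) (Q : Cube n)
    {F : E n → ℂ} (hF : AEStronglyMeasurable F volume) :
    volume Q.toSet * avg r Q F ^ (2 * α) ≤ ∫⁻ x in Q.toSet, ‖F x‖ₑ ^ (2 * α) := by
  have hα0 : 0 < 2 * α := by linarith
  set v := volume Q.toSet with hv
  have hv0 : v ≠ 0 := Q.volume_ne_zero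
  have hvt : v ≠ ⊤ := Q.volume_ne_top
  have h1 := eLpNorm_le_eLpNorm_mul_rpow_measure_univ (p := ENNReal.ofReal r)
    (q := ENNReal.ofReal (2 * α)) (ENNReal.ofReal_le_ofReal hα) (hF.restrict (s := Q.toSet))
  rw [Measure.restrict_apply_univ, ENNReal.toReal_ofReal (by linarith),
    ENNReal.toReal_ofReal hα0.le, ← hv] at h1
  have h2 : avg r Q F ≤ eLpNorm F (ENNReal.ofReal (2 * α)) (volume.restrict Q.toSet) *
      v ^ (-(1 / (2 * α))) := by
    unfold avg
    calc _ ≤ v ^ (-(1 / r)) * (eLpNorm F (ENNReal.ofReal (2 * α)) (volume.restrict Q.toSet) *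
          v ^ (1 / r - 1 / (2 * α))) := by gcongr
      _ = eLpNorm F (ENNReal.ofReal (2 * α)) (volume.restrict Q.toSet) *
          (v ^ (-(1 / r)) * v ^ (1 / r - 1 / (2 * α))) := by ring
      _ = _ := by
          rw [← ENNReal.rpow_add _ _ hv0 hvt]
          congr 2
          ring
  calc v * avg r Q F ^ (2 * α) ≤ v * (eLpNorm F (ENNReal.ofReal (2 * α))
        (volume.restrict Q.toSet) * v ^ (-(1 / (2 * α)))) ^ (2 * α) := by gcongr
    _ = eLpNorm F (ENNReal.ofReal (2 * α)) (volume.restrict Q.toSet) ^ (2 * α) *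
        (v * v ^ (-1 : ℝ)) := by
        rw [ENNReal.mul_rpow_of_nonneg _ _ hα0.le, ← ENNReal.rpow_mul]
        have : -(1 / (2 * α)) * (2 * α) = -1 := by
          rw [neg_mul, one_div_mul_cancel hα0.ne']
        rw [this]
        ring
    _ = eLpNorm F (ENNReal.ofReal (2 * α)) (volume.restrict Q.toSet) ^ (2 * α) := by
        rw [ENNReal.rpow_neg_one, ENNReal.mul_inv_cancel hv0 hvt, mul_one]
    _ = ∫⁻ x in Q.toSet, ‖F x‖ₑ ^ (2 * α) := by
        rw [eLpNorm_eq_lintegral_rpow_enorm_toReal (by simpa using hα0) ENNReal.ofReal_ne_top,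
          ENNReal.toReal_ofReal hα0.le, ← ENNReal.rpow_mul, one_div_mul_cancel hα0.ne',
          ENNReal.rpow_one]

theorem ENNReal_mul_le_sq_add_sq (x y : ℝ≥0∞) : x * y ≤ x ^ 2 + y ^ 2 := by
  rcases le_total x y with h | h
  · calc x * y ≤ y * y := by gcongr
      _ = y ^ 2 := (sq y).symm
      _ ≤ _ := le_add_self
  · calc x * y ≤ x * x := by gcongr
      _ = x ^ 2 := (sq x).symm
      _ ≤ _ := le_self_add

theorem sum_volume_mul_avg_rpow_le {n : ℕ} {α r : ℝ} (hr : 1 ≤ r) (hα : r ≤ 2 * α)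
    {S : Set (Cube n)} (hS : S.PairwiseDisjoint Cube.toSet) {F : E n → ℂ}
    (hF : AEStronglyMeasurable F volume) :
    ∑' Q : S, volume (Q : Cube n).toSet * avg r (Q : Cube n) F ^ (2 * α) ≤
      ∫⁻ x, ‖F x‖ₑ ^ (2 * α) := by
  refine ENNReal.summable.tsum_le_of_sum_le fun s => ?_
  calc _ ≤ ∑ Q ∈ s, ∫⁻ x in (Q : Cube n).toSet, ‖F x‖ₑ ^ (2 * α) :=
        Finset.sum_le_sum fun Q _ => volume_mul_avg_rpow_le hr hα Q hF
    _ = ∫⁻ x in ⋃ Q ∈ s, (Q : Cube n).toSet, ‖F x‖ₑ ^ (2 * α) := by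
        refine (lintegral_biUnion_finset ?_ (fun Q _ => Cube.measurableSet _) _).symm
        intro Q _ Q' _ hne
        exact hS Q.2 Q'.2 (fun h => hne (Subtype.ext h))
    _ ≤ _ := setLIntegral_le_lintegral _ _

/-- The bound `xy ≤ x² + y²` separates the two averages, and each resulting sum over disjoint cubes
is at most a global `2α`-integral. Finiteness is what permits the choice of a near maximiser. -/
theorem disjointSup_lt_top {n : ℕ} {α r : ℝ} (hr : 1 ≤ r) (hα : r ≤ 2 * α) {F g : E n → ℂ}
    (hF : MemLp F (ENNReal.ofReal (2 * α))) (hg : MemLp g (ENNReal.ofReal (2 * α))) :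
    disjointSup α r F g < ⊤ := by
  have hα0 : 0 < α := by linarith
  have hfin : ∀ H : E n → ℂ, MemLp H (ENNReal.ofReal (2 * α)) →
      ∫⁻ x, ‖H x‖ₑ ^ (2 * α) ≠ ⊤ := by
    intro H hH
    have := (lintegral_rpow_enorm_lt_top_of_eLpNorm_lt_top (by simpa using hα0)
      ENNReal.ofReal_ne_top hH.2).ne
    rwa [ENNReal.toReal_ofReal (by linarith)] at this
  have hlt : ((∫⁻ x, ‖F x‖ₑ ^ (2 * α)) + ∫⁻ x, ‖g x‖ₑ ^ (2 * α)) ^ (1 / α) < ⊤ :=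
    ENNReal.rpow_lt_top_of_nonneg (by positivity) (ENNReal.add_ne_top.2 ⟨hfin F hF, hfin g hg⟩)
  refine lt_of_le_of_lt (iSup_le ?_) hlt
  rintro ⟨S, hS⟩
  unfold sparseForm
  gcongr
  calc _ ≤ ∑' Q : S, (volume (Q : Cube n).toSet * avg r (Q : Cube n) F ^ (2 * α) +
        volume (Q : Cube n).toSet * avg r (Q : Cube n) g ^ (2 * α)) := by
        refine ENNReal.tsum_le_tsum fun Q => ?_
        rw [mul_assoc, ← mul_add]
        gcongr
        refine (ENNReal_mul_le_sq_add_sq _ _).trans (le_of_eq ?_)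
        have : ∀ x : ℝ≥0∞, (x ^ α) ^ 2 = x ^ (2 * α) := by
          intro x
          rw [← ENNReal.rpow_natCast, ← ENNReal.rpow_mul]
          congr 1
          push_cast
          ring
        rw [this, this]
    _ = _ := ENNReal.tsum_add
    _ ≤ _ := add_le_add (sum_volume_mul_avg_rpow_le hr hα hS hF.1)
        (sum_volume_mul_avg_rpow_le hr hα hS hg.1)

/-- There is a family of disjoint cubes whose sparse form dominates, up to a factor `2`, those of
all families of disjoint cubes. -/
theorem exists_disjoint_family {n : ℕ} {α r : ℝ} (hr : 1 ≤ r) (hα : r ≤ 2 * α) {F g : E n → ℂ}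
    (hF : MemLp F (ENNReal.ofReal (2 * α))) (hg : MemLp g (ENNReal.ofReal (2 * α))) :
    ∃ S : Set (Cube n), IsSparse (1 / 2) S ∧ disjointSup α r F g ≤ 2 * sparseForm α S r r F g := by
  by_cases h0 : disjointSup α r F g = 0
  · refine ⟨∅, isSparse_of_pairwiseDisjoint (Set.pairwiseDisjoint_empty), ?_⟩
    rw [h0]; exact zero_le
  · have hlt : disjointSup α r F g / 2 < disjointSup α r F g :=
      ENNReal.half_lt_self h0 (disjointSup_lt_top hr hα hF hg).ne
    obtain ⟨⟨S, hS⟩, hlt⟩ := lt_iSup_iff.1 hlt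
    refine ⟨S, isSparse_of_pairwiseDisjoint hS, ?_⟩
    have h1 := hlt.le
    rw [ENNReal.div_le_iff (by norm_num) (by norm_num)] at h1
    rw [mul_comm]
    exact h1

/-! ### Grids of cubes -/

theorem tsum_le_rpow_tsum {ι : Type*} {α : ℝ} (hα : 0 < α) (hα1 : α ≤ 1) (x : ι → ℝ≥0∞) :
    ∑' i, x i ≤ (∑' i, x i ^ α) ^ (1 / α) := by
  refine ENNReal.summable.tsum_le_of_sum_le fun s => ?_
  have hs : (∑ i ∈ s, x i) ^ α ≤ ∑ i ∈ s, x i ^ α := by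
    classical
    induction s using Finset.induction_on with
    | empty => simp [ENNReal.zero_rpow_of_pos hα]
    | insert a s ha ih =>
      rw [Finset.sum_insert ha, Finset.sum_insert ha]
      exact (ENNReal.rpow_add_le_add_rpow _ _ hα.le hα1).trans (by gcongr)
  calc ∑ i ∈ s, x i = ((∑ i ∈ s, x i) ^ α) ^ (1 / α) := by
        rw [← ENNReal.rpow_mul, mul_one_div_cancel hα.ne', ENNReal.rpow_one]
    _ ≤ (∑ i ∈ s, x i ^ α) ^ (1 / α) := by gcongr
    _ ≤ _ := by
        gcongr
        exact ENNReal.sum_le_tsum s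

/-- The cube with lower corner `ℓ q` and side length `ℓ M`. -/
def gridCube {n : ℕ} {ℓ : ℝ} (hℓ : 0 < ℓ) (M : ℕ) (hM : 0 < M) (q : Fin n → ℤ) : Cube n where
  center := WithLp.toLp 2 fun i => ℓ * q i + ℓ * M / 2
  side := ℓ * M
  side_pos := by positivity

theorem mem_gridCube {n : ℕ} {ℓ : ℝ} (hℓ : 0 < ℓ) {M : ℕ} (hM : 0 < M) (q : Fin n → ℤ)
    (x : E n) : x ∈ (gridCube hℓ M hM q).toSet ↔
      ∀ i, ℓ * q i ≤ x i ∧ x i < ℓ * (q i + M) := by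
  simp only [Cube.toSet, gridCube, cubeSet, Set.mem_ofPred_eq]
  refine forall_congr' fun i => and_congr ?_ ?_
  · rw [add_sub_cancel_right]
  · have : ℓ * (q i : ℝ) + ℓ * M / 2 + ℓ * M / 2 = ℓ * (q i + M) := by ring
    rw [this]

theorem gridCube_disjoint {n : ℕ} {ℓ : ℝ} (hℓ : 0 < ℓ) {M : ℕ} (hM : 0 < M)
    (c p p' : Fin n → ℤ) (hne : p ≠ p') :
    Disjoint (gridCube hℓ M hM fun i => c i + M * p i).toSet
      (gridCube hℓ M hM fun i => c i + M * p' i).toSet := by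
  rw [Set.disjoint_left]
  intro x hx hx'
  apply hne
  ext i
  rw [mem_gridCube] at hx hx'
  obtain ⟨h1, h2⟩ := hx i
  obtain ⟨h3, h4⟩ := hx' i
  have h5 := lt_of_mul_lt_mul_left (h1.trans_lt h4) hℓ.le
  have h6 := lt_of_mul_lt_mul_left (h3.trans_lt h2) hℓ.le
  have h7 : (c i + M * p i : ℤ) < c i + M * p' i + M := by
    rw [← @Int.cast_lt ℝ]; push_cast at h5 ⊢; exact h5
  have h8 : (c i + M * p' i : ℤ) < c i + M * p i + M := by
    rw [← @Int.cast_lt ℝ]; push_cast at h6 ⊢; exact h6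
  have hM' : (0 : ℤ) < M := by exact_mod_cast hM
  have h9 : (M : ℤ) * p i < M * (p' i + 1) := by linarith
  have h10 : (M : ℤ) * p' i < M * (p i + 1) := by linarith
  have := lt_of_mul_lt_mul_left h9 hM'.le
  have := lt_of_mul_lt_mul_left h10 hM'.le
  omega

theorem eLpNorm_restrict_cube {n : ℕ} (r : ℝ) (Q : Cube n) (F : E n → ℂ) :
    eLpNorm F (ENNReal.ofReal r) (volume.restrict Q.toSet) =
      volume Q.toSet ^ (1 / r) * avg r Q F := by
  unfold avg
  rw [← mul_assoc, ← ENNReal.rpow_add _ _ Q.volume_ne_zero Q.volume_ne_top]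
  simp

/-- Since `α ≤ 1`, the `ℓ¹` sum is at most the `ℓ^α` sum. Passing from norms to averages contributes
`v^{2/r}`, and the weight `|Q|` inside the sparse form absorbs `v^{1/α}`. -/
theorem tsum_eLpNorm_mul_le_of_disjoint {n : ℕ} {α r : ℝ} (hα : 0 < α) (hα1 : α ≤ 1)
    {ι : Type*} (Q : ι → Cube n) (hQ : Pairwise fun i j => Disjoint (Q i).toSet (Q j).toSet)
    {l : ℝ} (hl : 0 < l) (hside : ∀ i, (Q i).side = l) (F g : E n → ℂ) :
    ∑' i, eLpNorm F (ENNReal.ofReal r) (volume.restrict (Q i).toSet) *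
      eLpNorm g (ENNReal.ofReal r) (volume.restrict (Q i).toSet) ≤
      ENNReal.ofReal (l ^ n) ^ (2 / r - 1 / α) * disjointSup α r F g := by
  set v := ENNReal.ofReal (l ^ n) with hv
  have hv0 : v ≠ 0 := by simpa [hv] using pow_pos hl n
  have hvt : v ≠ ⊤ := ENNReal.ofReal_ne_top
  have hvol : ∀ i, volume (Q i).toSet = v := fun i => by rw [Cube.volume_eq, hside]
  -- Disjointness of nonempty cubes forces the indexing to be injective, so the indexed sum is the
  -- sum over the family.
  have hinj : Function.Injective Q := by
    intro i j hij
    by_contra hne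
    have h1 : Disjoint (Q i).toSet (Q j).toSet := hQ hne
    rw [hij, disjoint_self] at h1
    have h2 := (Q j).volume_ne_zero
    simp only [Set.bot_eq_empty] at h1
    rw [h1] at h2
    simp at h2
  have hdisj : (Set.range Q).PairwiseDisjoint Cube.toSet := by
    rintro _ ⟨i, rfl⟩ _ ⟨j, rfl⟩ hne
    exact hQ (fun h => hne (h ▸ rfl))
  have hform : sparseForm α (Set.range Q) r r F g =
      (∑' i, v * avg r (Q i) F ^ α * avg r (Q i) g ^ α) ^ (1 / α) := by
    unfold sparseForm
    congr 1
    rw [tsum_range (fun Q : Cube n => volume Q.toSet * avg r Q F ^ α * avg r Q g ^ α) hinj]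
    simp only [hvol]
  calc _ ≤ (∑' i, (eLpNorm F (ENNReal.ofReal r) (volume.restrict (Q i).toSet) *
      eLpNorm g (ENNReal.ofReal r) (volume.restrict (Q i).toSet)) ^ α) ^ (1 / α) :=
        tsum_le_rpow_tsum hα hα1 _
    _ = (∑' i, v ^ (2 * α / r - 1) * (v * avg r (Q i) F ^ α * avg r (Q i) g ^ α)) ^ (1 / α) := by
        congr 2
        ext i
        rw [eLpNorm_restrict_cube, eLpNorm_restrict_cube, hvol]
        have e1 : v ^ (1 / r) * avg r (Q i) F * (v ^ (1 / r) * avg r (Q i) g) =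
            v ^ (2 / r) * (avg r (Q i) F * avg r (Q i) g) := by
          have : v ^ (2 / r) = v ^ (1 / r) * v ^ (1 / r) := by
            rw [← ENNReal.rpow_add _ _ hv0 hvt]
            congr 1
            ring
          rw [this]
          ring
        rw [e1, ENNReal.mul_rpow_of_nonneg _ _ hα.le, ENNReal.mul_rpow_of_nonneg _ _ hα.le,
          ← ENNReal.rpow_mul]
        have e2 : v ^ (2 / r * α) = v ^ (2 * α / r - 1) * v := by
          conv_rhs => rw [← ENNReal.rpow_one v, ← ENNReal.rpow_mul, one_mul,
            ← ENNReal.rpow_add _ _ hv0 hvt]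
          congr 1
          ring
        rw [e2]
        ring
    _ = v ^ (2 / r - 1 / α) * sparseForm α (Set.range Q) r r F g := by
        rw [ENNReal.tsum_mul_left, ENNReal.mul_rpow_of_nonneg _ _ (by positivity), hform,
          ← ENNReal.rpow_mul]
        congr 2
        field_simp
    _ ≤ _ := by
        gcongr
        exact sparseForm_le_disjointSup _ _ _ _ hdisj

/-- Cubes of side `ℓM` attached to all grid points overlap. Sorting the points by their residues
modulo `M` gives `M^n` families of disjoint cubes. -/
theorem tsum_eLpNorm_mul_le {n : ℕ} {α r : ℝ} (hα : 0 < α) (hα1 : α ≤ 1) {ℓ : ℝ} (hℓ : 0 < ℓ)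
    {M : ℕ} (hM : 0 < M) (F g : E n → ℂ) :
    ∑' q : Fin n → ℤ, eLpNorm F (ENNReal.ofReal r) (volume.restrict (gridCube hℓ M hM q).toSet) *
      eLpNorm g (ENNReal.ofReal r) (volume.restrict (gridCube hℓ M hM q).toSet) ≤
      (M : ℝ≥0∞) ^ n * (ENNReal.ofReal ((ℓ * M) ^ n) ^ (2 / r - 1 / α) * disjointSup α r F g) := by
  have hM' : (0 : ℤ) < M := by exact_mod_cast hM
  let φ : (Fin n → Fin M) × (Fin n → ℤ) → (Fin n → ℤ) := fun cp i => (cp.1 i : ℤ) + M * cp.2 i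
  have hφ : Function.Surjective φ := by
    intro q
    refine ⟨(fun i => ⟨(q i % M).toNat, by
      have := Int.emod_lt_of_pos (q i) hM'
      have := Int.emod_nonneg (q i) hM'.ne'
      omega⟩, fun i => q i / M), ?_⟩
    ext i
    simp only [φ]
    rw [Int.toNat_of_nonneg (Int.emod_nonneg (q i) hM'.ne')]
    exact Int.emod_add_mul_ediv (q i) M
  refine (ENNReal.tsum_le_tsum_comp_of_surjective hφ _).trans ?_
  rw [ENNReal.tsum_prod', tsum_fintype]
  calc _ ≤ ∑ _c : Fin n → Fin M,
        (ENNReal.ofReal ((ℓ * M) ^ n) ^ (2 / r - 1 / α) * disjointSup α r F g) := by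
        refine Finset.sum_le_sum fun c _ => ?_
        exact tsum_eLpNorm_mul_le_of_disjoint hα hα1
          (fun p : Fin n → ℤ => gridCube hℓ M hM fun i => (c i : ℤ) + M * p i)
          (fun p p' hne => gridCube_disjoint hℓ hM (fun i => (c i : ℤ)) p p' hne)
          (l := ℓ * M) (by positivity) (fun p => rfl) F g
    _ = _ := by
        rw [Finset.sum_const, nsmul_eq_mul]
        simp

/-- The supremum norm of an integer vector. -/
def offsetSize {n : ℕ} (m : Fin n → ℤ) : ℕ := Finset.univ.sup fun i => (m i).natAbs

theorem natAbs_le_offsetSize {n : ℕ} (m : Fin n → ℤ) (i : Fin n) :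
    (m i).natAbs ≤ offsetSize m :=
  Finset.le_sup (f := fun i => (m i).natAbs) (Finset.mem_univ i)

theorem tsum_int_inv_sq_ne_top :
    ∑' k : ℤ, ENNReal.ofReal (((1 + |(k : ℝ)|) ^ 2)⁻¹) ≠ ⊤ := by
  have hs : Summable fun k : ℤ => ((1 + |(k : ℝ)|) ^ 2)⁻¹ := by
    refine Summable.of_norm_bounded_eventually
      (Real.summable_one_div_int_pow.2 (by norm_num : 1 < 2)) ?_
    have : ∀ᶠ k : ℤ in cofinite, k ≠ 0 := (Set.finite_singleton (0 : ℤ)).compl_mem_cofinite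
    filter_upwards [this] with k hk
    have hk' : (k : ℝ) ≠ 0 := by exact_mod_cast hk
    have hpos : 0 < |(k : ℝ)| := abs_pos.2 hk'
    rw [Real.norm_of_nonneg (by positivity), one_div, ← sq_abs (k : ℝ)]
    gcongr
    linarith
  exact hs.tsum_ofReal_ne_top

theorem tsum_pi_prod_eq_pow (w : ℤ → ℝ≥0∞) (n : ℕ) :
    ∑' m : Fin n → ℤ, ∏ i, w (m i) = (∑' k, w k) ^ n := by
  induction n with
  | zero => simp [tsum_fintype]
  | succ n ih =>
    rw [← (Fin.consEquiv fun _ : Fin (n + 1) => ℤ).tsum_eq, ENNReal.tsum_prod']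
    simp only [Fin.consEquiv_apply, Fin.prod_univ_succ, Fin.cons_zero, Fin.cons_succ]
    simp_rw [ENNReal.tsum_mul_left, ih, ENNReal.tsum_mul_right]
    rw [pow_succ, mul_comm]

theorem tsum_offsetSize_ne_top (n : ℕ) :
    ∑' m : Fin n → ℤ, ENNReal.ofReal (((2 * (offsetSize m : ℝ) + 1) ^ (2 * n))⁻¹) ≠ ⊤ := by
  have h1 : ∀ m : Fin n → ℤ, ENNReal.ofReal (((2 * (offsetSize m : ℝ) + 1) ^ (2 * n))⁻¹) ≤
      ∏ i, ENNReal.ofReal (((1 + |(m i : ℝ)|) ^ 2)⁻¹) := by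
    intro m
    rw [← ENNReal.ofReal_prod_of_nonneg (fun i _ => by positivity), Finset.prod_inv_distrib]
    refine ENNReal.ofReal_le_ofReal (inv_anti₀ (Finset.prod_pos fun i _ => by positivity) ?_)
    calc ∏ i, (1 + |(m i : ℝ)|) ^ 2 ≤ ∏ _i : Fin n, (2 * (offsetSize m : ℝ) + 1) ^ 2 := by
          refine Finset.prod_le_prod (fun i _ => by positivity) fun i _ => ?_
          refine pow_le_pow_left₀ (by positivity) ?_ 2
          have h2 : |(m i : ℝ)| ≤ offsetSize m := by
            rw [← Int.cast_abs, ← Nat.cast_natAbs]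
            exact_mod_cast natAbs_le_offsetSize m i
          have h3 : (0 : ℝ) ≤ offsetSize m := Nat.cast_nonneg _
          linarith
      _ = _ := by
          rw [Finset.prod_const, Finset.card_univ, Fintype.card_fin, pow_mul]
  refine ne_top_of_le_ne_top ?_ (ENNReal.tsum_le_tsum h1)
  rw [tsum_pi_prod_eq_pow (fun k => ENNReal.ofReal (((1 + |(k : ℝ)|) ^ 2)⁻¹)) n]
  exact ENNReal.pow_ne_top tsum_int_inv_sq_ne_top

theorem mem_gridCube_one {n : ℕ} {ℓ : ℝ} (hℓ : 0 < ℓ) (q : Fin n → ℤ) (x : E n) :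
    x ∈ (gridCube hℓ 1 one_pos q).toSet ↔ q = fun i => ⌊x i / ℓ⌋ := by
  rw [mem_gridCube, funext_iff]
  refine forall_congr' fun i => ?_
  rw [eq_comm, Int.floor_eq_iff, le_div_iff₀ hℓ, div_lt_iff₀ hℓ, mul_comm ℓ, mul_comm ℓ]
  simp

/-- Decomposition of the form of a convolution operator into pairs of grid cubes. -/
theorem enorm_kernelForm_le_tsum {n : ℕ} {K F G : E n → ℂ} (hK : Continuous K) {B : ℝ}
    (hB : ∀ x, ‖K x‖ ≤ B) (hF : Integrable F) (hG : Integrable G) {ℓ : ℝ} (hℓ : 0 < ℓ) :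
    ‖kernelForm K F G‖ₑ ≤ ∑' m : Fin n → ℤ, ∑' q : Fin n → ℤ,
      ‖kernelForm K ((gridCube hℓ 1 one_pos (q + m)).toSet.indicator F)
        ((gridCube hℓ 1 one_pos q).toSet.indicator G)‖ₑ := by
  set Q : (Fin n → ℤ) → Set (E n) := fun q => (gridCube hℓ 1 one_pos q).toSet with hQ
  set H : E n × E n → ℂ := fun p => K (p.1 - p.2) * (F p.2 * G p.1) with hH
  have hHi : Integrable H := by
    have h2 : Integrable (fun p : E n × E n => F p.2 * G p.1) :=
      (hG.mul_prod hF).congr (Eventually.of_forall fun p => mul_comm _ _)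
    exact h2.bdd_mul (c := B) (hK.comp (continuous_fst.sub continuous_snd)).aestronglyMeasurable
      (Eventually.of_forall fun p => hB _)
  have hpart : ∀ qq : (Fin n → ℤ) × (Fin n → ℤ), ∫ p in Q qq.1 ×ˢ Q qq.2, H p =
      kernelForm K ((Q qq.2).indicator F) ((Q qq.1).indicator G) := by
    intro qq
    rw [← integral_indicator ((Cube.measurableSet _).prod (Cube.measurableSet _))]
    unfold kernelForm
    congr 1
    ext p
    by_cases h1 : p.1 ∈ Q qq.1
    · by_cases h2 : p.2 ∈ Q qq.2
      · rw [Set.indicator_of_mem (Set.mk_mem_prod h1 h2), Set.indicator_of_mem h1,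
          Set.indicator_of_mem h2]
      · rw [Set.indicator_of_notMem (fun h => h2 h.2), Set.indicator_of_notMem h2]
        simp
    · rw [Set.indicator_of_notMem (fun h => h1 h.1), Set.indicator_of_notMem h1]
      simp
  have hunion : ⋃ qq : (Fin n → ℤ) × (Fin n → ℤ), Q qq.1 ×ˢ Q qq.2 = Set.univ := by
    refine Set.eq_univ_of_forall fun p => Set.mem_iUnion.2
      ⟨(fun i => ⌊p.1 i / ℓ⌋, fun i => ⌊p.2 i / ℓ⌋), ?_⟩
    exact ⟨(mem_gridCube_one hℓ _ _).2 rfl, (mem_gridCube_one hℓ _ _).2 rfl⟩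
  have hsum := hasSum_integral_iUnion (μ := volume) (f := H)
    (s := fun qq : (Fin n → ℤ) × (Fin n → ℤ) => Q qq.1 ×ˢ Q qq.2)
    (fun qq => (Cube.measurableSet _).prod (Cube.measurableSet _)) (by
      intro a b hab
      rw [Function.onFun, Set.disjoint_left]
      rintro p ⟨h1, h2⟩ ⟨h3, h4⟩
      apply hab
      have e1 := (mem_gridCube_one hℓ _ _).1 h1
      have e2 := (mem_gridCube_one hℓ _ _).1 h2
      have e3 := (mem_gridCube_one hℓ _ _).1 h3
      have e4 := (mem_gridCube_one hℓ _ _).1 h4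
      exact Prod.ext (e1.trans e3.symm) (e2.trans e4.symm)) hHi.integrableOn
  rw [hunion, setIntegral_univ] at hsum
  have h1 : kernelForm K F G = ∑' qq : (Fin n → ℤ) × (Fin n → ℤ),
      kernelForm K ((Q qq.2).indicator F) ((Q qq.1).indicator G) := by
    rw [← tsum_congr hpart, hsum.tsum_eq]
    rfl
  rw [h1]
  refine enorm_tsum_le_tsum_enorm.trans ?_
  -- Pairs of cubes are reindexed by their offset and the index of the cube carrying `G`.
  let e : (Fin n → ℤ) × (Fin n → ℤ) ≃ (Fin n → ℤ) × (Fin n → ℤ) :=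
    { toFun := fun mq => (mq.2, mq.2 + mq.1)
      invFun := fun qq => (qq.2 - qq.1, qq.1)
      left_inv := fun mq => by simp
      right_inv := fun qq => by simp }
  rw [← e.tsum_eq, ENNReal.tsum_prod']
  exact le_rfl

/-- In a coordinate where the offset is largest, the cubes are at least `(s - 1)ℓ` apart, and `s - 1
≥ s/2` for `s ≥ 2`. -/
theorem half_mul_le_norm_sub {n : ℕ} {ℓ : ℝ} (hℓ : 0 < ℓ) {m q : Fin n → ℤ}
    (hm : 2 ≤ offsetSize m) {x y : E n} (hx : x ∈ (gridCube hℓ 1 one_pos q).toSet)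
    (hy : y ∈ (gridCube hℓ 1 one_pos (q + m)).toSet) : offsetSize m * ℓ / 2 ≤ ‖x - y‖ := by
  have hne : (Finset.univ : Finset (Fin n)).Nonempty := by
    by_contra h
    rw [Finset.not_nonempty_iff_eq_empty] at h
    simp [offsetSize, h] at hm
  obtain ⟨i, -, hi⟩ := Finset.exists_mem_eq_sup Finset.univ hne fun i => (m i).natAbs
  have hs : (offsetSize m : ℝ) = |(m i : ℝ)| := by
    rw [← Int.cast_abs, ← Nat.cast_natAbs]
    exact_mod_cast hi
  have hs2 : (2 : ℝ) ≤ offsetSize m := by exact_mod_cast hm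
  rw [mem_gridCube] at hx hy
  obtain ⟨h1, h2⟩ := hx i
  obtain ⟨h3, h4⟩ := hy i
  simp only [Pi.add_apply, Int.cast_add, Nat.cast_one] at h1 h2 h3 h4
  have h5 : ‖(x - y) i‖ ≤ ‖x - y‖ := PiLp.norm_apply_le _ i
  refine le_trans ?_ h5
  rw [PiLp.sub_apply, Real.norm_eq_abs]
  rw [hs] at hs2 ⊢
  rcases abs_cases (m i : ℝ) with ⟨h6, h7⟩ | ⟨h6, h7⟩
  · rw [h6] at hs2 ⊢
    rw [abs_sub_comm]
    refine le_trans ?_ (le_abs_self _)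
    nlinarith
  · rw [h6] at hs2 ⊢
    refine le_trans ?_ (le_abs_self _)
    nlinarith

/-- The larger cube is the block of `2s + 1` grid cubes per direction centred at the cube `q`. -/
theorem gridCube_subset {n : ℕ} {ℓ : ℝ} (hℓ : 0 < ℓ) {q p : Fin n → ℤ} {s : ℕ}
    (hp : ∀ i, (p i - q i).natAbs ≤ s) : (gridCube hℓ 1 one_pos p).toSet ⊆
      (gridCube hℓ (2 * s + 1) (Nat.succ_pos _) (q - fun _ => (s : ℤ))).toSet := by
  intro x hx
  rw [mem_gridCube] at hx ⊢
  intro i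
  obtain ⟨h1, h2⟩ := hx i
  have h3 := hp i
  have h4 : q i - s ≤ p i := by omega
  have h5 : p i + 1 ≤ q i - s + (2 * s + 1) := by omega
  have h4' : ((q i - s : ℤ) : ℝ) ≤ p i := by exact_mod_cast h4
  have h5' : ((p i + 1 : ℤ) : ℝ) ≤ ((q i - s + (2 * s + 1) : ℤ) : ℝ) := by exact_mod_cast h5
  push_cast at h4' h5'
  simp only [Pi.sub_apply]
  push_cast at h2 ⊢
  exact ⟨le_trans (mul_le_mul_of_nonneg_left h4' hℓ.le) h1,
    lt_of_lt_of_le h2 (mul_le_mul_of_nonneg_left h5' hℓ.le)⟩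

/-- For separated cubes the `L¹` bound suffices; Hölder on each cube turns it into an `L^r` bound at
the cost of `|Q|^{1 - 1/r}` twice. -/
theorem enorm_kernelForm_indicator_far_le {n : ℕ} {K F G : E n → ℂ} {D : ℝ} (hD : 0 ≤ D)
    {S T : Cube n} (hK : ∀ x ∈ T.toSet, ∀ y ∈ S.toSet, ‖K (x - y)‖ ≤ D) (hF : Integrable F)
    (hG : Integrable G) {ℓ : ℝ} (hS : S.side = ℓ) (hT : T.side = ℓ) {r : ℝ} (hr : 1 ≤ r) :
    ‖kernelForm K (S.toSet.indicator F) (T.toSet.indicator G)‖ₑ ≤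
      ENNReal.ofReal (D * (ℓ ^ n) ^ (2 - 2 / r)) *
        (eLpNorm F (ENNReal.ofReal r) (volume.restrict S.toSet) *
          eLpNorm G (ENNReal.ofReal r) (volume.restrict T.toSet)) := by
  have hℓ : 0 < ℓ := hS ▸ S.side_pos
  have hr0 : 0 < r := by linarith
  have hFi := hF.indicator S.measurableSet
  have hGi := hG.indicator T.measurableSet
  have h1 := norm_kernelForm_le (K := K) (B := D) (fun x y hy hx => hK x
    (Set.mem_of_indicator_ne_zero hx) y (Set.mem_of_indicator_ne_zero hy)) hFi hGi
  have h2 : ‖kernelForm K (S.toSet.indicator F) (T.toSet.indicator G)‖ₑ ≤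
      ENNReal.ofReal D * (eLpNorm (S.toSet.indicator F) 1 * eLpNorm (T.toSet.indicator G) 1) := by
    rw [← ofReal_norm, eLpNorm_one_eq_lintegral_enorm, eLpNorm_one_eq_lintegral_enorm,
      ← ofReal_integral_norm_eq_lintegral_enorm hFi, ← ofReal_integral_norm_eq_lintegral_enorm hGi,
      ← ENNReal.ofReal_mul (by positivity), ← ENNReal.ofReal_mul hD]
    exact ENNReal.ofReal_le_ofReal h1
  have h3 : ∀ (Q : Cube n) (H : E n → ℂ), Q.side = ℓ → Integrable H →
      eLpNorm (Q.toSet.indicator H) 1 ≤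
        eLpNorm H (ENNReal.ofReal r) (volume.restrict Q.toSet) *
          ENNReal.ofReal ((ℓ ^ n) ^ (1 - 1 / r)) := by
    intro Q H hQ hH
    rw [eLpNorm_indicator_eq_eLpNorm_restrict Q.measurableSet]
    have := eLpNorm_le_eLpNorm_mul_rpow_measure_univ (p := 1) (q := ENNReal.ofReal r)
      (by simpa using hr) (hH.aestronglyMeasurable.restrict (s := Q.toSet))
    rw [Measure.restrict_apply_univ, Q.volume_eq, hQ, ENNReal.toReal_ofReal hr0.le,
      ENNReal.toReal_one, ENNReal.ofReal_rpow_of_pos (by positivity), div_one] at this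
    exact this
  refine h2.trans ?_
  calc _ ≤ ENNReal.ofReal D * ((eLpNorm F (ENNReal.ofReal r) (volume.restrict S.toSet) *
          ENNReal.ofReal ((ℓ ^ n) ^ (1 - 1 / r))) *
          (eLpNorm G (ENNReal.ofReal r) (volume.restrict T.toSet) *
          ENNReal.ofReal ((ℓ ^ n) ^ (1 - 1 / r)))) := by
        gcongr
        · exact h3 S F hS hF
        · exact h3 T G hT hG
    _ = _ := by
        have e1 : (ℓ ^ n) ^ (2 - 2 / r) = (ℓ ^ n) ^ (1 - 1 / r) * (ℓ ^ n) ^ (1 - 1 / r) := by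
          rw [← Real.rpow_add (by positivity)]
          congr 1
          ring
        rw [e1, ENNReal.ofReal_mul hD, ENNReal.ofReal_mul (by positivity)]
        ring

/-! ### From kernel bounds to sparse bounds -/

/-- A convolution operator with bounded multiplier, whose kernel is bounded and decays rapidly
beyond the scale `ℓ`, is controlled by sparse forms. -/
theorem exists_enorm_kernelForm_le_disjointSup (n : ℕ) : ∃ C : ℝ≥0, ∀ (m F G : E n → ℂ)
    (r α ℓ A B D L : ℝ) (M : ℝ≥0), 1 ≤ r → r ≤ 2 → 0 < α → α ≤ 1 → 1 / α ≤ 2 / r → 0 < ℓ →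
    Integrable m → (∀ ξ, ‖m ξ‖₊ ≤ M) → (∀ x, ‖𝓕⁻ m x‖ ≤ B) → 0 ≤ D →
    (∀ s : ℕ, 2 ≤ s → ∀ x, s * ℓ / 2 ≤ ‖x‖ → ‖𝓕⁻ m x‖ ≤ D * ((s : ℝ) ^ (4 * n))⁻¹) →
    B ^ (2 / r - 1) * (M : ℝ) ^ (2 - 2 / r) ≤ A → D * (ℓ ^ n) ^ (2 - 2 / r) ≤ A →
    Integrable F → Integrable G → Measurable F → Measurable G → 0 < L →
    (∀ x, ‖F x‖ ≤ L) → (∀ x, ‖G x‖ ≤ L) →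
    ‖kernelForm (𝓕⁻ m) F G‖ₑ ≤
      C * ENNReal.ofReal (A * (ℓ ^ n) ^ (2 / r - 1 / α)) * disjointSup α r F G := by
  set Z := ∑' m : Fin n → ℤ, ENNReal.ofReal (((2 * (offsetSize m : ℝ) + 1) ^ (2 * n))⁻¹) with hZ
  have hZt : Z ≠ ⊤ := tsum_offsetSize_ne_top n
  -- The factor `3^{4n}` replaces decay in the offset `s` by decay in `2s + 1`: one has `2s + 1 ≤ 3`
  -- for `s ≤ 1` and `2s + 1 ≤ 3s` otherwise. Of the `4n` powers, `2n` pay for the enlarged cubes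
  -- and `2n` remain for the sum `Z`.
  refine ⟨3 ^ (4 * n) * Z.toNNReal, ?_⟩
  intro m F G r α ℓ A B D L M hr1 hr2 hα hα1 hαr hℓ hm hM hB hD hfar hA1 hA2 hF hG hFm hGm hL
    hFL hGL
  have hr0 : 0 < r := by linarith
  have hA0 : 0 ≤ A := le_trans (by positivity) hA2
  have hKc : Continuous (𝓕⁻ m) := by
    have h1 : 𝓕⁻ m = 𝓕 m ∘ fun x => -x := by
      ext x
      rw [Real.fourierInv_eq_fourier_neg]
      rfl
    rw [h1]
    exact (VectorFourier.fourierIntegral_continuous Real.continuous_fourierChar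
      (by exact continuous_inner) hm).comp continuous_neg
  set N : (Fin n → ℤ) → (E n → ℂ) → ℝ≥0∞ := fun q H =>
    eLpNorm H (ENNReal.ofReal r) (volume.restrict (gridCube hℓ 1 one_pos q).toSet) with hN
  have hpair : ∀ k q : Fin n → ℤ,
      ‖kernelForm (𝓕⁻ m) ((gridCube hℓ 1 one_pos (q + k)).toSet.indicator F)
        ((gridCube hℓ 1 one_pos q).toSet.indicator G)‖ₑ ≤
      ENNReal.ofReal (A * (3 ^ (4 * n) * ((2 * (offsetSize k : ℝ) + 1) ^ (4 * n))⁻¹)) *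
        (N (q + k) F * N q G) := by
    intro k q
    rcases le_or_gt (offsetSize k) 1 with hk | hk
    · have h1 := enorm_kernelForm_le_interp hm hM hB
        (hFm.indicator (gridCube hℓ 1 one_pos (q + k)).measurableSet)
        (hGm.indicator (gridCube hℓ 1 one_pos q).measurableSet) hL
        (fun x => (norm_indicator_le_norm_self F x).trans (hFL x))
        (fun x => (norm_indicator_le_norm_self G x).trans (hGL x))
        (gridCube hℓ 1 one_pos (q + k)).measurableSet (gridCube hℓ 1 one_pos q).measurableSet
        (Cube.volume_ne_top _) (Cube.volume_ne_top _)
        (fun x hx => Set.indicator_of_notMem hx F) (fun x hx => Set.indicator_of_notMem hx G)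
        hr1 hr2
      rw [eLpNorm_indicator_eq_eLpNorm_restrict (Cube.measurableSet _),
        eLpNorm_indicator_eq_eLpNorm_restrict (Cube.measurableSet _)] at h1
      refine h1.trans ?_
      refine mul_le_mul' (ENNReal.ofReal_le_ofReal ?_) le_rfl
      refine hA1.trans (le_mul_of_one_le_right hA0 ?_)
      rw [← div_eq_mul_inv, one_le_div (by positivity)]
      gcongr
      have : (offsetSize k : ℝ) ≤ 1 := by exact_mod_cast hk
      linarith
    · have hk0 : (0 : ℝ) < offsetSize k := by exact_mod_cast (by omega : 0 < offsetSize k)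
      have hk2 : (2 : ℝ) ≤ offsetSize k := by exact_mod_cast hk
      have h1 := enorm_kernelForm_indicator_far_le (n := n) (K := 𝓕⁻ m)
        (D := D * ((offsetSize k : ℝ) ^ (4 * n))⁻¹)
        (S := gridCube hℓ 1 one_pos (q + k)) (T := gridCube hℓ 1 one_pos q) (by positivity)
        (fun x hx y hy => hfar _ hk _ (half_mul_le_norm_sub hℓ hk hx hy)) hF hG
        (ℓ := ℓ) (by simp [gridCube]) (by simp [gridCube]) hr1
      refine h1.trans ?_
      refine mul_le_mul' (ENNReal.ofReal_le_ofReal ?_) le_rfl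
      have h2 : ((offsetSize k : ℝ) ^ (4 * n))⁻¹ ≤
          3 ^ (4 * n) * ((2 * (offsetSize k : ℝ) + 1) ^ (4 * n))⁻¹ := by
        rw [← div_eq_mul_inv, ← div_pow, ← inv_pow]
        gcongr
        rw [inv_eq_one_div, div_le_div_iff₀ hk0 (by positivity)]
        linarith
      calc _ = D * (ℓ ^ n) ^ (2 - 2 / r) * ((offsetSize k : ℝ) ^ (4 * n))⁻¹ := by ring
        _ ≤ _ := by gcongr
  have hsum : ∀ k : Fin n → ℤ, ∑' q, N (q + k) F * N q G ≤
      ENNReal.ofReal ((2 * (offsetSize k : ℝ) + 1) ^ (2 * n) * (ℓ ^ n) ^ (2 / r - 1 / α)) *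
        disjointSup α r F G := by
    intro k
    set s := offsetSize k with hs
    -- Both cubes of a pair lie in one cube of side `(2s + 1)ℓ`, so each pair becomes a product of
    -- norms over the same cube.
    set P : (Fin n → ℤ) → Set (E n) := fun q =>
      (gridCube hℓ (2 * s + 1) (Nat.succ_pos _) q).toSet with hP
    have h1 : ∀ q, N (q + k) F * N q G ≤
        eLpNorm F (ENNReal.ofReal r) (volume.restrict (P (q - fun _ => (s : ℤ)))) *
        eLpNorm G (ENNReal.ofReal r) (volume.restrict (P (q - fun _ => (s : ℤ)))) := by
      intro q
      refine mul_le_mul' (eLpNorm_mono_measure _ (Measure.restrict_mono ?_ le_rfl))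
        (eLpNorm_mono_measure _ (Measure.restrict_mono ?_ le_rfl))
      · exact gridCube_subset hℓ fun i => by
          simpa using natAbs_le_offsetSize k i
      · exact gridCube_subset hℓ fun i => by simp
    refine (ENNReal.tsum_le_tsum h1).trans ?_
    have h2 := (Equiv.subRight (fun _ : Fin n => (s : ℤ))).tsum_eq (fun q =>
      eLpNorm F (ENNReal.ofReal r) (volume.restrict (P q)) *
        eLpNorm G (ENNReal.ofReal r) (volume.restrict (P q)))
    simp only [Equiv.subRight_apply] at h2
    rw [h2]
    refine (tsum_eLpNorm_mul_le hα hα1 hℓ (Nat.succ_pos _) F G).trans ?_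
    rw [← mul_assoc]
    gcongr
    have hM0 : (0 : ℝ) < 2 * (s : ℝ) + 1 := by positivity
    have hcast : ((2 * s + 1 : ℕ) : ℝ) = 2 * (s : ℝ) + 1 := by push_cast; ring
    have he0 : 0 ≤ 2 / r - 1 / α := by linarith
    -- The enlarged cubes thus cost at most `(2s + 1)^n` for their size, besides `(2s + 1)^n` for
    -- their overlap.
    have he1 : 2 / r - 1 / α ≤ 1 := by
      have h3 : 2 / r ≤ 2 := by rw [div_le_iff₀ hr0]; linarith
      have h4 : 1 ≤ 1 / α := by rw [le_div_iff₀ hα]; linarith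
      linarith
    have e1 : ((2 * s + 1 : ℕ) : ℝ≥0∞) ^ n = ENNReal.ofReal ((2 * (s : ℝ) + 1) ^ n) := by
      rw [← hcast, ENNReal.ofReal_pow (by positivity), ENNReal.ofReal_natCast]
    rw [e1, ENNReal.ofReal_rpow_of_pos (by positivity), ← ENNReal.ofReal_mul (by positivity), hcast]
    refine ENNReal.ofReal_le_ofReal ?_
    rw [mul_pow, Real.mul_rpow (by positivity) (by positivity), two_mul n, pow_add]
    have h5 : ((2 * (s : ℝ) + 1) ^ n) ^ (2 / r - 1 / α) ≤ (2 * (s : ℝ) + 1) ^ n := by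
      conv_rhs => rw [← Real.rpow_one ((2 * (s : ℝ) + 1) ^ n)]
      refine Real.rpow_le_rpow_of_exponent_le (one_le_pow₀ ?_) he1
      have : (0 : ℝ) ≤ s := Nat.cast_nonneg s
      linarith
    calc _ = (2 * (s : ℝ) + 1) ^ n * ((2 * (s : ℝ) + 1) ^ n) ^ (2 / r - 1 / α) *
          (ℓ ^ n) ^ (2 / r - 1 / α) := by ring
      _ ≤ _ := by gcongr
  calc ‖kernelForm (𝓕⁻ m) F G‖ₑ ≤ _ := enorm_kernelForm_le_tsum hKc hB hF hG hℓ
    _ ≤ ∑' k : Fin n → ℤ,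
        ENNReal.ofReal (A * (3 ^ (4 * n) * ((2 * (offsetSize k : ℝ) + 1) ^ (4 * n))⁻¹)) *
        (ENNReal.ofReal ((2 * (offsetSize k : ℝ) + 1) ^ (2 * n) * (ℓ ^ n) ^ (2 / r - 1 / α)) *
        disjointSup α r F G) := by
        refine ENNReal.tsum_le_tsum fun k => ?_
        refine (ENNReal.tsum_le_tsum (hpair k)).trans ?_
        rw [ENNReal.tsum_mul_left]
        gcongr
        exact hsum k
    _ = ∑' k : Fin n → ℤ, ENNReal.ofReal (((2 * (offsetSize k : ℝ) + 1) ^ (2 * n))⁻¹) *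
        (ENNReal.ofReal (3 ^ (4 * n)) * ENNReal.ofReal (A * (ℓ ^ n) ^ (2 / r - 1 / α)) *
          disjointSup α r F G) := by
        congr 1
        ext k
        have hM0 : (0 : ℝ) < 2 * (offsetSize k : ℝ) + 1 := by positivity
        have e0 : (2 * (offsetSize k : ℝ) + 1) ^ (4 * n) =
            (2 * (offsetSize k : ℝ) + 1) ^ (2 * n) * (2 * (offsetSize k : ℝ) + 1) ^ (2 * n) := by
          rw [← pow_add]; congr 1; ring
        have e1 : ENNReal.ofReal (A * (3 ^ (4 * n) *
              ((2 * (offsetSize k : ℝ) + 1) ^ (4 * n))⁻¹)) *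
            ENNReal.ofReal ((2 * (offsetSize k : ℝ) + 1) ^ (2 * n) * (ℓ ^ n) ^ (2 / r - 1 / α)) =
            ENNReal.ofReal (((2 * (offsetSize k : ℝ) + 1) ^ (2 * n))⁻¹) *
              (ENNReal.ofReal (3 ^ (4 * n)) * ENNReal.ofReal (A * (ℓ ^ n) ^ (2 / r - 1 / α))) := by
          rw [← ENNReal.ofReal_mul (by positivity), ← ENNReal.ofReal_mul (by positivity),
            ← ENNReal.ofReal_mul (by positivity)]
          congr 1
          rw [e0]
          field_simp
        rw [← mul_assoc, e1, mul_assoc]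
    _ = _ := by
        rw [ENNReal.tsum_mul_right, ← hZ, ENNReal.coe_mul, ENNReal.coe_toNNReal hZt,
          ENNReal.ofReal_pow (by norm_num)]
        norm_num
        ring

/-! ### Rescaling to a frequency shell of arbitrary size -/

theorem fourierInv_comp_inv_smul {n : ℕ} (h : E n → ℂ) {l : ℝ} (hl : 0 < l) (x : E n) :
    𝓕⁻ (fun ξ => h (l⁻¹ • ξ)) x = ((l ^ n : ℝ) : ℂ) * 𝓕⁻ h (l • x) := by
  rw [Real.fourierInv_eq, Real.fourierInv_eq]
  have h1 := Measure.integral_comp_inv_smul (μ := (volume : Measure (E n)))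
    (fun v : E n => Real.fourierChar (inner ℝ v (l • x)) • h v) l
  rw [finrank_euclideanSpace_fin, abs_of_pos (by positivity)] at h1
  rw [← Complex.real_smul, ← h1]
  congr 1
  ext v
  rw [inner_smul_left, inner_smul_right]
  simp [hl.ne']

/-- The modulus one factor `e^{it(2π|ξ|)^a}`. -/
def phase {n : ℕ} (a t : ℝ) (ξ : E n) : ℂ :=
  Complex.exp (Complex.I * ((t * (2 * Real.pi * ‖ξ‖) ^ a : ℝ) : ℂ))

theorem norm_phase {n : ℕ} (a t : ℝ) (ξ : E n) : ‖phase a t ξ‖ = 1 := by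
  rw [phase, mul_comm, Complex.norm_exp_ofReal_mul_I]

theorem continuous_phase {n : ℕ} {a : ℝ} (ha : 0 < a) (t : ℝ) :
    Continuous (phase a t : E n → ℂ) := by
  have h1 : Continuous fun ξ : E n => (2 * Real.pi * ‖ξ‖) ^ a :=
    (continuous_const.mul continuous_norm).rpow_const fun _ => Or.inr ha.le
  unfold phase
  fun_prop

theorem phase_smul {n : ℕ} (a t : ℝ) {l : ℝ} (hl : 0 < l) (ξ : E n) :
    phase a t (l • ξ) = phase a (t * l ^ a) ξ := by
  unfold phase
  rw [norm_smul, Real.norm_of_nonneg hl.le, mul_left_comm,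
    Real.mul_rpow hl.le (by positivity), ← mul_assoc t]

/-- Homogeneity of the phase: a shell of size `l` at time `t` is the unit shell at time `t l^a`, so
every constant can be taken from the unit shell. -/
theorem fourierInv_phase_mul {n : ℕ} (a t : ℝ) (b : E n → ℂ) {l : ℝ} (hl : 0 < l) (x : E n) :
    𝓕⁻ (fun ξ => phase a t ξ * b (l⁻¹ • ξ)) x =
      ((l ^ n : ℝ) : ℂ) * oscKernel a (t * l ^ a) b (l • x) := by
  have h1 : (fun ξ : E n => phase a t ξ * b (l⁻¹ • ξ)) =
      fun ξ => (fun ζ => phase a (t * l ^ a) ζ * b ζ) (l⁻¹ • ξ) := by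
    ext ξ
    simp only
    rw [← phase_smul a t hl, smul_inv_smul₀ hl.ne']
  rw [h1, fourierInv_comp_inv_smul (fun ζ => phase a (t * l ^ a) ζ * b ζ) hl]
  rfl

theorem hasCompactSupport_of_norm_le {n : ℕ} {b : E n → ℂ} {c : ℝ}
    (hbs : ∀ ξ, b ξ ≠ 0 → ‖ξ‖ ≤ c) : HasCompactSupport b :=
  HasCompactSupport.of_support_subset_isCompact (isCompact_closedBall 0 c) fun ξ hξ => by
    simpa using hbs ξ hξ

/-- The dispersive estimate for frequencies of size `l`, in sparse form. -/
theorem exists_enorm_multiplierForm_le_disjointSup {n d : ℕ} {a : ℝ} (ha : 0 < a)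
    (hd : (a ≠ 1 ∧ d = n) ∨ d + 1 = n) {c₁ c₂ : ℝ} (h₁ : 0 < c₁) (h₂ : c₁ ≤ c₂) {b : E n → ℂ}
    (hb : ContDiff ℝ ∞ b) (hbs : ∀ ξ, b ξ ≠ 0 → c₁ ≤ ‖ξ‖ ∧ ‖ξ‖ ≤ c₂) {r α : ℝ} (hr1 : 1 ≤ r)
    (hr2 : r ≤ 2) (hα : 0 < α) (hα1 : α ≤ 1) (hαr : 1 / α ≤ 2 / r) {e : ℝ}
    (he : e = n * (2 / r - 1 / α) - d * (1 / r - 1 / 2)) (he0 : e ≤ 0) :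
    ∃ C : ℝ≥0, ∀ t l : ℝ, 0 < t → 0 < l → ∀ (F G : E n → ℂ) (L : ℝ), Integrable F →
      Integrable G → Measurable F → Measurable G → 0 < L → (∀ x, ‖F x‖ ≤ L) → (∀ x, ‖G x‖ ≤ L) →
      ‖multiplierForm (fun ξ => phase a t ξ * b (l⁻¹ • ξ)) F G‖ₑ ≤
        C * ENNReal.ofReal (t ^ e) * ENNReal.ofReal (l ^ (n * (1 / α - 1) + a * e)) *
          disjointSup α r F G := by
  obtain ⟨C₀, hC₀⟩ := exists_enorm_kernelForm_le_disjointSup n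
  obtain ⟨C₁, hC₁, hB⟩ := norm_oscKernel_le_sqrt_pow ha hd h₁ h₂ hb hbs
  obtain ⟨C₂, c₀, hC₂, hc₀, hfar⟩ := norm_oscKernel_le_of_far a h₁ h₂ hb hbs (4 * n)
  obtain ⟨M', hM'⟩ := (hasCompactSupport_of_norm_le fun ξ h => (hbs ξ h).2).exists_bound_of_continuous
    hb.continuous
  have hM0 : 0 ≤ M' := (norm_nonneg _).trans (hM' 0)
  lift M' to ℝ≥0 using hM0 with M
  -- With grid side `ℓ = c y / l`, points with `‖x‖ ≥ sℓ/2` and `s ≥ 2` satisfy `l‖x‖ ≥ s y` and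
  -- `l‖x‖ ≥ c₀ y`. The second puts them in the region of rapid decay.
  set c := max c₀ 2 with hc
  have hcpos : 0 < c := lt_of_lt_of_le hc₀ (le_max_left _ _)
  have hr0 : 0 < r := by linarith
  have hp0 : 0 ≤ 2 / r - 1 := by
    rw [sub_nonneg, le_div_iff₀ hr0]; linarith
  have hdn : (d : ℝ) ≤ n := by
    rcases hd with ⟨-, h⟩ | h
    · rw [h]
    · exact_mod_cast (by omega : d ≤ n)
  set C' := C₁ ^ (2 / r - 1) * (M : ℝ) ^ (2 - 2 / r) + C₂ * (c ^ n) ^ (2 - 2 / r) with hC'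
  have hC'0 : 0 ≤ C' := by positivity
  refine ⟨C₀ * Real.toNNReal (C' * (c ^ n) ^ (2 / r - 1 / α)), ?_⟩
  intro t l ht hl F G L hF hG hFm hGm hL hFL hGL
  set τ := t * l ^ a with hτ
  have hτ0 : 0 < τ := by positivity
  set y := 1 + τ with hy
  have hy0 : 0 < y := by positivity
  have hy1 : 1 ≤ y := by linarith
  have hsq : (√y) ^ 2 = y := Real.sq_sqrt hy0.le
  have hsq0 : 0 < √y := Real.sqrt_pos.2 hy0
  set m : E n → ℂ := fun ξ => phase a t ξ * b (l⁻¹ • ξ) with hm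
  have hmc : HasCompactSupport m := by
    refine hasCompactSupport_of_norm_le (c := l * c₂) fun ξ hξ => ?_
    have h3 : b (l⁻¹ • ξ) ≠ 0 := fun h => hξ (by simp [hm, h])
    have h4 := (hbs _ h3).2
    rw [norm_smul, norm_inv, Real.norm_of_nonneg hl.le, inv_mul_le_iff₀ hl] at h4
    exact h4
  have hmi : Integrable m := ((continuous_phase ha t).mul
    (hb.continuous.comp (continuous_const_smul _))).integrable_of_hasCompactSupport hmc
  have hKn : ∀ x, ‖𝓕⁻ m x‖ = l ^ n * ‖oscKernel a τ b (l • x)‖ := by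
    intro x
    rw [hm, fourierInv_phase_mul a t b hl, norm_mul, Complex.norm_real,
      Real.norm_of_nonneg (by positivity)]
  -- The far constant `l^n C₂ y^{-2n}` comes from decay of order `4n`: `(√y / (s y))^{4n} = y^{-2n}
  -- s^{-4n}`.
  have hmain := hC₀ m F G r α (c * y / l) (C' * (l ^ n) ^ (2 / r - 1) * y ^ (-(d * (1 / r - 1 / 2))))
    (l ^ n * (C₁ * (√y ^ d)⁻¹)) (l ^ n * (C₂ * (y ^ (2 * n))⁻¹)) L M hr1 hr2 hα hα1 hαr
    (by positivity) hmi (fun ξ => ?_) (fun x => ?_) (by positivity) ?_ ?_ ?_ hF hG hFm hGm hL hFL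
    hGL
  · rw [multiplierForm_eq_kernelForm hmi hF hG]
    refine hmain.trans ?_
    rw [ENNReal.coe_mul, ← ENNReal.ofReal, mul_assoc (C₀ : ℝ≥0∞) (ENNReal.ofReal (C' * _)),
      ← ENNReal.ofReal_mul (by positivity), mul_assoc (C₀ : ℝ≥0∞) (ENNReal.ofReal (C' * _ * _)),
      ← ENNReal.ofReal_mul (by positivity)]
    refine mul_le_mul' (mul_le_mul' le_rfl (ENNReal.ofReal_le_ofReal ?_)) le_rfl
    have e1 : ((c * y / l) ^ n) ^ (2 / r - 1 / α) = (c ^ n) ^ (2 / r - 1 / α) *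
        y ^ (n * (2 / r - 1 / α)) * l ^ (-(n * (2 / r - 1 / α))) := by
      rw [div_pow, mul_pow, Real.div_rpow (by positivity) (by positivity),
        Real.mul_rpow (by positivity) (by positivity), Real.rpow_neg hl.le,
        Real.rpow_mul hl.le, Real.rpow_mul hy0.le, Real.rpow_natCast, Real.rpow_natCast]
      rfl
    have e2 : (l ^ n) ^ (2 / r - 1) = l ^ (n * (2 / r - 1)) := by
      rw [Real.rpow_mul hl.le, Real.rpow_natCast]
    rw [e1, e2]
    calc _ = C' * (c ^ n) ^ (2 / r - 1 / α) * (l ^ (n * (2 / r - 1)) *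
          l ^ (-(n * (2 / r - 1 / α)))) *
          (y ^ (n * (2 / r - 1 / α)) * y ^ (-(d * (1 / r - 1 / 2)))) := by ring
      _ = C' * (c ^ n) ^ (2 / r - 1 / α) * l ^ (n * (1 / α - 1)) * y ^ e := by
          rw [← Real.rpow_add hl, ← Real.rpow_add hy0, he]
          congr 3
          ring
      -- Here `e ≤ 0` enters: since `y ≥ τ`, the bound `y^e` may be replaced by the pure power
      -- `τ^e`, which factors into powers of `t` and `l`.
      _ ≤ C' * (c ^ n) ^ (2 / r - 1 / α) * l ^ (n * (1 / α - 1)) * τ ^ e := by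
          refine mul_le_mul_of_nonneg_left ?_ (by positivity)
          exact Real.rpow_le_rpow_of_nonpos hτ0 (by linarith) he0
      _ = _ := by
          rw [hτ, Real.mul_rpow ht.le (by positivity), ← Real.rpow_mul hl.le, Real.rpow_add hl]
          ring
  · rw [hm, ← NNReal.coe_le_coe, coe_nnnorm, norm_mul, norm_phase, one_mul]
    exact hM' _
  · rw [hKn]
    exact mul_le_mul_of_nonneg_left (hB τ hτ0.le _) (by positivity)
  · intro s hs x hx
    have hs2 : (2 : ℝ) ≤ s := by exact_mod_cast hs
    have h3 : s * y ≤ ‖l • x‖ ∧ c₀ * y ≤ ‖l • x‖ := by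
      rw [norm_smul, Real.norm_of_nonneg hl.le]
      have h4 : s * (c * y) / 2 ≤ l * ‖x‖ := by
        calc s * (c * y) / 2 = l * (s * (c * y / l) / 2) := by field_simp
          _ ≤ _ := by gcongr
      have h5 : (2 : ℝ) ≤ c := le_max_right _ _
      have h6 : c₀ ≤ c := le_max_left _ _
      constructor
      · refine le_trans ?_ h4
        have : (s : ℝ) * y * 2 ≤ s * y * c := by gcongr
        linarith
      · refine le_trans ?_ h4
        have h7 : 2 * (c * y) ≤ s * (c * y) := by gcongr
        have h8 : c₀ * y ≤ c * y := by gcongr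
        linarith
    rw [hKn, mul_assoc]
    refine mul_le_mul_of_nonneg_left ?_ (by positivity)
    refine (hfar τ hτ0.le _ h3.2).trans ?_
    rw [mul_assoc]
    refine mul_le_mul_of_nonneg_left ?_ hC₂
    have h9 : √y / ‖l • x‖ ≤ √y / (s * y) :=
      div_le_div_of_nonneg_left hsq0.le (by positivity) h3.1
    refine (pow_le_pow_left₀ (by positivity) h9 _).trans_eq ?_
    have h10 : (√y) ^ (4 * n) = y ^ (2 * n) := by
      rw [show 4 * n = 2 * (2 * n) by ring, pow_mul, hsq]
    rw [div_pow, mul_pow, h10, show y ^ (4 * n) = y ^ (2 * n) * y ^ (2 * n) by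
      rw [← pow_add]; congr 1; ring]
    field_simp
  · have e1 : (l ^ n * (C₁ * (√y ^ d)⁻¹)) ^ (2 / r - 1) = (l ^ n) ^ (2 / r - 1) *
        (C₁ ^ (2 / r - 1) * y ^ (-(d * (1 / r - 1 / 2)))) := by
      rw [Real.mul_rpow (by positivity) (by positivity), Real.mul_rpow hC₁ (by positivity),
        Real.inv_rpow (by positivity), ← Real.rpow_natCast (√y) d, Real.sqrt_eq_rpow,
        ← Real.rpow_mul hy0.le, ← Real.rpow_mul hy0.le, ← Real.rpow_neg hy0.le]
      congr 3
      ring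
    rw [e1, hC']
    have h4 : 0 ≤ C₂ * (c ^ n) ^ (2 - 2 / r) * (l ^ n) ^ (2 / r - 1) *
      y ^ (-(d * (1 / r - 1 / 2))) := by positivity
    linear_combination h4
  · have e1 : ((c * y / l) ^ n) ^ (2 - 2 / r) = (c ^ n) ^ (2 - 2 / r) *
        y ^ (n * (2 - 2 / r)) * ((l ^ n) ^ (2 / r - 1) * (l ^ n)⁻¹) := by
      rw [div_pow, mul_pow, Real.div_rpow (by positivity) (by positivity),
        Real.mul_rpow (by positivity) (by positivity), Real.rpow_mul hy0.le, Real.rpow_natCast,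
        ← Real.rpow_neg_one (l ^ n), ← Real.rpow_add (by positivity), div_eq_mul_inv,
        ← Real.rpow_neg (by positivity)]
      congr 2
      ring
    -- The left side equals `y^{-2n/r}`, and `d ≤ n` makes `d(1/r - 1/2)` at most `n/r`.
    have e2 : (y ^ (2 * n))⁻¹ * y ^ (n * (2 - 2 / r)) ≤ y ^ (-(d * (1 / r - 1 / 2))) := by
      rw [← Real.rpow_natCast y (2 * n), ← Real.rpow_neg hy0.le, ← Real.rpow_add hy0]
      refine Real.rpow_le_rpow_of_exponent_le hy1 ?_
      have h5 : (d : ℝ) * (1 / r - 1 / 2) ≤ n * (1 / r) := by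
        have : 0 ≤ 1 / r - 1 / 2 := by
          have : 2 / r = 2 * (1 / r) := by ring
          linarith
        nlinarith
      have h6 : (0 : ℝ) ≤ n * (1 / r) := by positivity
      have : (n : ℝ) * (2 - 2 / r) = 2 * n - 2 * (n * (1 / r)) := by ring
      push_cast
      linarith
    rw [e1, hC']
    have h4 : 0 ≤ C₁ ^ (2 / r - 1) * (M : ℝ) ^ (2 - 2 / r) * (l ^ n) ^ (2 / r - 1) *
      y ^ (-(d * (1 / r - 1 / 2))) := by positivity
    calc _ = C₂ * (c ^ n) ^ (2 - 2 / r) * (l ^ n) ^ (2 / r - 1) *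
          ((y ^ (2 * n))⁻¹ * y ^ (n * (2 - 2 / r))) := by field_simp
      _ ≤ C₂ * (c ^ n) ^ (2 - 2 / r) * (l ^ n) ^ (2 / r - 1) *
          y ^ (-(d * (1 / r - 1 / 2))) := by gcongr
      _ ≤ _ := by linear_combination h4

/-! ### Littlewood–Paley decomposition -/

theorem pairing_fourierInv {n : ℕ} {H g : E n → ℂ} (hH : Integrable H) (hg : Integrable g) :
    pairing (𝓕⁻ H) g = ∫ ξ, H ξ * 𝓕⁻ g ξ := by
  have h1 : pairing (𝓕⁻ H) g = ∫ x, 𝓕 H x * g (-x) := by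
    rw [← integral_neg_eq_self]
    unfold pairing
    congr 1
    ext x
    rw [Real.fourierInv_eq_fourier_neg, neg_neg]
  have h5 := VectorFourier.integral_fourierIntegral_smul_eq_flip (L := innerₗ (E n))
      (μ := volume) (ν := volume) (f := H) (g := fun x => g (-x)) Real.continuous_fourierChar
      (by exact continuous_inner) hH hg.comp_neg
  simp only [smul_eq_mul, flip_innerₗ] at h5
  rw [h1]
  refine Eq.trans h5 ?_
  congr 1
  ext ξ
  rw [Real.fourierInv_eq_fourier_comp_neg]
  rfl

theorem pairing_U {n : ℕ} {ρ : ℝ} (hρ : ρ < 1) (t : ℝ) (f g : 𝓢(E n, ℂ)) :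
    pairing (U ρ t f) g = multiplierForm (phase (1 - ρ) t) f g := by
  have hf : Integrable (𝓕 (f : E n → ℂ)) := by
    rw [← SchwartzMap.fourier_coe]
    exact (𝓕 f).integrable
  have h1 : Integrable fun ξ : E n => phase (1 - ρ) t ξ * 𝓕 (f : E n → ℂ) ξ :=
    hf.bdd_mul (c := 1) (continuous_phase (by linarith) t).aestronglyMeasurable
      (Eventually.of_forall fun ξ => (norm_phase _ _ _).le)
  have h2 := pairing_fourierInv h1 g.integrable
  refine Eq.trans h2 ?_
  unfold multiplierForm
  simp only [mul_assoc]

theorem IsCutoff.eq_zero {n : ℕ} {χ : E n → ℝ} (hχ : IsCutoff χ) {ξ : E n} (hξ : 2 < ‖ξ‖) :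
    χ ξ = 0 := by
  refine image_eq_zero_of_notMem_tsupport fun h => ?_
  have := hχ.tsupport_subset h
  rw [mem_closedBall_zero_iff] at this
  linarith

theorem IsCutoff.eq_one_of_norm_le {n : ℕ} {χ : E n → ℝ} (hχ : IsCutoff χ) {ξ : E n}
    (hξ : ‖ξ‖ ≤ 1) : χ ξ = 1 :=
  hχ.eq_one ξ (by simpa using hξ)

theorem IsCutoff.hasCompactSupport {n : ℕ} {χ : E n → ℝ} (hχ : IsCutoff χ) :
    HasCompactSupport χ :=
  (isCompact_closedBall (0 : E n) 2).of_isClosed_subset (isClosed_tsupport χ) hχ.tsupport_subset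

theorem IsCutoff.exists_bound {n : ℕ} {χ : E n → ℝ} (hχ : IsCutoff χ) :
    ∃ M : ℝ, 0 ≤ M ∧ ∀ ξ, |χ ξ| ≤ M := by
  obtain ⟨M, hM⟩ := hχ.hasCompactSupport.exists_bound_of_continuous hχ.smooth.continuous
  exact ⟨M, (norm_nonneg _).trans (hM 0), hM⟩

theorem contDiff_phiHat {n : ℕ} {χ : E n → ℝ} (hχ : IsCutoff χ) (j : ℕ) :
    ContDiff ℝ ∞ (phiHat χ j) := by
  cases j with
  | zero => exact hχ.smooth
  | succ j =>
    exact (hχ.smooth.comp (contDiff_const_smul _)).sub (hχ.smooth.comp (contDiff_const_smul _))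

theorem phiHat_eq_zero {n : ℕ} {χ : E n → ℝ} (hχ : IsCutoff χ) (j : ℕ) {ξ : E n}
    (hξ : 2 * 2 ^ j < ‖ξ‖) : phiHat χ j ξ = 0 := by
  cases j with
  | zero => exact hχ.eq_zero (by simpa using hξ)
  | succ j =>
    have h1 : ∀ i : ℕ, i ≤ j + 1 → χ (((2 : ℝ) ^ i)⁻¹ • ξ) = 0 := by
      intro i hi
      refine hχ.eq_zero ?_
      rw [norm_smul, norm_inv, Real.norm_of_nonneg (by positivity), lt_inv_mul_iff₀ (by positivity)]
      refine lt_of_le_of_lt ?_ hξ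
      rw [mul_comm]
      gcongr
      norm_num
    simp [phiHat, h1 (j + 1) le_rfl, h1 j (Nat.le_succ j)]

theorem phiHat_succ_eq_zero {n : ℕ} {χ : E n → ℝ} (hχ : IsCutoff χ) (j : ℕ) {ξ : E n}
    (hξ : ‖ξ‖ ≤ 2 ^ j) : phiHat χ (j + 1) ξ = 0 := by
  have h1 : ∀ i : ℕ, j ≤ i → χ (((2 : ℝ) ^ i)⁻¹ • ξ) = 1 := by
    intro i hi
    refine hχ.eq_one_of_norm_le ?_
    rw [norm_smul, norm_inv, Real.norm_of_nonneg (by positivity), inv_mul_le_iff₀ (by positivity),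
      mul_one]
    refine hξ.trans ?_
    gcongr
    norm_num
  simp [phiHat, h1 (j + 1) (Nat.le_succ j), h1 j le_rfl]

theorem sum_phiHat {n : ℕ} (χ : E n → ℝ) (J : ℕ) (ξ : E n) :
    ∑ j ∈ Finset.range (J + 1), phiHat χ j ξ = χ (((2 : ℝ) ^ J)⁻¹ • ξ) := by
  induction J with
  | zero => simp [phiHat]
  | succ J ih => rw [Finset.sum_range_succ, ih]; simp [phiHat]

/-- The Littlewood-Paley pieces of a Schwartz function are Schwartz functions. -/
theorem exists_schwartz_lpPiece {n : ℕ} {χ : E n → ℝ} (hχ : IsCutoff χ) (j : ℕ)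
    (f : 𝓢(E n, ℂ)) : ∃ h : 𝓢(E n, ℂ), (h : E n → ℂ) = lpPiece χ j f ∧
      ∀ ξ, 𝓕 (h : E n → ℂ) ξ = phiHat χ j ((2 * Real.pi) • ξ) * 𝓕 (f : E n → ℂ) ξ := by
  have hpi := Real.pi_pos
  have hs : ContDiff ℝ ∞ fun ξ : E n => (phiHat χ j ((2 * Real.pi) • ξ) : ℂ) :=
    Complex.ofRealCLM.contDiff.comp ((contDiff_phiHat hχ j).comp (contDiff_const_smul _))
  have hc : HasCompactSupport fun ξ : E n => (phiHat χ j ((2 * Real.pi) • ξ) : ℂ) := by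
    refine hasCompactSupport_of_norm_le (c := (2 * Real.pi)⁻¹ * (2 * 2 ^ j)) fun ξ hξ => ?_
    by_contra h
    refine hξ ?_
    rw [phiHat_eq_zero hχ j, Complex.ofReal_zero]
    rw [not_le, inv_mul_lt_iff₀ (by positivity)] at h
    rwa [norm_smul, Real.norm_of_nonneg (by positivity)]
  set p : 𝓢(E n, ℂ) := hc.toSchwartzMap hs with hp
  have hphi : ((𝓕⁻ p : 𝓢(E n, ℂ)) : E n → ℂ) = phi χ j := by
    rw [SchwartzMap.fourierInv_coe]
    rfl
  refine ⟨SchwartzMap.convolution (ContinuousLinearMap.mul ℂ ℂ) (𝓕⁻ p) f, ?_, fun ξ => ?_⟩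
  · ext x
    rw [SchwartzMap.convolution_apply, hphi]
    rfl
  · rw [← SchwartzMap.fourier_coe, SchwartzMap.fourier_convolution]
    simp only [FourierTransform.fourier_fourierInv_eq]
    rfl

theorem integrable_fourier_mul_fourierInv {n : ℕ} (f g : 𝓢(E n, ℂ)) :
    Integrable fun ξ : E n => 𝓕 (f : E n → ℂ) ξ * 𝓕⁻ (g : E n → ℂ) ξ := by
  rw [← SchwartzMap.fourier_coe, ← SchwartzMap.fourierInv_coe]
  obtain ⟨C, -, hC⟩ := (𝓕 f).decay 0 0
  refine (𝓕⁻ g).integrable.bdd_mul (c := C) (𝓕 f).continuous.aestronglyMeasurable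
    (Eventually.of_forall fun ξ => ?_)
  simpa using hC ξ

/-- A multiplier form is bounded by the sum of the forms of the pieces of its symbol. -/
theorem enorm_multiplierForm_le_tsum {n : ℕ} (f g : 𝓢(E n, ℂ)) {m : E n → ℂ}
    {w : ℕ → E n → ℂ} (hw : ∀ k, Continuous (w k)) {M : ℝ}
    (hM : ∀ K ξ, ‖∑ k ∈ Finset.range K, w k ξ‖ ≤ M)
    (hlim : ∀ᵐ ξ, Tendsto (fun K => ∑ k ∈ Finset.range K, w k ξ) atTop (nhds (m ξ))) :
    ‖multiplierForm m f g‖ₑ ≤ ∑' k, ‖multiplierForm (w k) f g‖ₑ := by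
  have hi := integrable_fourier_mul_fourierInv f g
  have hwb : ∀ k ξ, ‖w k ξ‖ ≤ M + M := by
    intro k ξ
    have h1 : w k ξ = ∑ i ∈ Finset.range (k + 1), w i ξ - ∑ i ∈ Finset.range k, w i ξ := by
      rw [Finset.sum_range_succ]; ring
    rw [h1]
    exact (norm_sub_le _ _).trans (add_le_add (hM _ _) (hM _ _))
  have hsum : ∀ K, ∑ k ∈ Finset.range K, multiplierForm (w k) f g =
      ∫ ξ, (∑ k ∈ Finset.range K, w k ξ) * (𝓕 (f : E n → ℂ) ξ * 𝓕⁻ (g : E n → ℂ) ξ) := by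
    intro K
    unfold multiplierForm
    rw [← integral_finsetSum]
    · simp only [Finset.sum_mul]
    · intro k _
      exact hi.bdd_mul (c := M + M) (hw k).aestronglyMeasurable (Eventually.of_forall (hwb k))
  have hT : Tendsto (fun K => ∑ k ∈ Finset.range K, multiplierForm (w k) f g) atTop
      (nhds (multiplierForm m f g)) := by
    simp only [hsum]
    refine tendsto_integral_of_dominated_convergence
      (fun ξ => M * ‖𝓕 (f : E n → ℂ) ξ * 𝓕⁻ (g : E n → ℂ) ξ‖) (fun K => ?_) (hi.norm.const_mul M)
      (fun K => Eventually.of_forall fun ξ => ?_) ?_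
    · exact (continuous_finsetSum _ fun k _ => hw k).aestronglyMeasurable.mul
        hi.aestronglyMeasurable
    · rw [norm_mul]
      exact mul_le_mul_of_nonneg_right (hM K ξ) (norm_nonneg _)
    · filter_upwards [hlim] with ξ hξ
      exact hξ.mul_const _
  refine le_of_tendsto hT.enorm (Eventually.of_forall fun K => ?_)
  exact (enorm_sum_le _ _).trans (ENNReal.sum_le_tsum _)

/-- The difference of a dilated cutoff and a more concentrated one, as a function of `2πξ`. -/
def cutoffDiff {n : ℕ} (χ : E n → ℝ) (p q : ℝ) (ξ : E n) : ℂ :=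
  ((χ (p • (2 * Real.pi) • ξ) - χ (q • (2 * Real.pi) • ξ) : ℝ) : ℂ)

theorem contDiff_cutoffDiff {n : ℕ} {χ : E n → ℝ} (hχ : IsCutoff χ) (p q : ℝ) :
    ContDiff ℝ ∞ (cutoffDiff χ p q) :=
  Complex.ofRealCLM.contDiff.comp ((hχ.smooth.comp (by fun_prop)).sub
    (hχ.smooth.comp (by fun_prop)))

theorem norm_smul_two_pi_smul {n : ℕ} {p : ℝ} (hp : 0 ≤ p) (ξ : E n) :
    ‖p • (2 * Real.pi) • ξ‖ = p * (2 * Real.pi * ‖ξ‖) := by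
  rw [norm_smul, norm_smul, Real.norm_of_nonneg hp, Real.norm_of_nonneg (by positivity)]

theorem cutoffDiff_support {n : ℕ} {χ : E n → ℝ} (hχ : IsCutoff χ) {p q : ℝ} (hp : 0 < p)
    (hpq : p ≤ q) (ξ : E n) (hξ : cutoffDiff χ p q ξ ≠ 0) :
    (q * (2 * Real.pi))⁻¹ ≤ ‖ξ‖ ∧ ‖ξ‖ ≤ 2 * (p * (2 * Real.pi))⁻¹ := by
  have hpi := Real.pi_pos
  have hq : 0 < q := hp.trans_le hpq
  have hle : p * (2 * Real.pi * ‖ξ‖) ≤ q * (2 * Real.pi * ‖ξ‖) := by gcongr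
  constructor
  · by_contra h
    refine hξ ?_
    rw [not_le, ← one_div, lt_div_iff₀ (by positivity)] at h
    rw [cutoffDiff, hχ.eq_one_of_norm_le, hχ.eq_one_of_norm_le, sub_self, Complex.ofReal_zero]
    · rw [norm_smul_two_pi_smul hq.le]; linarith
    · rw [norm_smul_two_pi_smul hp.le]; linarith
  · by_contra h
    refine hξ ?_
    rw [not_le, ← div_eq_mul_inv, div_lt_iff₀ (by positivity)] at h
    rw [cutoffDiff, hχ.eq_zero, hχ.eq_zero, sub_self, Complex.ofReal_zero]
    · rw [norm_smul_two_pi_smul hq.le]; linarith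
    · rw [norm_smul_two_pi_smul hp.le]; linarith

theorem multiplierForm_congr {n : ℕ} {m m' F F' G : E n → ℂ}
    (h : ∀ ξ, m ξ * 𝓕 F ξ = m' ξ * 𝓕 F' ξ) : multiplierForm m F G = multiplierForm m' F' G := by
  unfold multiplierForm
  congr 1
  ext ξ
  rw [← mul_assoc, ← mul_assoc, h]

/-- A wider cutoff equal to one on the shell. The multiplier can then be localised while `φ_j * f`
itself stays as the function to which the sparse bound is applied. -/
theorem cutoffDiff_mul_phiHat {n : ℕ} {χ : E n → ℝ} (hχ : IsCutoff χ) (j : ℕ) (ξ : E n) :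
    cutoffDiff χ (1 / 2) 4 (((2 : ℝ) ^ (j + 1))⁻¹ • ξ) *
      (phiHat χ (j + 1) ((2 * Real.pi) • ξ) : ℂ) = phiHat χ (j + 1) ((2 * Real.pi) • ξ) := by
  have hn : ‖(2 * Real.pi) • ξ‖ = 2 * Real.pi * ‖ξ‖ := by
    rw [norm_smul, Real.norm_of_nonneg (by positivity)]
  have hn' : ‖((2 : ℝ) ^ (j + 1))⁻¹ • ξ‖ = ((2 : ℝ) ^ (j + 1))⁻¹ * ‖ξ‖ := by
    rw [norm_smul, Real.norm_of_nonneg (by positivity)]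
  have h2 : (0 : ℝ) < 2 ^ (j + 1) := by positivity
  rcases le_or_gt ‖(2 * Real.pi) • ξ‖ (2 ^ j) with h | h
  · rw [phiHat_succ_eq_zero hχ j h]; simp
  rcases lt_or_ge (2 * 2 ^ (j + 1)) ‖(2 * Real.pi) • ξ‖ with h' | h'
  · rw [phiHat_eq_zero hχ (j + 1) h']; simp
  rw [hn] at h h'
  rw [cutoffDiff, hχ.eq_one_of_norm_le, hχ.eq_zero]
  · simp
  · rw [norm_smul_two_pi_smul (by norm_num), hn']
    rw [show (4 : ℝ) * (2 * Real.pi * (((2 : ℝ) ^ (j + 1))⁻¹ * ‖ξ‖)) =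
      (4 * (2 * Real.pi * ‖ξ‖)) / 2 ^ (j + 1) by field_simp, lt_div_iff₀ h2, pow_succ]
    linarith
  · rw [norm_smul_two_pi_smul (by norm_num), hn']
    rw [show (1 / 2 : ℝ) * (2 * Real.pi * (((2 : ℝ) ^ (j + 1))⁻¹ * ‖ξ‖)) =
      (2 * Real.pi * ‖ξ‖ / 2) / 2 ^ (j + 1) by field_simp, div_le_one₀ h2]
    linarith

/-- Telescoping over the shells of size `2·2^{-k}`. The subtracted cutoff shrinks to the origin as
`K` grows. -/
theorem sum_cutoffDiff {n : ℕ} (χ : E n → ℝ) (K : ℕ) (ξ : E n) :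
    ∑ k ∈ Finset.range K, cutoffDiff χ 1 2 ((2 * ((2 : ℝ) ^ k)⁻¹)⁻¹ • ξ) =
      ((χ ((1 / 2 : ℝ) • (2 * Real.pi) • ξ) -
        χ (((2 : ℝ) ^ K / 2) • (2 * Real.pi) • ξ) : ℝ) : ℂ) := by
  induction K with
  | zero => simp
  | succ K ih =>
    rw [Finset.sum_range_succ, ih, cutoffDiff, ← Complex.ofReal_add]
    congr 1
    simp only [smul_smul]
    have e1 : (1 : ℝ) * (2 * Real.pi * (2 * ((2 : ℝ) ^ K)⁻¹)⁻¹) =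
        (2 : ℝ) ^ K / 2 * (2 * Real.pi) := by field_simp
    have e2 : (2 : ℝ) * (2 * Real.pi * (2 * ((2 : ℝ) ^ K)⁻¹)⁻¹) =
        (2 : ℝ) ^ (K + 1) / 2 * (2 * Real.pi) := by rw [pow_succ]; field_simp
    rw [e1, e2]
    ring

theorem enorm_multiplierForm_phase_le_tsum_phiHat {n : ℕ} {χ : E n → ℝ} (hχ : IsCutoff χ)
    {a : ℝ} (ha : 0 < a) (t : ℝ) (f g : 𝓢(E n, ℂ)) :
    ‖multiplierForm (phase a t) f g‖ₑ ≤
      ∑' j, ‖multiplierForm (fun ξ => phase a t ξ * phiHat χ j ((2 * Real.pi) • ξ)) f g‖ₑ := by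
  obtain ⟨M, hM0, hM⟩ := hχ.exists_bound
  have hsum : ∀ J (ξ : E n), ∑ j ∈ Finset.range (J + 1),
      phase a t ξ * (phiHat χ j ((2 * Real.pi) • ξ) : ℂ) =
        phase a t ξ * (χ (((2 : ℝ) ^ J)⁻¹ • (2 * Real.pi) • ξ) : ℂ) := by
    intro J ξ
    rw [← Finset.mul_sum, ← sum_phiHat χ J, Complex.ofReal_sum]
  refine enorm_multiplierForm_le_tsum f g (M := M) (fun j => ?_) (fun K ξ => ?_)
    (Eventually.of_forall fun ξ => ?_)
  · exact (continuous_phase ha t).mul (Complex.continuous_ofReal.comp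
      ((contDiff_phiHat hχ j).continuous.comp (continuous_const_smul _)))
  · cases K with
    | zero => simpa using hM0
    | succ J =>
      rw [hsum, norm_mul, norm_phase, one_mul, Complex.norm_real]
      exact hM _
  · rw [← tendsto_add_atTop_iff_nat 1]
    refine tendsto_const_nhds.congr' ?_
    obtain ⟨J₀, hJ₀⟩ := pow_unbounded_of_one_lt ‖(2 * Real.pi) • ξ‖ (one_lt_two (α := ℝ))
    filter_upwards [eventually_ge_atTop J₀] with J hJ
    rw [hsum, hχ.eq_one_of_norm_le]
    · simp
    · rw [norm_smul, norm_inv, Real.norm_of_nonneg (by positivity),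
        inv_mul_le_iff₀ (by positivity), mul_one]
      exact hJ₀.le.trans (pow_le_pow_right₀ one_le_two hJ)

/-- Splits low frequencies into shells. The partial sums converge off the origin, which is a null
set because `n ≥ 1`, and they are uniformly bounded. -/
theorem enorm_multiplierForm_phase_le_tsum_cutoffDiff {n : ℕ} (hn : 1 ≤ n) {χ : E n → ℝ}
    (hχ : IsCutoff χ) {a : ℝ} (ha : 0 < a) (t : ℝ) (f g : 𝓢(E n, ℂ)) :
    ‖multiplierForm (fun ξ => phase a t ξ * (χ ((1 / 2 : ℝ) • (2 * Real.pi) • ξ) : ℂ)) f g‖ₑ ≤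
      ∑' k : ℕ, ‖multiplierForm (fun ξ => phase a t ξ *
        cutoffDiff χ 1 2 ((2 * ((2 : ℝ) ^ k)⁻¹)⁻¹ • ξ)) f g‖ₑ := by
  have : Nonempty (Fin n) := ⟨⟨0, hn⟩⟩
  have hpi := Real.pi_pos
  obtain ⟨M, hM0, hM⟩ := hχ.exists_bound
  refine enorm_multiplierForm_le_tsum f g (M := M + M) (fun j => ?_) (fun K ξ => ?_) ?_
  · exact (continuous_phase ha t).mul
      ((contDiff_cutoffDiff hχ 1 2).continuous.comp (continuous_const_smul _))
  · rw [← Finset.mul_sum, sum_cutoffDiff, norm_mul, norm_phase, one_mul, Complex.norm_real]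
    exact (norm_sub_le _ _).trans (add_le_add (hM _) (hM _))
  · have h0 : ∀ᵐ ξ : E n, ξ ≠ 0 := by
      rw [ae_iff]
      simp
    filter_upwards [h0] with ξ hξ
    refine tendsto_const_nhds.congr' ?_
    have hξ' : 0 < ‖ξ‖ := norm_pos_iff.2 hξ
    obtain ⟨K₀, hK₀⟩ := pow_unbounded_of_one_lt (4 / (2 * Real.pi * ‖ξ‖)) (one_lt_two (α := ℝ))
    filter_upwards [eventually_ge_atTop K₀] with K hK
    have h1 : 4 / (2 * Real.pi * ‖ξ‖) < 2 ^ K :=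
      hK₀.trans_le (pow_le_pow_right₀ one_le_two hK)
    rw [div_lt_iff₀ (by positivity)] at h1
    rw [← Finset.mul_sum, sum_cutoffDiff, hχ.eq_zero (ξ := ((2 : ℝ) ^ K / 2) • _), sub_zero]
    rw [norm_smul_two_pi_smul (by positivity)]
    linarith

/-! ### Summation over frequencies -/

theorem exists_bound_schwartz {n : ℕ} (f g : 𝓢(E n, ℂ)) :
    ∃ L : ℝ, 0 < L ∧ (∀ x, ‖f x‖ ≤ L) ∧ ∀ x, ‖g x‖ ≤ L := by
  obtain ⟨C, hC, h⟩ := f.decay 0 0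
  obtain ⟨C', hC', h'⟩ := g.decay 0 0
  refine ⟨C + C', by positivity, fun x => ?_, fun x => ?_⟩
  · have := h x
    simp only [pow_zero, norm_iteratedFDeriv_zero, one_mul] at this
    linarith
  · have := h' x
    simp only [pow_zero, norm_iteratedFDeriv_zero, one_mul] at this
    linarith

theorem tsum_two_mul_inv_pow_rpow_ne_top {κ : ℝ} (hκ : 0 < κ) :
    ∑' k : ℕ, ENNReal.ofReal ((2 * ((2 : ℝ) ^ k)⁻¹) ^ κ) ≠ ⊤ := by
  have h1 : ∀ k : ℕ, (2 * ((2 : ℝ) ^ k)⁻¹) ^ κ = 2 ^ κ * ((2 : ℝ) ^ (-κ)) ^ k := by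
    intro k
    rw [Real.mul_rpow (by norm_num) (by positivity), Real.inv_rpow (by positivity),
      ← Real.rpow_natCast, ← Real.rpow_natCast, ← Real.rpow_mul (by norm_num),
      ← Real.rpow_mul (by norm_num), ← Real.rpow_neg (by norm_num)]
    congr 2
    ring
  simp only [h1]
  exact ((summable_geometric_of_lt_one (by positivity)
    (Real.rpow_lt_one_of_one_lt_of_neg one_lt_two (by linarith))).mul_left _).tsum_ofReal_ne_top

/-- The dispersive estimate, summed over all frequencies. -/
theorem exists_enorm_multiplierForm_phase_le {n d : ℕ} (hn : 1 ≤ n) {χ : E n → ℝ}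
    (hχ : IsCutoff χ) {a : ℝ} (ha : 0 < a)
    (hd : (a ≠ 1 ∧ d = n) ∨ d + 1 = n) {r α : ℝ} (hr1 : 1 ≤ r)
    (hr2 : r ≤ 2) (hα : 0 < α) (hα1 : α ≤ 1) (hαr : 1 / α ≤ 2 / r) {e κ : ℝ}
    (he : e = n * (2 / r - 1 / α) - d * (1 / r - 1 / 2)) (he0 : e ≤ 0)
    (hκ : κ = n * (1 / α - 1) + a * e) (hκ0 : 0 < κ) :
    ∃ C : ℝ≥0, ∀ (f g : 𝓢(E n, ℂ)) (t : ℝ), 0 < t →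
      ‖multiplierForm (phase a t) f g‖ₑ ≤ C * ENNReal.ofReal (t ^ e) *
        ∑' j : ℕ, ENNReal.ofReal ((2 : ℝ) ^ ((j : ℝ) * κ)) * disjointSup α r (lpPiece χ j f) g := by
  have hpi := Real.pi_pos
  obtain ⟨C₁, hC₁⟩ := exists_enorm_multiplierForm_le_disjointSup ha hd
    (c₁ := (4 * (2 * Real.pi))⁻¹) (c₂ := 2 * (1 / 2 * (2 * Real.pi))⁻¹) (by positivity)
    (by rw [← one_div, ← div_eq_mul_inv, div_le_div_iff₀ (by positivity) (by positivity)]; linarith)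
    (contDiff_cutoffDiff hχ (1 / 2) 4) (cutoffDiff_support hχ (by norm_num) (by norm_num))
    hr1 hr2 hα hα1 hαr he he0
  obtain ⟨C₂, hC₂⟩ := exists_enorm_multiplierForm_le_disjointSup ha hd
    (c₁ := (2 * (2 * Real.pi))⁻¹) (c₂ := 2 * (1 * (2 * Real.pi))⁻¹) (by positivity)
    (by rw [← one_div, ← div_eq_mul_inv, div_le_div_iff₀ (by positivity) (by positivity)]; linarith)
    (contDiff_cutoffDiff hχ 1 2) (cutoffDiff_support hχ (by norm_num) (by norm_num))
    hr1 hr2 hα hα1 hαr he he0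
  rw [← hκ] at hC₁ hC₂
  set Z := ∑' k : ℕ, ENNReal.ofReal ((2 * ((2 : ℝ) ^ k)⁻¹) ^ κ) with hZ
  have hZt : Z ≠ ⊤ := tsum_two_mul_inv_pow_rpow_ne_top hκ0
  -- `C₁` serves the single shells `j ≥ 1`. The piece `j = 0` needs `C₂` times the sum `Z` of the
  -- low frequency weights, which is finite because `κ > 0`.
  refine ⟨C₁ + C₂ * Z.toNNReal, fun f g t ht => ?_⟩
  refine (enorm_multiplierForm_phase_le_tsum_phiHat hχ ha t f g).trans ?_
  rw [← ENNReal.tsum_mul_left]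
  refine ENNReal.tsum_le_tsum fun j => ?_
  obtain ⟨F, hF, hFhat⟩ := exists_schwartz_lpPiece hχ j f
  obtain ⟨L, hL, hFL, hGL⟩ := exists_bound_schwartz F g
  rw [← hF]
  have hFm := F.continuous.measurable
  have hGm := g.continuous.measurable
  cases j with
  | zero =>
    -- The cutoff at half the argument equals one on the support of `φ̂_0`, so it can multiply the
    -- symbol once `φ̂_0` has been absorbed into `F`.
    have h1 : multiplierForm (fun ξ => phase a t ξ * phiHat χ 0 ((2 * Real.pi) • ξ)) f g =
        multiplierForm (fun ξ => phase a t ξ * (χ ((1 / 2 : ℝ) • (2 * Real.pi) • ξ) : ℂ)) F g := by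
      refine multiplierForm_congr fun ξ => ?_
      rw [hFhat, mul_assoc, mul_assoc]
      congr 1
      rw [← mul_assoc]
      congr 1
      rcases le_or_gt ‖(2 * Real.pi) • ξ‖ 2 with h | h
      · rw [hχ.eq_one_of_norm_le (ξ := (1 / 2 : ℝ) • _)]
        · simp
        · rw [norm_smul, Real.norm_of_nonneg (by norm_num)]
          linarith
      · have h0 : phiHat χ 0 ((2 * Real.pi) • ξ) = 0 := hχ.eq_zero h
        simp [h0]
    rw [h1]
    refine (enorm_multiplierForm_phase_le_tsum_cutoffDiff hn hχ ha t F g).trans ?_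
    refine (ENNReal.tsum_le_tsum fun k => hC₂ t (2 * ((2 : ℝ) ^ k)⁻¹) ht (by positivity) F g L
      F.integrable g.integrable hFm hGm hL hFL hGL).trans ?_
    rw [ENNReal.tsum_mul_right, ENNReal.tsum_mul_left, ← hZ]
    rw [Nat.cast_zero, zero_mul, Real.rpow_zero, ENNReal.ofReal_one, one_mul, ENNReal.coe_add,
      ENNReal.coe_mul, ENNReal.coe_toNNReal hZt]
    refine mul_le_mul' ?_ le_rfl
    rw [mul_right_comm]
    exact mul_le_mul' le_add_self le_rfl
  | succ j =>
    have h1 : multiplierForm (fun ξ => phase a t ξ * phiHat χ (j + 1) ((2 * Real.pi) • ξ)) f g =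
        multiplierForm (fun ξ => phase a t ξ *
          cutoffDiff χ (1 / 2) 4 (((2 : ℝ) ^ (j + 1))⁻¹ • ξ)) F g := by
      refine multiplierForm_congr fun ξ => ?_
      rw [hFhat, mul_assoc, mul_assoc, ← mul_assoc (cutoffDiff _ _ _ _), cutoffDiff_mul_phiHat hχ]
    rw [h1]
    refine (hC₁ t ((2 : ℝ) ^ (j + 1)) ht (by positivity) F g L
      F.integrable g.integrable hFm hGm hL hFL hGL).trans ?_
    have h2 : ((2 : ℝ) ^ (j + 1)) ^ κ = 2 ^ (((j + 1 : ℕ) : ℝ) * κ) := by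
      rw [Real.rpow_mul (by norm_num), Real.rpow_natCast]
    rw [h2, mul_assoc]
    refine mul_le_mul' (mul_le_mul' ?_ le_rfl) le_rfl
    rw [ENNReal.coe_add]
    exact le_self_add

/-! ### Truncation to large cubes, and the choice of the families -/

/-- Finite partial sums eventually agree and give the lower bound; termwise domination gives the
upper bound. No monotonicity in `R` is required. -/
theorem tendsto_tsum_of_eventually_eq {ι : Type*} {u : ℝ → ι → ℝ≥0∞} {v : ι → ℝ≥0∞}
    (hle : ∀ R i, u R i ≤ v i) (hev : ∀ i, ∀ᶠ R in atTop, u R i = v i) :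
    Tendsto (fun R => ∑' i, u R i) atTop (nhds (∑' i, v i)) := by
  refine tendsto_order.2 ⟨fun c hc => ?_, fun c hc => ?_⟩
  · rw [ENNReal.tsum_eq_iSup_sum, lt_iSup_iff] at hc
    obtain ⟨s, hs⟩ := hc
    have h1 : ∀ᶠ R in atTop, ∀ i ∈ s, u R i = v i := (eventually_all_finset s).2 fun i _ => hev i
    filter_upwards [h1] with R hR
    refine hs.trans_le ?_
    rw [← Finset.sum_congr rfl hR]
    exact ENNReal.sum_le_tsum _
  · exact Eventually.of_forall fun R => (ENNReal.tsum_le_tsum (hle R)).trans_lt hc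

theorem Cube.eventually_subset {n : ℕ} (Q : Cube n) :
    ∀ᶠ R : ℝ in atTop, Q.toSet ⊆ cubeSet 0 R := by
  filter_upwards [eventually_ge_atTop (2 * (‖Q.center‖ + Q.side))] with R hR x hx i
  obtain ⟨h1, h2⟩ := hx i
  have h3 : |Q.center i| ≤ ‖Q.center‖ := PiLp.norm_apply_le Q.center i
  have h4 := abs_le.1 h3
  have h5 := Q.side_pos
  simp only [PiLp.zero_apply]
  constructor <;> linarith [h4.1, h4.2]

theorem avg_indicator_le {n : ℕ} (p : ℝ) (Q : Cube n) (h : E n → ℂ) (s : Set (E n)) :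
    avg p Q (s.indicator h) ≤ avg p Q h :=
  mul_le_mul' le_rfl (eLpNorm_mono fun x => norm_indicator_le_norm_self h x)

theorem avg_indicator_of_subset {n : ℕ} (p : ℝ) {Q : Cube n} (h : E n → ℂ) {s : Set (E n)}
    (hs : Q.toSet ⊆ s) : avg p Q (s.indicator h) = avg p Q h := by
  unfold avg
  congr 1
  refine eLpNorm_congr_ae (ae_restrict_of_forall_mem Q.measurableSet fun x hx => ?_)
  exact Set.indicator_of_mem (hs hx) h

/-- Each fixed cube eventually lies in `Q_R`, after which truncation does not change its average. -/
theorem tendsto_sparseForm_indicator {n : ℕ} {α : ℝ} (hα : 0 < α) (S : Set (Cube n)) (r s : ℝ)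
    (h g : E n → ℂ) : Tendsto (fun R : ℝ => sparseForm α S r s ((cubeSet 0 R).indicator h) g) atTop
      (nhds (sparseForm α S r s h g)) := by
  unfold sparseForm
  refine (ENNReal.continuous_rpow_const.tendsto _).comp
    (tendsto_tsum_of_eventually_eq (fun R Q => ?_) fun Q => ?_)
  · gcongr
    exact avg_indicator_le _ _ _ _
  · filter_upwards [(Q : Cube n).eventually_subset] with R hR
    rw [avg_indicator_of_subset _ _ hR]

/-- A Fatou argument: every finite sum over `j` converges as `R → ∞` and is dominated by the full
sum for each `R`. -/
theorem tsum_sparseForm_le_besovSparseForm {n : ℕ} (χ : E n → ℝ) (κ : ℝ) {α : ℝ} (hα : 0 < α)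
    (r : ℝ) (S : ℕ → Set (Cube n)) (f g : E n → ℂ) :
    ∑' j : ℕ, ENNReal.ofReal ((2 : ℝ) ^ ((j : ℝ) * κ)) * sparseForm α (S j) r r (lpPiece χ j f) g ≤
      besovSparseForm χ κ α r S f g := by
  rw [ENNReal.tsum_eq_iSup_sum]
  refine iSup_le fun s => ?_
  have h1 : Tendsto (fun R : ℝ => ∑ j ∈ s, ENNReal.ofReal ((2 : ℝ) ^ ((j : ℝ) * κ)) *
      sparseForm α (S j) r r ((cubeSet (0 : E n) R).indicator (lpPiece χ j f)) g) atTop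
      (nhds (∑ j ∈ s, ENNReal.ofReal ((2 : ℝ) ^ ((j : ℝ) * κ)) *
        sparseForm α (S j) r r (lpPiece χ j f) g)) :=
    tendsto_finsetSum _ fun j _ => ENNReal.Tendsto.const_mul
      (tendsto_sparseForm_indicator hα _ _ _ _ _) (Or.inr ENNReal.ofReal_ne_top)
  rw [← h1.liminf_eq]
  exact liminf_le_liminf (Eventually.of_forall fun R => ENNReal.sum_le_tsum _)

/-- Common form of both cases, with `d` the number of directions in which the phase disperses. The
conditions `e ≤ 0` and `0 < κ` are all that has to be verified about the exponents afterwards. -/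
theorem exists_sparse_family_bound {n d : ℕ} (hn : 1 ≤ n) {χ : E n → ℝ} (hχ : IsCutoff χ)
    {ρ : ℝ} (hρ : ρ < 1) (hd : (ρ ≠ 0 ∧ d = n) ∨ d + 1 = n) {r α : ℝ} (hr1 : 1 ≤ r) (hr2 : r ≤ 2)
    (hα1 : 1 ≤ 1 / α) (hαr : 1 / α ≤ 2 / r) {e κ : ℝ}
    (he : e = n * (2 / r - 1 / α) - d * (1 / r - 1 / 2)) (he0 : e ≤ 0)
    (hκ : κ = n * (1 / α - 1) + (1 - ρ) * e) (hκ0 : 0 < κ) :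
    ∃ C : ℝ≥0, ∀ f g : 𝓢(E n, ℂ), ∃ S : ℕ → Set (Cube n), (∀ j, IsSparse (1 / 2) (S j)) ∧
      ∀ t : ℝ, 0 < t → ‖pairing (U ρ t f) g‖ₑ ≤
        C * ENNReal.ofReal (t ^ e) * besovSparseForm χ κ α r S f g := by
  have hα : 0 < α := one_div_pos.1 (by linarith)
  have hr0 : 0 < r := by linarith
  have hα1' : α ≤ 1 := by rwa [le_div_iff₀ hα, one_mul] at hα1
  have hrα : r ≤ 2 * α := by rwa [div_le_div_iff₀ hα hr0, one_mul] at hαr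
  obtain ⟨C, hC⟩ := exists_enorm_multiplierForm_phase_le hn hχ (a := 1 - ρ) (by linarith)
    (hd.imp_left fun h => ⟨fun h' => h.1 (by linarith), h.2⟩) hr1 hr2 hα hα1' hαr he he0 hκ hκ0
  -- The factor `2` is the loss in choosing a family that nearly attains the supremum.
  refine ⟨C * 2, fun f g => ?_⟩
  have hS : ∀ j, ∃ S : Set (Cube n), IsSparse (1 / 2) S ∧
      disjointSup α r (lpPiece χ j f) g ≤ 2 * sparseForm α S r r (lpPiece χ j f) g := by
    intro j
    obtain ⟨F, hF, -⟩ := exists_schwartz_lpPiece hχ j f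
    rw [← hF]
    exact exists_disjoint_family hr1 hrα (F.memLp _) (g.memLp _)
  -- The families depend only on `φ_j * f` and `g`; the time is introduced after they are fixed.
  choose S hS1 hS2 using hS
  refine ⟨S, hS1, fun t ht => ?_⟩
  rw [pairing_U hρ]
  refine (hC f g t ht).trans ?_
  calc _ ≤ C * ENNReal.ofReal (t ^ e) * ∑' j : ℕ, ENNReal.ofReal ((2 : ℝ) ^ ((j : ℝ) * κ)) *
        (2 * sparseForm α (S j) r r (lpPiece χ j f) g) := by
        gcongr with j
        exact hS2 j
    _ = ↑(C * 2) * ENNReal.ofReal (t ^ e) * ∑' j : ℕ, ENNReal.ofReal ((2 : ℝ) ^ ((j : ℝ) * κ)) *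
        sparseForm α (S j) r r (lpPiece χ j f) g := by
        simp only [mul_left_comm _ (2 : ℝ≥0∞)]
        rw [ENNReal.tsum_mul_left, ENNReal.coe_mul, ENNReal.coe_ofNat]
        ring
    _ ≤ _ := by
        gcongr
        exact tsum_sparseForm_le_besovSparseForm χ κ hα r S f g

end SparseDispersive

end

/-! ### The two ranges of exponents -/

theorem theorem3p3 (n : ℕ) (hn : 1 ≤ n) :
    ∃ η : ℝ, 0 < η ∧ η < 1 ∧
      ∀ χ : SparseDispersive.E n → ℝ, SparseDispersive.IsCutoff χ →
      ∀ r : ℝ, 1 ≤ r → r ≤ 2 →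
      (∀ ρ α : ℝ, -1 ≤ ρ → ρ < 1 → ρ ≠ 0 → 1 / r + 1 / 2 < 1 / α → 1 / α < 2 / r →
        ∃ C : ℝ≥0, ∀ f g : 𝓢(SparseDispersive.E n, ℂ),
          ∃ S : ℕ → Set (SparseDispersive.Cube n),
            (∀ j, SparseDispersive.IsSparse η (S j)) ∧
            ∀ t : ℝ, 0 < t →
              ‖SparseDispersive.pairing (SparseDispersive.U ρ t f) g‖ₑ ≤
                C * ENNReal.ofReal (t ^ ((n : ℝ) * (1 / r - 1 / 2 - (1 / α - 1)))) *
                  SparseDispersive.besovSparseForm χ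
                    ((n : ℝ) * (1 - ρ) * (1 / r - 1 / 2) + ρ * n * (1 / α - 1)) α r S f g) ∧
      (∀ α : ℝ, ((n : ℝ) + 1) / (r * n) + ((n : ℝ) - 1) / (2 * n) < 1 / α → 1 / α < 2 / r →
        ∃ C : ℝ≥0, ∀ f g : 𝓢(SparseDispersive.E n, ℂ),
          ∃ S : ℕ → Set (SparseDispersive.Cube n),
            (∀ j, SparseDispersive.IsSparse η (S j)) ∧
            ∀ t : ℝ, 0 < t →
              ‖SparseDispersive.pairing (SparseDispersive.U 0 t f) g‖ₑ ≤
                C * ENNReal.ofReal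
                    (t ^ (((n : ℝ) + 1) * (1 / r - 1 / 2) - (n : ℝ) * (1 / α - 1))) *
                  SparseDispersive.besovSparseForm χ
                    (((n : ℝ) + 1) * (1 / r - 1 / 2)) α r S f g) := by
  have hn1 : (1 : ℝ) ≤ n := by exact_mod_cast hn
  have hn0 : (0 : ℝ) < n := by linarith
  refine ⟨1 / 2, by norm_num, by norm_num, fun χ hχ r hr1 hr2 => ⟨?_, ?_⟩⟩
  · intro ρ α hρ1 hρ2 hρ0 h1 h2
    have hr0 : 0 < r := by linarith
    have hu : 1 / 2 ≤ 1 / r := one_div_le_one_div_of_le hr0 hr2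
    have hu2 : 2 / r = 2 * (1 / r) := by ring
    rw [hu2] at h2
    refine SparseDispersive.exists_sparse_family_bound (d := n) hn hχ hρ2 (Or.inl ⟨hρ0, rfl⟩) hr1
      hr2 (by linarith) (by rw [hu2]; exact h2.le) (by ring) ?_ (by ring) ?_
    · exact mul_nonpos_of_nonneg_of_nonpos hn0.le (by linarith)
    · set u := 1 / r
      set v := 1 / α
      have hκ : (n : ℝ) * (1 - ρ) * (u - 1 / 2) + ρ * n * (v - 1) =
          n * ((1 - ρ) * (u - 1 / 2) + ρ * (v - 1)) := by ring
      rw [hκ]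
      refine mul_pos hn0 ?_
      -- Positivity of `κ`. For `ρ < 0` the bound `v < 2u` gives `ρ(v - 1) > ρ(2u - 1)`, which
      -- leaves `(1 + ρ)(u - 1/2) ≥ 0` since `ρ ≥ -1`. For `ρ > 0` both terms have the right sign,
      -- the second strictly, because `v > 1`.
      rcases lt_or_gt_of_ne hρ0 with h | h
      · have h3 : ρ * (2 * u - 1) < ρ * (v - 1) := mul_lt_mul_of_neg_left (by linarith) h
        have h4 : 0 ≤ (1 + ρ) * (u - 1 / 2) := mul_nonneg (by linarith) (by linarith)
        linarith
      · have h3 : 0 < ρ * (v - 1) := mul_pos h (by linarith)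
        have h4 : 0 ≤ (1 - ρ) * (u - 1 / 2) := mul_nonneg (by linarith) (by linarith)
        linarith
  · intro α h1 h2
    have hr0 : 0 < r := by linarith
    have hu : 1 / 2 ≤ 1 / r := one_div_le_one_div_of_le hr0 hr2
    have hu2 : 2 / r = 2 * (1 / r) := by ring
    rw [hu2] at h2
    have h3 : ((n : ℝ) + 1) * (1 / r) + (n - 1) / 2 < n * (1 / α) := by
      have h4 := mul_lt_mul_of_pos_left h1 hn0
      refine lt_of_eq_of_lt ?_ h4
      field_simp
    have hd : ((n - 1 : ℕ) : ℝ) = n - 1 := by rw [Nat.cast_sub hn, Nat.cast_one]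
    -- The hypothesis on `α` is the stronger one because `1/r ≥ 1/2`; the weaker form yields `1/α >
    -- 1`.
    have hv : 1 / r + 1 / 2 < 1 / α := by
      refine lt_of_mul_lt_mul_left ?_ hn0.le
      linarith
    refine SparseDispersive.exists_sparse_family_bound (d := n - 1) hn hχ one_pos
      (Or.inr (by omega)) hr1 hr2 (by linarith) (by rw [hu2]; exact h2.le) (by rw [hd]; ring) ?_
      (by ring) ?_
    · linarith
    -- At `r = 2` the range for `1/α` would be empty, so `1/r > 1/2` strictly and `κ > 0`.
    · refine mul_pos (by linarith) (sub_pos.2 (lt_of_le_of_ne hu fun h => ?_))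
      rw [← h] at h2 hv
      linarith
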